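/- Fix $h>1$ and let $W(m)=\tfrac12(m_1^2-2hm_1+2h-1)$ for $m=(m_1,m_2)\in\mathbb S^1$. For $m\in H^1_{\mathrm{loc}}(\mathbb R;\mathbb S^1)$ (identified with its continuous representative) put $$E_h(m)=\frac12\int_{-\infty}^{\infty}\bigl(|m'|^2+2W(m)\bigr)\,dx_1+\frac12\int_{\mathbb R\times(0,\infty)}|\nabla u|^2\,dx\in[0,\infty],$$ where $u\in\dot H^1(\mathbb R\times(0,\infty))$, the completion of $C_0^\infty(\mathbb R\times[0,\infty))$ with respect to the inner product $\int\nabla\zeta\cdot\nabla\eta\,dx$, is the unique weak solution of $\Delta u=0$ in $\mathbb R\times(0,\infty)$, $\partial u/\partial x_2=-m_1'$ on $\mathbb R\times\{0\}$, i.e. $\int_{\mathbb R\times(0,\infty)}\nabla u\cdot\nabla\zeta\,dx=\int_{\mathbb R} m_1'\,\zeta(\cdot,0)\,dx_1$ for all $\zeta\in C_0^\infty(\mathbb R^2)$. For $D\in\mathbb Z$ let $\mathcal A_h(D)$ be the set of all $m\in H^1_{\mathrm{loc}}(\mathbb R;\mathbb S^1)$ with $E_h(m)<\infty$ and winding number $D$,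 that is, $m=(\cos\phi,\sin\phi)$ with $\phi$ continuous and $\frac1{2\pi}\bigl(\lim_{x\to+\infty}\phi(x)-\lim_{x\to-\infty}\phi(x)\bigr)=D$. Let $$\Lambda f(x)=\frac1\pi\,\mathrm{PV}\!\int_{-\infty}^{\infty}\frac{f(t)-f(x)}{(t-x)^2}\,dt .$$ **Theorem (exponential decay for $h>1$).** Let $h>1$, let $d\ge1$ be an integer, let $0\le\beta<2$, and let $m=(\cos\phi,\sin\phi)\in\mathcal A_h(-d)$, with $\phi:\mathbb R\to\mathbb R$ continuous, be a minimiser of $E_h$ in $\mathcal A_h(-d)$ such that $\lim_{x\to\infty}\phi(x)=0$. Then $\phi$ is twice continuously differentiable, and there exist $a\in\mathbb R$ and $c,C>0$ such that for all $x\ge a$ $$\phi'(x)\le0\qquad\text{and}\qquad\max\{|\phi(x)|,|\phi'(x)|,|\phi''(x)|\}\le e^{c(a-x)},$$ and such that for all $x>a$ the principal value defining $\Lambda(m_1-1)(x)$ exists and $$|\Lambda(m_1-1)(x)|\le\frac{C}{(x-a)^{\beta}} .$$ -/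

import Mathlib

open Real Set Filter Topology MeasureTheory
open scoped ENNReal ContDiff

noncomputable section

namespace NeelWall

/-- The plane `ℝ²` with its Euclidean norm; values of magnetisations and of gradients. -/
abbrev Plane : Type := EuclideanSpace ℝ (Fin 2)

/-- The components `m₁` (for `i = 0`) and `m₂` (for `i = 1`) of a map `m : ℝ → ℝ²`. -/
def comp (m : ℝ → Plane) (i : Fin 2) : ℝ → ℝ := fun x => m x i

/-- The map `(cos φ, sin φ)` with phase `φ`. -/
def ofPhase (φ : ℝ → ℝ) : ℝ → Plane := fun x => !₂[cos (φ x), sin (φ x)]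

/-- `f` is (the continuous representative of) an element of `H¹_loc(ℝ)`: it is absolutely
continuous on every compact interval, and its derivative, which exists almost everywhere and is
the weak derivative, is square integrable on every compact interval. -/
def MemH1Loc (f : ℝ → ℝ) : Prop :=
  ∀ a b : ℝ, a ≤ b → AbsolutelyContinuousOnInterval f a b ∧
    MemLp (deriv f) 2 (volume.restrict (Icc a b))

/-- `m ∈ H¹_loc(ℝ; 𝕊¹)`. -/
def MemH1LocCircle (m : ℝ → Plane) : Prop :=
  (∀ i, MemH1Loc (comp m i)) ∧ ∀ x, ‖m x‖ = 1

/-- `k = min {h, 1}`. -/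
def wellHeight (h : ℝ) : ℝ := min h 1

/-- The anisotropy potential `W(m) = (m₁² - 2 h m₁ + 2 h k - k²) / 2`. -/
def anisotropy (h : ℝ) (p : Plane) : ℝ :=
  (p 0 ^ 2 - 2 * h * p 0 + 2 * h * wellHeight h - wellHeight h ^ 2) / 2

/-- The open upper half-plane `ℝ × (0, ∞)`. -/
def halfPlane : Set (ℝ × ℝ) := {x | 0 < x.2}

/-- Lebesgue measure on the upper half-plane. -/
def halfPlaneMeasure : Measure (ℝ × ℝ) := volume.restrict halfPlane

/-- Smooth compactly supported functions on `ℝ²`. Their restrictions to the closed half-plane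
are the elements of `C₀^∞` of the closed half-plane. -/
def IsTestFunction (ζ : ℝ × ℝ → ℝ) : Prop := ContDiff ℝ ∞ ζ ∧ HasCompactSupport ζ

/-- The gradient `(∂ζ/∂x₁, ∂ζ/∂x₂)`. -/
def grad (ζ : ℝ × ℝ → ℝ) (x : ℝ × ℝ) : Plane :=
  !₂[fderiv ℝ ζ x (1, 0), fderiv ℝ ζ x (0, 1)]

/-- The homogeneous Sobolev space `Ḣ¹` of the half-plane is the completion of the test functions
with respect to the inner product `∫ ∇ζ · ∇η`. Via the gradient, which determines an element of
the completion, it is the closure in `L²` of the gradients of test functions: `G` is the gradient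
of an element of `Ḣ¹`. -/
def IsHomogeneousSobolevGradient (G : ℝ × ℝ → Plane) : Prop :=
  MemLp G 2 halfPlaneMeasure ∧
    ∀ ε : ℝ≥0∞, 0 < ε → ∃ ζ, IsTestFunction ζ ∧ eLpNorm (G - grad ζ) 2 halfPlaneMeasure < ε

/-- `G = ∇u`, where `u ∈ Ḣ¹` is the stray field potential of a magnetisation with first component
`m₁`: the weak solution of `Δu = 0` in the half-plane with `∂u/∂x₂ = -m₁'` on its boundary, i.e.
`∫ ∇u · ∇ζ dx = ∫ m₁' ζ(·, 0) dx₁` for all test functions `ζ`. -/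
def IsStrayField (m₁ : ℝ → ℝ) (G : ℝ × ℝ → Plane) : Prop :=
  IsHomogeneousSobolevGradient G ∧
    ∀ ζ, IsTestFunction ζ →
      ∫ x, inner ℝ (G x) (grad ζ x) ∂halfPlaneMeasure = ∫ t : ℝ, deriv m₁ t * ζ (t, 0)

/-- The Dirichlet integral `∫ |∇u|² dx` of the stray field potential. The gradient `∇u` is unique
almost everywhere, so that the infimum is over a single value; it is `∞` if there is no stray
field potential. -/
def strayFieldIntegral (m₁ : ℝ → ℝ) : ℝ≥0∞ :=
  ⨅ (G : ℝ × ℝ → Plane) (_ : IsStrayField m₁ G), ∫⁻ x, ‖G x‖ₑ ^ 2 ∂halfPlaneMeasure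

/-- The energy
`E_h(m) = (1/2) ∫ (|m'|² + 2 W(m)) dx₁ + (1/2) ∫ |∇u|² dx`, with values in `[0, ∞]`. -/
def energy (h : ℝ) (m : ℝ → Plane) : ℝ≥0∞ :=
  2⁻¹ * (∫⁻ x, ENNReal.ofReal
      (deriv (comp m 0) x ^ 2 + deriv (comp m 1) x ^ 2 + 2 * anisotropy h (m x))) +
    2⁻¹ * strayFieldIntegral (comp m 0)

/-- `deg(m) = d`: a continuous lifting `φ` of `m` has limits at `±∞`, and
`d = (φ(+∞) - φ(-∞)) / (2π)`. -/
def HasDegree (m : ℝ → Plane) (d : ℝ) : Prop :=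
  ∃ φ : ℝ → ℝ, Continuous φ ∧ m = ofPhase φ ∧
    ∃ p q : ℝ, Tendsto φ atTop (𝓝 p) ∧ Tendsto φ atBot (𝓝 q) ∧ d = (p - q) / (2 * π)

/-- The set `𝒜_h(d)` of all `m ∈ H¹_loc(ℝ; 𝕊¹)` with finite energy and winding number `d`. -/
def admissible (h d : ℝ) : Set (ℝ → Plane) :=
  {m | MemH1LocCircle m ∧ energy h m < ⊤ ∧ HasDegree m d}

/-- `Λf(x) = L` for the Dirichlet-to-Neumann operator `Λ`, given by the principal value
`Λf(x) = (1/π) PV ∫ (f(t) - f(x)) / (t - x)² dt`; this includes existence of the principal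
value. -/
def HasDirichletToNeumann (f : ℝ → ℝ) (x L : ℝ) : Prop :=
  (∀ ε : ℝ, 0 < ε →
    IntegrableOn (fun t => (f t - f x) / (t - x) ^ 2) {t | ε < |t - x|}) ∧
  Tendsto (fun ε : ℝ => 1 / π * ∫ t in {t | ε < |t - x|}, (f t - f x) / (t - x) ^ 2)
    (𝓝[>] 0) (𝓝 L)

end NeelWall

end

noncomputable section

namespace NeelWall

/-! Put q = h - cos φ + Λ(cos φ). A minimiser solves the nonlocal pendulum equation φ'' = q sin φ.
As x → ∞, cos φ → 1 and Λ(cos φ) → 0, so q → h - 1 > 0. A positive solution that tends to 0 is then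
convex and decreasing near +∞ and decays exponentially together with its first two derivatives
(`exists_exp_decay`). Finite energy makes 1 - cos φ integrable; splitting the singular integral at
half the distance to a gives Λ(cos φ - 1) = O((x - a)⁻²) (`exists_dirichletToNeumann_decay`), which
covers every β < 2 once the bounded region near a is treated separately.

Two points need work. One is the Euler–Lagrange equation with its regularity (`euler_lagrange`). For
w in H¹ with compact support, the Cauchy integral of w is holomorphic in the upper half-plane; up to
constant factors its imaginary part is the Poisson extension of w and its real part the conjugate
potential. The square of the Cauchy integral has zero integral over horizontal lines
(`integral_cauchyPow_sq`), so both parts have the same L² norm, at most that of w. Shifted up by y,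
the conjugate potential is the stray field potential of the Poisson extension of w at height y.
Letting y → 0 gives a stray field U of w with ‖U‖² ≤ ‖w'‖ ‖w‖ (`CompactH1.exists_strayField`), and
an L² function g such that the stray field G of cos φ satisfies ∫ G · U = ∫ g w
(`exists_strayField_density`). Under the variation φ + tη the term ‖U‖² is O(t²), whence φ'' = sin φ
(h - cos φ - g) weakly. The right-hand side is in L², so φ' is bounded and Hölder continuous of
exponent 1/2; hence Λ(cos φ) is continuous, g = -Λ(cos φ) almost everywhere, and φ is C².

The other point is the sign of φ (`phase_pos`). Passing from φ to |φ| preserves cos φ, hence the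
stray field, does not increase the rest of the energy, and keeps the limits 2πd at -∞ and 0 at +∞.
So |φ| is a minimiser too and a C² solution. At a zero of φ both |φ| and its derivative vanish, and
uniqueness for the differential equation gives φ = 0 everywhere to the left, against the limit 2πd.
Hence φ > 0. -/

/-! ### Locally absolutely continuous functions. -/

/-- Absolute continuity on every compact interval. -/
def LocallyAC (f : ℝ → ℝ) : Prop := ∀ a b : ℝ, AbsolutelyContinuousOnInterval f a b

namespace LocallyAC

variable {f g : ℝ → ℝ}

lemma of_le (h : ∀ a b : ℝ, a ≤ b → AbsolutelyContinuousOnInterval f a b) : LocallyAC f := by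
  intro a b
  rcases le_total a b with hab | hab
  · exact h a b hab
  · exact (h b a hab).symm

protected lemma continuous (hf : LocallyAC f) : Continuous f := by
  rw [continuous_iff_continuousAt]
  intro x
  have h := (hf (x - 1) (x + 1)).continuousOn
  rw [uIcc_of_le (by linarith)] at h
  exact h.continuousAt (Icc_mem_nhds (by linarith) (by linarith))

lemma ae_differentiableAt (hf : LocallyAC f) : ∀ᵐ x, DifferentiableAt ℝ f x := by
  have h : ∀ n : ℕ, ∀ᵐ x, x ∈ uIcc (-(n : ℝ)) n → DifferentiableAt ℝ f x :=
    fun n => (hf _ _).ae_differentiableAt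
  filter_upwards [ae_all_iff.2 h] with x hx
  obtain ⟨n, hn⟩ := exists_nat_ge |x|
  exact hx n (by rw [uIcc_of_le (by linarith [abs_nonneg x])]; exact abs_le.1 hn)

lemma ae_hasDerivAt (hf : LocallyAC f) : ∀ᵐ x, HasDerivAt f (deriv f x) x :=
  hf.ae_differentiableAt.mono fun _ hx => hx.hasDerivAt

/-- Meant for a phase φ with f = cos φ and g = sin φ. These determine φ only modulo 2π, so the
comparison is available only for values of φ closer than r; uniform continuity on the compact
interval ensures this on short subintervals. -/
lemma of_dist_le {φ : ℝ → ℝ} (hφ : Continuous φ) (hf : LocallyAC f) (hg : LocallyAC g)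
    {K r : ℝ} (hr : 0 < r) (hK : ∀ x y, dist (φ x) (φ y) < r →
      dist (φ x) (φ y) ≤ K * (dist (f x) (f y) + dist (g x) (g y))) : LocallyAC φ := by
  intro a b
  wlog hK0 : 0 < K generalizing K
  · exact this (K := |K| + 1) (fun x y hxy => (hK x y hxy).trans (by
      gcongr
      linarith [le_abs_self K])) (by positivity)
  rw [absolutelyContinuousOnInterval_iff]
  intro ε hε
  have hfg := (hf a b)
  obtain ⟨δ₁, hδ₁, h₁⟩ := (absolutelyContinuousOnInterval_iff f a b).1 (hf a b) (ε / (2 * K))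
    (by positivity)
  obtain ⟨δ₂, hδ₂, h₂⟩ := (absolutelyContinuousOnInterval_iff g a b).1 (hg a b) (ε / (2 * K))
    (by positivity)
  have hu : UniformContinuousOn φ (uIcc a b) :=
    isCompact_uIcc.uniformContinuousOn_of_continuous hφ.continuousOn
  obtain ⟨δ₃, hδ₃, h₃⟩ := Metric.uniformContinuousOn_iff.1 hu r hr
  refine ⟨min δ₁ (min δ₂ δ₃), by positivity, fun E hE hlen => ?_⟩
  have hlen₁ := h₁ E hE (hlen.trans_le (min_le_left _ _))
  have hlen₂ := h₂ E hE (hlen.trans_le ((min_le_right _ _).trans (min_le_left _ _)))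
  have hlen₃ := hlen.trans_le ((min_le_right _ _).trans (min_le_right _ _))
  have key : ∀ i ∈ Finset.range E.1, dist (φ (E.2 i).1) (φ (E.2 i).2) ≤
      K * (dist (f (E.2 i).1) (f (E.2 i).2) + dist (g (E.2 i).1) (g (E.2 i).2)) := by
    intro i hi
    have hmem := hE.1 i hi
    refine hK _ _ (h₃ _ hmem.1 _ hmem.2 (lt_of_le_of_lt ?_ hlen₃))
    exact Finset.single_le_sum (f := fun i => dist (E.2 i).1 (E.2 i).2)
      (fun _ _ => dist_nonneg) hi
  refine (Finset.sum_le_sum key).trans_lt ?_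
  rw [← Finset.mul_sum, Finset.sum_add_distrib]
  calc _ < K * (ε / (2 * K) + ε / (2 * K)) := by gcongr
    _ = ε := by field_simp; ring

lemma lipschitz_comp {K : NNReal} {L : ℝ → ℝ} (hL : LipschitzWith K L) (hf : LocallyAC f) :
    LocallyAC (fun x => L (f x)) := by
  refine of_dist_le (K := K) (r := 1) (hL.continuous.comp hf.continuous) hf hf one_pos
    fun x y _ => (hL.dist_le_mul _ _).trans ?_
  gcongr
  linarith [dist_nonneg (x := f x) (y := f y)]

lemma cos (hf : LocallyAC f) : LocallyAC (fun x => Real.cos (f x)) :=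
  lipschitz_comp (K := 1) (LipschitzWith.of_dist_le_mul fun x y => by
    simpa [Real.dist_eq] using Real.abs_cos_sub_cos_le x y) hf

lemma sin (hf : LocallyAC f) : LocallyAC (fun x => Real.sin (f x)) :=
  lipschitz_comp (K := 1) (LipschitzWith.of_dist_le_mul fun x y => by
    simpa [Real.dist_eq] using Real.abs_sin_sub_sin_le x y) hf

lemma add (hf : LocallyAC f) (hg : LocallyAC g) : LocallyAC (fun x => f x + g x) :=
  fun a b => (hf a b).add (hg a b)

lemma sub (hf : LocallyAC f) (hg : LocallyAC g) : LocallyAC (fun x => f x - g x) :=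
  fun a b => (hf a b).sub (hg a b)

lemma const_mul (c : ℝ) (hf : LocallyAC f) : LocallyAC (fun x => c * f x) :=
  fun a b => (hf a b).const_mul c

lemma of_contDiff (hf : ContDiff ℝ 1 f) : LocallyAC f :=
  fun _ _ => hf.contDiffOn.absolutelyContinuousOnInterval

lemma of_integral {v : ℝ → ℝ} (hv : LocallyIntegrable v) (c : ℝ) :
    LocallyAC (fun x => ∫ t in c..x, v t) := by
  intro a b
  -- The base point c may lie outside the interval between a and b, which is enlarged to contain it.
  have := (IntervalIntegrable.absolutelyContinuousOnInterval_intervalIntegral (f := v)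
    (a := min (min a b) c) (b := max (max a b) c) (c := c)
    (hv.integrableOn_isCompact isCompact_uIcc).intervalIntegrable ?_)
  · refine this.mono ?_
    rw [uIcc_of_le (a := min (min a b) c) ((min_le_right _ _).trans (le_max_right _ _))]
    exact Icc_subset_Icc (min_le_left _ _) (le_max_left _ _)
  · rw [uIcc_of_le ((min_le_right _ _).trans (le_max_right _ _))]
    exact ⟨min_le_right _ _, le_max_right _ _⟩

end LocallyAC

lemma _root_.HasCompactSupport.exists_Ioo_support {E : Type*} [Zero E] {w : ℝ → E}
    (hw : HasCompactSupport w) : ∃ R : ℝ, 0 < R ∧ tsupport w ⊆ Ioo (-R) R := by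
  obtain ⟨R, hR⟩ := hw.isCompact.isBounded.subset_ball_lt 0 0
  exact ⟨R, hR.1, fun x hx => by simpa [Real.ball_eq_Ioo] using hR.2 hx⟩

lemma integral_eq_intervalIntegral {v : ℝ → ℝ} {R : ℝ} (h : tsupport v ⊆ Ioo (-R) R) :
    ∫ x, v x = ∫ x in (-R)..R, v x :=
  (intervalIntegral.integral_eq_integral_of_support_subset
    ((subset_tsupport v).trans (h.trans Ioo_subset_Ioc_self))).symm

/-- Integration by parts on the line when one factor has compact support. -/
lemma LocallyAC.integral_deriv_mul {w g : ℝ → ℝ} (hw : LocallyAC w) (hc : HasCompactSupport w)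
    (hg : LocallyAC g) : ∫ x, deriv w x * g x = -∫ x, w x * deriv g x := by
  obtain ⟨R, hR, hs⟩ := hc.exists_Ioo_support
  have e : ∀ x, x ∉ Ioo (-R) R → w x = 0 := fun x hx => image_eq_zero_of_notMem_tsupport
    fun h => hx (hs h)
  rw [integral_eq_intervalIntegral (R := R), integral_eq_intervalIntegral (R := R),
    AbsolutelyContinuousOnInterval.integral_mul_deriv_eq_deriv_mul (hw _ _) (hg _ _),
    e R (by simp), e (-R) (by simp)]
  · simp
  · exact (tsupport_mul_subset_left).trans hs
  · exact (tsupport_mul_subset_left).trans ((tsupport_deriv_subset (f := w) (𝕜 := ℝ)).trans hs)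

/-! ### Compactly supported H¹ functions. -/

/-- The compactly supported elements of `H¹(ℝ)`. -/
structure CompactH1 (w : ℝ → ℝ) : Prop where
  ac : LocallyAC w
  supp : HasCompactSupport w
  memLp : MemLp (deriv w) 2

namespace CompactH1

variable {w v : ℝ → ℝ}

protected lemma continuous (hw : CompactH1 w) : Continuous w := hw.ac.continuous

lemma integrable (hw : CompactH1 w) : Integrable w :=
  hw.continuous.integrable_of_hasCompactSupport hw.supp

lemma memLp_two (hw : CompactH1 w) : MemLp w 2 :=
  hw.continuous.memLp_of_hasCompactSupport hw.supp

lemma of_contDiff (hw : ContDiff ℝ 1 w) (hc : HasCompactSupport w) : CompactH1 w :=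
  ⟨.of_contDiff hw, hc, (hw.continuous_deriv le_rfl).memLp_of_hasCompactSupport hc.deriv⟩

lemma add (hw : CompactH1 w) (hv : CompactH1 v) : CompactH1 (w + v) :=
  ⟨hw.ac.add hv.ac, hw.supp.add hv.supp, (hw.memLp.add hv.memLp).ae_eq (by
    filter_upwards [hw.ac.ae_hasDerivAt, hv.ac.ae_hasDerivAt] with x h₁ h₂
    exact (h₁.add h₂).deriv.symm)⟩

lemma const_smul (c : ℝ) (hw : CompactH1 w) : CompactH1 (c • w) :=
  ⟨hw.ac.const_mul c, hw.supp.smul_left (f := fun _ => c), (hw.memLp.const_smul c).ae_eq (by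
    filter_upwards [hw.ac.ae_hasDerivAt] with x h₁
    exact (h₁.const_smul c).deriv.symm)⟩

/-- On a set of finite measure L² is contained in L¹: pair the derivative with the indicator of the
support. -/
lemma integrable_deriv (hw : CompactH1 w) : Integrable (deriv w) := by
  have h1 : MemLp ((tsupport w).indicator (fun _ => (1 : ℝ))) 2 :=
    memLp_indicator_const 2 (isClosed_tsupport w).measurableSet 1
      (Or.inr hw.supp.isCompact.measure_lt_top.ne)
  have h2 : Integrable (fun x => deriv w x * (tsupport w).indicator (fun _ => (1 : ℝ)) x) :=
    hw.memLp.integrable_mul h1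
  refine h2.congr (.of_forall fun x => ?_)
  by_cases hx : x ∈ tsupport w
  · simp [hx]
  · have : deriv w x = 0 := image_eq_zero_of_notMem_tsupport fun h =>
      hx (tsupport_deriv_subset (𝕜 := ℝ) h)
    simp [this]

end CompactH1

/-! ### Cauchy integrals in the upper half-plane. -/

/-- The integrals `∫ w(t) (z - t)⁻ⁿ dt`. For `n = 1` this is the Cauchy integral of `w`. -/
def cauchyPow (n : ℕ) (w : ℝ → ℝ) (z : ℂ) : ℂ := ∫ t, (w t : ℂ) / (z - t) ^ n

lemma im_le_norm_sub_ofReal (z : ℂ) (t : ℝ) : z.im ≤ ‖z - t‖ := by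
  have := Complex.abs_im_le_norm (z - t)
  simp only [Complex.sub_im, Complex.ofReal_im, sub_zero] at this
  exact (le_abs_self _).trans this

lemma norm_cauchyPow_integrand_le {n : ℕ} {w : ℝ → ℝ} {z : ℂ} {y : ℝ} (hy : 0 < y)
    (hz : y ≤ z.im) (t : ℝ) : ‖(w t : ℂ) / (z - t) ^ n‖ ≤ |w t| / y ^ n := by
  rw [norm_div, norm_pow, Complex.norm_real, Real.norm_eq_abs]
  gcongr
  exact hz.trans (im_le_norm_sub_ofReal z t)

lemma aestronglyMeasurable_cauchyPow {n : ℕ} {w : ℝ → ℝ} (hw : AEStronglyMeasurable w) (z : ℂ) :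
    AEStronglyMeasurable (fun t : ℝ => (w t : ℂ) / (z - t) ^ n) := by
  have h1 : AEStronglyMeasurable (fun t : ℝ => (w t : ℂ)) :=
    Complex.continuous_ofReal.comp_aestronglyMeasurable hw
  have h2 : AEStronglyMeasurable (fun t : ℝ => (((z - t) ^ n)⁻¹ : ℂ)) := by
    apply Measurable.aestronglyMeasurable
    fun_prop
  simp only [div_eq_mul_inv]
  exact h1.mul h2

lemma integrable_cauchyPow {n : ℕ} {w : ℝ → ℝ} (hw : Integrable w) {z : ℂ} (hz : 0 < z.im) :
    Integrable (fun t : ℝ => (w t : ℂ) / (z - t) ^ n) :=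
  (hw.abs.div_const (z.im ^ n)).mono' (aestronglyMeasurable_cauchyPow hw.1 z)
    (.of_forall fun t => norm_cauchyPow_integrand_le hz le_rfl t)

/-- Differentiation under the integral is legitimate on the ball of radius Im z / 2, where the
distance to the real line stays above Im z / 2. -/
lemma hasDerivAt_cauchyPow (n : ℕ) {w : ℝ → ℝ} (hw : Integrable w) {z : ℂ} (hz : 0 < z.im) :
    HasDerivAt (cauchyPow n w) (-n * cauchyPow (n + 1) w z) z := by
  have him : ∀ x ∈ Metric.ball z (z.im / 2), z.im / 2 ≤ x.im := by
    intro x hx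
    have h1 : |(x - z).im| ≤ ‖x - z‖ := Complex.abs_im_le_norm _
    have h2 : ‖x - z‖ < z.im / 2 := by simpa [dist_eq_norm] using hx
    have := abs_le.1 (h1.trans h2.le)
    simp only [Complex.sub_im] at this
    linarith [this.1]
  have h := (hasDerivAt_integral_of_dominated_loc_of_deriv_le (μ := volume) (𝕜 := ℂ)
    (F := fun z (t : ℝ) => (w t : ℂ) / (z - t) ^ n)
    (F' := fun z (t : ℝ) => -n * ((w t : ℂ) / (z - t) ^ (n + 1)))
    (x₀ := z) (s := Metric.ball z (z.im / 2))
    (bound := fun t => n * (|w t| / (z.im / 2) ^ (n + 1)))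
    (Metric.ball_mem_nhds z (by positivity))
    (.of_forall fun x => aestronglyMeasurable_cauchyPow hw.1 x)
    (integrable_cauchyPow hw hz)
    ((aestronglyMeasurable_cauchyPow hw.1 z).const_mul _) ?_
    ((hw.abs.div_const _).const_mul _) ?_).2
  · rw [integral_const_mul] at h
    exact h
  · refine .of_forall fun t x hx => ?_
    rw [norm_mul, norm_neg, Complex.norm_natCast]
    gcongr
    exact norm_cauchyPow_integrand_le (by positivity) (him x hx) t
  · refine .of_forall fun t x hx => ?_
    have hx0 : x - t ≠ 0 := by
      intro h0
      have := im_le_norm_sub_ofReal x t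
      rw [h0, norm_zero] at this
      linarith [him x hx]
    have h1 : HasDerivAt (fun x : ℂ => x - t) 1 x := (hasDerivAt_id x).sub_const _
    have h2 := ((h1.pow n).inv (pow_ne_zero n hx0)).const_mul (w t : ℂ)
    have h3 : (fun x : ℂ => (w t : ℂ) / (x - t) ^ n) = fun x => (w t : ℂ) * (((fun x : ℂ => x - t) ^ n)⁻¹) x := by
      ext x; simp [div_eq_mul_inv]
    rw [h3]
    refine h2.congr_deriv ?_
    rcases n with _ | n
    · simp
    · simp only [Nat.cast_succ, Nat.add_sub_cancel, mul_one, Pi.pow_apply]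
      field_simp
      ring

lemma cauchyPow_decay (n : ℕ) {w : ℝ → ℝ} (hw : Integrable w) (hc : HasCompactSupport w)
    {y : ℝ} (hy : 0 < y) :
    ∃ K, 0 < K ∧ ∀ z : ℂ, y ≤ z.im → ‖cauchyPow n w z‖ ≤ K / (1 + ‖z‖) ^ n := by
  obtain ⟨R, hR, hs⟩ := hc.exists_Ioo_support
  -- For |t| < R and Im z ≥ y one has 1 + ‖z‖ ≤ (1 + R) + ‖z - t‖ ≤ B ‖z - t‖.
  set B := (1 + R) / y + 1 with hB
  have hB0 : 0 < B := by positivity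
  have hI : 0 ≤ ∫ t, |w t| := integral_nonneg fun _ => abs_nonneg _
  refine ⟨((∫ t, |w t|) + 1) * B ^ n, by positivity, fun z hz => ?_⟩
  have key : ∀ t : ℝ, ‖(w t : ℂ) / (z - t) ^ n‖ ≤ |w t| * (B / (1 + ‖z‖)) ^ n := by
    intro t
    by_cases ht : t ∈ Ioo (-R) R
    · have h1 : y ≤ ‖z - t‖ := hz.trans (im_le_norm_sub_ofReal z t)
      have h2 : ‖z‖ ≤ ‖z - t‖ + R := by
        calc ‖z‖ = ‖(z - t) + t‖ := by simp
          _ ≤ ‖z - t‖ + ‖(t : ℂ)‖ := norm_add_le _ _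
          _ ≤ _ := by
            gcongr
            rw [Complex.norm_real, Real.norm_eq_abs]
            exact (abs_lt.2 ht).le
      have h3 : 1 + ‖z‖ ≤ B * ‖z - t‖ := by
        have : (1 + R) ≤ (1 + R) / y * ‖z - t‖ := by
          rw [div_mul_eq_mul_div, le_div_iff₀ hy]
          gcongr
        rw [hB, add_mul, one_mul]
        linarith
      rw [norm_div, norm_pow, Complex.norm_real, Real.norm_eq_abs, div_eq_mul_inv, ← inv_pow]
      gcongr
      rw [inv_le_comm₀ (by linarith) (by positivity), inv_div, div_le_iff₀ hB0]
      linarith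
    · have : w t = 0 := image_eq_zero_of_notMem_tsupport fun h => ht (hs h)
      simp [this]
  calc ‖cauchyPow n w z‖ ≤ ∫ t, |w t| * (B / (1 + ‖z‖)) ^ n :=
        norm_integral_le_of_norm_le (hw.abs.mul_const _) (.of_forall key)
    _ = (∫ t, |w t|) * B ^ n / (1 + ‖z‖) ^ n := by rw [integral_mul_const, div_pow]; ring
    _ ≤ _ := by gcongr; linarith

/-- The point `x + i y`. -/
def upper (x y : ℝ) : ℂ := ⟨x, y⟩

@[simp] lemma upper_re (x y : ℝ) : (upper x y).re = x := rfl
@[simp] lemma upper_im (x y : ℝ) : (upper x y).im = y := rfl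

lemma upper_eq (x y : ℝ) : upper x y = x + y * Complex.I := Complex.ext (by simp) (by simp)

lemma abs_le_norm_upper (x y : ℝ) : |x| ≤ ‖upper x y‖ := Complex.abs_re_le_norm (upper x y)

lemma hasDerivAt_cauchyPow_fst (n : ℕ) {w : ℝ → ℝ} (hw : Integrable w) (x : ℝ) {y : ℝ}
    (hy : 0 < y) : HasDerivAt (fun x => cauchyPow n w (upper x y))
      (-n * cauchyPow (n + 1) w (upper x y)) x := by
  have h1 : HasDerivAt (fun x => upper x y) 1 x := by
    simp only [upper_eq]
    exact (Complex.ofRealCLM.hasDerivAt (x := x)).add_const _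
  exact ((hasDerivAt_cauchyPow n hw (z := upper x y) hy).comp x h1).congr_deriv (mul_one _)

lemma hasDerivAt_cauchyPow_snd (n : ℕ) {w : ℝ → ℝ} (hw : Integrable w) (x : ℝ) {y : ℝ}
    (hy : 0 < y) : HasDerivAt (fun y => cauchyPow n w (upper x y))
      (-n * cauchyPow (n + 1) w (upper x y) * Complex.I) y := by
  have h1 : HasDerivAt (fun y => upper x y) Complex.I y := by
    simp only [upper_eq]
    simpa using ((Complex.ofRealCLM.hasDerivAt (x := y)).mul_const Complex.I).const_add (x : ℂ)
  exact (hasDerivAt_cauchyPow n hw (z := upper x y) hy).comp y h1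

lemma continuous_cauchyPow_fst (n : ℕ) {w : ℝ → ℝ} (hw : Integrable w) {y : ℝ}
    (hy : 0 < y) : Continuous (fun x => cauchyPow n w (upper x y)) :=
  continuous_iff_continuousAt.2 fun x => (hasDerivAt_cauchyPow_fst n hw x hy).continuousAt

lemma integrable_one_add_abs_inv_sq : Integrable fun x : ℝ => ((1 + |x|) ^ 2)⁻¹ := by
  have := integrable_one_add_norm (E := ℝ) (μ := volume) (r := 2) (by simp)
  refine this.congr (.of_forall fun x => ?_)
  simp only [Real.norm_eq_abs]
  rw [Real.rpow_neg (by positivity)]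
  norm_cast

lemma norm_cauchyPow_upper_le {n : ℕ} {w : ℝ → ℝ} {K y : ℝ} (hK : 0 < K)
    (h : ∀ z : ℂ, y ≤ z.im → ‖cauchyPow n w z‖ ≤ K / (1 + ‖z‖) ^ n) (x : ℝ) {s : ℝ} (hs : y ≤ s) :
    ‖cauchyPow n w (upper x s)‖ ≤ K / (1 + |x|) ^ n := by
  refine (h _ hs).trans ?_
  gcongr
  exact abs_le_norm_upper x s

/-- The square of the Cauchy integral has vanishing integral over horizontal lines. -/
lemma integral_cauchyPow_sq {w : ℝ → ℝ} (hw : Integrable w) (hc : HasCompactSupport w)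
    {y : ℝ} (hy : 0 < y) : ∫ x, cauchyPow 1 w (upper x y) ^ 2 = 0 := by
  have hmeas : ∀ y : ℝ, 0 < y → AEStronglyMeasurable (fun x => cauchyPow 1 w (upper x y) ^ 2) :=
    fun y hy => ((continuous_cauchyPow_fst 1 hw hy).pow 2).aestronglyMeasurable
  have hb : ∀ y : ℝ, 0 < y → ∃ K, 0 < K ∧ ∀ x s, y ≤ s →
      ‖cauchyPow 1 w (upper x s) ^ 2‖ ≤ K * ((1 + |x|) ^ 2)⁻¹ := by
    intro y hy
    obtain ⟨K, hK, h⟩ := cauchyPow_decay 1 hw hc hy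
    refine ⟨K ^ 2, by positivity, fun x s hs => ?_⟩
    have := norm_cauchyPow_upper_le hK h x hs
    rw [norm_pow, ← div_eq_mul_inv, ← div_pow]
    rw [pow_one] at this
    gcongr
  -- By holomorphy the derivative in the height is i times the derivative along the line, and the
  -- latter integrates to zero because the function decays at both ends.
  have hd : ∀ y ∈ Ioi (0 : ℝ), HasDerivAt (fun y => ∫ x, cauchyPow 1 w (upper x y) ^ 2) 0 y := by
    intro y hy
    simp only [mem_Ioi] at hy
    obtain ⟨K₁, hK₁, h₁⟩ := cauchyPow_decay 1 hw hc (half_pos hy)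
    obtain ⟨K₂, hK₂, h₂⟩ := cauchyPow_decay 2 hw hc (half_pos hy)
    obtain ⟨K, hK, hKb⟩ := hb y hy
    have hbound : ∀ x s, y / 2 ≤ s → ‖2 * cauchyPow 1 w (upper x s) *
        (-cauchyPow 2 w (upper x s))‖ ≤ 2 * K₁ * K₂ * ((1 + |x|) ^ 2)⁻¹ := by
      intro x s hs
      rw [norm_mul, norm_mul, norm_neg]
      have e1 := norm_cauchyPow_upper_le hK₁ h₁ x hs
      have e2 := norm_cauchyPow_upper_le hK₂ h₂ x hs
      have e3 : K₁ / (1 + |x|) ^ 1 ≤ K₁ := by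
        apply div_le_self hK₁.le; simp
      calc _ ≤ 2 * K₁ * (K₂ / (1 + |x|) ^ 2) := by
            gcongr
            · simp
            · exact e1.trans e3
        _ = _ := by rw [div_eq_mul_inv]; ring
    have hx : ∀ x, HasDerivAt (fun x => cauchyPow 1 w (upper x y) ^ 2)
        (2 * cauchyPow 1 w (upper x y) * (-cauchyPow 2 w (upper x y))) x := by
      intro x
      exact ((hasDerivAt_cauchyPow_fst 1 hw x hy).pow 2).congr_deriv (by simp)
    have hint : Integrable fun x => 2 * cauchyPow 1 w (upper x y) * (-cauchyPow 2 w (upper x y)) :=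
      (integrable_one_add_abs_inv_sq.const_mul _).mono'
        (((continuous_const.mul (continuous_cauchyPow_fst 1 hw hy)).mul
          (continuous_cauchyPow_fst 2 hw hy).neg).aestronglyMeasurable)
        (.of_forall fun x => hbound x y (by linarith))
    have hlim : ∀ l : Filter ℝ, Tendsto (fun x : ℝ => |x|) l atTop →
        Tendsto (fun x => cauchyPow 1 w (upper x y) ^ 2) l (𝓝 0) := by
      intro l hl
      refine squeeze_zero_norm (fun x => hKb x y le_rfl) ?_
      have : Tendsto (fun x : ℝ => ((1 + |x|) ^ 2)⁻¹) l (𝓝 0) :=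
        tendsto_inv_atTop_zero.comp ((tendsto_pow_atTop two_ne_zero).comp
          (tendsto_atTop_add_const_left _ _ hl))
      simpa using this.const_mul K
    have hzero := integral_of_hasDerivAt_of_tendsto hx hint (hlim _ tendsto_abs_atBot_atTop)
      (hlim _ tendsto_abs_atTop_atTop)
    have h := (hasDerivAt_integral_of_dominated_loc_of_deriv_le (μ := volume) (𝕜 := ℝ)
      (F := fun y x => cauchyPow 1 w (upper x y) ^ 2)
      (F' := fun y x => 2 * cauchyPow 1 w (upper x y) * (-cauchyPow 2 w (upper x y)) * Complex.I)
      (x₀ := y) (s := Ioi (y / 2)) (bound := fun x => 2 * K₁ * K₂ * ((1 + |x|) ^ 2)⁻¹)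
      (Ioi_mem_nhds (by linarith))
      ((eventually_gt_nhds hy).mono fun s hs => hmeas s hs)
      ((integrable_one_add_abs_inv_sq.const_mul K).mono' (hmeas y hy)
        (.of_forall fun x => hKb x y le_rfl))
      ((hint.mul_const _).1) ?_ (integrable_one_add_abs_inv_sq.const_mul _) ?_).2
    · rw [integral_mul_const, hzero] at h
      simpa using h
    · refine .of_forall fun x s hs => ?_
      rw [norm_mul, Complex.norm_I, mul_one]
      exact hbound x s (le_of_lt hs)
    · refine .of_forall fun x s hs => ?_
      have := (hasDerivAt_cauchyPow_snd 1 hw x (y := s) ((half_pos hy).trans hs)).pow 2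
      refine this.congr_deriv ?_
      simp
      ring
  have hconst : ∀ s ∈ Ioi (0 : ℝ), ∫ x, cauchyPow 1 w (upper x s) ^ 2 =
      ∫ x, cauchyPow 1 w (upper x y) ^ 2 := by
    intro s hs
    have := (convex_Ioi (0 : ℝ)).is_const_of_fderivWithin_eq_zero (𝕜 := ℝ)
      (f := fun y => ∫ x, cauchyPow 1 w (upper x y) ^ 2)
      (fun s hs => (hd s hs).differentiableAt.differentiableWithinAt)
      (fun s hs => by
        rw [fderivWithin_of_isOpen isOpen_Ioi hs]
        ext
        simpa using (hd s hs).deriv) hs (show y ∈ Ioi 0 from hy)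
    exact this
  obtain ⟨K, hK, h⟩ := cauchyPow_decay 1 hw hc one_pos
  obtain ⟨K', hK', h'⟩ := hb 1 one_pos
  -- The integral does not depend on the height, and it tends to zero as the height tends to
  -- infinity.
  have ht : Tendsto (fun s : ℝ => ∫ x, cauchyPow 1 w (upper x s) ^ 2) atTop
      (𝓝 (∫ _ : ℝ, (0 : ℂ))) := by
    refine tendsto_integral_filter_of_dominated_convergence
      (fun x => K' * ((1 + |x|) ^ 2)⁻¹)
      ((eventually_gt_atTop 0).mono fun s hs => hmeas s hs)
      ((eventually_ge_atTop 1).mono fun s hs => .of_forall fun x => h' x s hs)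
      (integrable_one_add_abs_inv_sq.const_mul _) (.of_forall fun x => ?_)
    have : Tendsto (fun s => cauchyPow 1 w (upper x s)) atTop (𝓝 0) := by
      refine squeeze_zero_norm' ((eventually_ge_atTop 1).mono fun s hs => h _ hs) ?_
      have h3 : Tendsto (fun s : ℝ => 1 + ‖upper x s‖) atTop atTop :=
        tendsto_atTop_mono (fun s => (by
          have := Complex.abs_im_le_norm (upper x s)
          simp only [upper_im] at this
          linarith [le_abs_self s] : s ≤ 1 + ‖upper x s‖)) tendsto_id
      simpa using tendsto_const_nhds.div_atTop h3
    simpa using this.pow 2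
  rw [integral_zero] at ht
  refine tendsto_nhds_unique (tendsto_const_nhds.congr' ?_) ht
  filter_upwards [eventually_gt_atTop 0] with s hs using (hconst s hs).symm

/-- The Cauchy–Schwarz inequality for integrals. -/
lemma abs_integral_mul_le {α : Type*} [MeasurableSpace α] {μ : Measure α} {f g : α → ℝ}
    (hf : MemLp f 2 μ) (hg : MemLp g 2 μ) :
    |∫ x, f x * g x ∂μ| ≤ √(∫ x, f x ^ 2 ∂μ) * √(∫ x, g x ^ 2 ∂μ) := by
  have h := integral_mul_norm_le_Lp_mul_Lq (μ := μ) (f := f) (g := g) (p := 2) (q := 2)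
    Real.HolderConjugate.two_two (by simpa using hf) (by simpa using hg)
  simp only [Real.norm_eq_abs, ← Real.sqrt_eq_rpow, Real.rpow_two, sq_abs] at h
  refine (abs_integral_le_integral_abs).trans ?_
  simpa only [abs_mul] using h

/-! ### The Poisson kernel and its contraction property on L². -/

/-- The Poisson kernel of the upper half-plane. -/
def poissonKer (y x : ℝ) : ℝ := y / (π * (x ^ 2 + y ^ 2))

lemma poissonKer_nonneg {y : ℝ} (hy : 0 < y) (x : ℝ) : 0 ≤ poissonKer y x := by
  unfold poissonKer; positivity

lemma poissonKer_le {y : ℝ} (hy : 0 < y) (x : ℝ) : poissonKer y x ≤ 1 / (π * y) := by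
  unfold poissonKer
  rw [div_le_div_iff₀ (by positivity) (by positivity)]
  nlinarith [mul_nonneg Real.pi_pos.le (sq_nonneg x)]

lemma continuous_poissonKer {y : ℝ} (hy : 0 < y) : Continuous (poissonKer y) := by
  unfold poissonKer
  refine continuous_const.div (by fun_prop) fun x => by positivity

lemma poissonKer_eq {y : ℝ} (hy : 0 < y) (x : ℝ) :
    poissonKer y x = 1 / (π * y) * (1 + (x / y) ^ 2)⁻¹ := by
  unfold poissonKer
  field_simp
  ring

lemma integrable_poissonKer {y : ℝ} (hy : 0 < y) : Integrable (poissonKer y) := by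
  have := (integrable_inv_one_add_sq.comp_div hy.ne').const_mul (1 / (π * y))
  exact this.congr (.of_forall fun x => (poissonKer_eq hy x).symm)

lemma integral_poissonKer {y : ℝ} (hy : 0 < y) : ∫ x, poissonKer y x = 1 := by
  simp_rw [poissonKer_eq hy]
  rw [integral_const_mul, Measure.integral_comp_div (fun x => (1 + x ^ 2)⁻¹),
    integral_univ_inv_one_add_sq, abs_of_pos hy, smul_eq_mul]
  field_simp

/-- The Poisson extension of `v` on the line at height `y`. -/
def poisson (y : ℝ) (v : ℝ → ℝ) (x : ℝ) : ℝ := ∫ t, v t * poissonKer y (x - t)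

lemma integrable_mul_poissonKer {v : ℝ → ℝ} (hv : Integrable v) {y : ℝ} (hy : 0 < y) (x : ℝ) :
    Integrable fun t => v t * poissonKer y (x - t) :=
  hv.mul_bdd (c := 1 / (π * y))
    ((continuous_poissonKer hy).comp (by fun_prop)).aestronglyMeasurable
    (.of_forall fun t => by
      rw [Real.norm_eq_abs, abs_of_nonneg (poissonKer_nonneg hy _)]
      exact poissonKer_le hy _)

lemma integrable_poisson {v : ℝ → ℝ} (hv : Integrable v) {y : ℝ} (hy : 0 < y) :
    Integrable (poisson y v) :=
  hv.integrable_convolution (ContinuousLinearMap.mul ℝ ℝ) (integrable_poissonKer hy)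

lemma integral_poisson {v : ℝ → ℝ} (hv : Integrable v) {y : ℝ} (hy : 0 < y) :
    ∫ x, poisson y v x = ∫ x, v x := by
  have := integral_convolution (ContinuousLinearMap.mul ℝ ℝ) (ν := volume) (μ := volume) hv
    (integrable_poissonKer hy)
  rw [integral_poissonKer hy] at this
  exact this.trans (by simp)

lemma integral_poissonKer_sub {y : ℝ} (hy : 0 < y) (x : ℝ) :
    ∫ t, poissonKer y (x - t) = 1 := by
  rw [integral_sub_left_eq_self (poissonKer y), integral_poissonKer hy]

/-- Jensen's inequality for the probability density given by the kernel: expand the average of (v -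
c)², with c the mean of v. -/
lemma poisson_sq_le {v : ℝ → ℝ} (hv : Integrable v) (hv2 : MemLp v 2) {y : ℝ} (hy : 0 < y)
    (x : ℝ) : poisson y v x ^ 2 ≤ poisson y (fun t => v t ^ 2) x := by
  set c := poisson y v x
  have h1 := (integrable_mul_poissonKer hv hy x).const_mul (2 * c)
  have h2 := integrable_mul_poissonKer hv2.integrable_sq hy x
  have h3 := ((integrable_poissonKer hy).comp_sub_left x).const_mul (c ^ 2)
  have key : 0 ≤ ∫ t, (v t ^ 2 * poissonKer y (x - t) - 2 * c * (v t * poissonKer y (x - t)) +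
      c ^ 2 * poissonKer y (x - t)) := by
    refine integral_nonneg fun t => ?_
    have : 0 ≤ (v t - c) ^ 2 * poissonKer y (x - t) :=
      mul_nonneg (sq_nonneg _) (poissonKer_nonneg hy _)
    simp only [Pi.zero_apply]
    linarith
  have h21 : Integrable fun t =>
      v t ^ 2 * poissonKer y (x - t) - 2 * c * (v t * poissonKer y (x - t)) := h2.sub h1
  rw [integral_add h21 h3, integral_sub h2 h1, integral_const_mul, integral_const_mul,
    integral_poissonKer_sub hy] at key
  have : ∫ t, v t * poissonKer y (x - t) = c := rfl
  rw [this] at key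
  have : ∫ t, v t ^ 2 * poissonKer y (x - t) = poisson y (fun t => v t ^ 2) x := rfl
  rw [this] at key
  linarith

lemma memLp_poisson {v : ℝ → ℝ} (hv : Integrable v) (hv2 : MemLp v 2) {y : ℝ} (hy : 0 < y) :
    MemLp (poisson y v) 2 := by
  rw [memLp_two_iff_integrable_sq (integrable_poisson hv hy).1]
  exact (integrable_poisson hv2.integrable_sq hy).mono' ((integrable_poisson hv hy).1.pow 2)
    (.of_forall fun x => by
      rw [Real.norm_eq_abs, abs_of_nonneg (sq_nonneg _)]
      exact poisson_sq_le hv hv2 hy x)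

lemma integral_poisson_sq_le {v : ℝ → ℝ} (hv : Integrable v) (hv2 : MemLp v 2) {y : ℝ}
    (hy : 0 < y) : ∫ x, poisson y v x ^ 2 ≤ ∫ x, v x ^ 2 := by
  rw [← integral_poisson hv2.integrable_sq hy]
  exact integral_mono (memLp_poisson hv hv2 hy).integrable_sq
    (integrable_poisson hv2.integrable_sq hy) (poisson_sq_le hv hv2 hy)

lemma tendsto_poisson {v : ℝ → ℝ} (hv : Integrable v) {x : ℝ} (hx : ContinuousAt v x) :
    Tendsto (fun y => poisson y v x) (𝓝[>] 0) (𝓝 (v x)) := by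
  -- The kernels are the dilates of the one at height 1, and the dilation parameter is 1 / y.
  have h := tendsto_integral_comp_smul_smul_of_integrable' (μ := volume) (φ := poissonKer 1)
    (poissonKer_nonneg one_pos) (integral_poissonKer one_pos) ?_ hv hx
  · have h2 := h.comp tendsto_inv_nhdsGT_zero
    refine h2.congr' ?_
    filter_upwards [self_mem_nhdsWithin] with y hy
    simp only [mem_Ioi] at hy
    simp only [Function.comp, poisson, Module.finrank_self, pow_one, smul_eq_mul]
    refine integral_congr_ae (.of_forall fun t => ?_)
    simp only [poissonKer]
    field_simp
  · simp only [Module.finrank_self, pow_one]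
    have h1 : Tendsto (fun x : ℝ => ‖x‖⁻¹) (Bornology.cobounded ℝ) (𝓝 0) :=
      tendsto_inv_atTop_zero.comp tendsto_norm_cobounded_atTop
    refine squeeze_zero (fun x => by have := poissonKer_nonneg one_pos x; positivity)
      (fun x => ?_) h1
    rcases eq_or_ne x 0 with rfl | hx
    · simp
    have hx' : 0 < |x| := abs_pos.2 hx
    unfold poissonKer
    rw [Real.norm_eq_abs, ← sq_abs x, ← mul_div_assoc, ← one_div, div_le_div_iff₀
      (by positivity) (by positivity)]
    nlinarith [Real.pi_gt_three, sq_nonneg |x|]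

lemma abs_poisson_le {v : ℝ → ℝ} {M : ℝ} (hM : ∀ t, |v t| ≤ M) {y : ℝ} (hy : 0 < y) (x : ℝ) :
    |poisson y v x| ≤ M := by
  calc |poisson y v x| ≤ ∫ t, M * poissonKer y (x - t) := by
        have hi := ((integrable_poissonKer hy).comp_sub_left x).const_mul M
        refine norm_integral_le_of_norm_le (f := fun t => v t * poissonKer y (x - t)) hi
          (.of_forall fun t => ?_)
        rw [Real.norm_eq_abs, abs_mul, abs_of_nonneg (poissonKer_nonneg hy _)]
        exact mul_le_mul_of_nonneg_right (hM t) (poissonKer_nonneg hy _)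
    _ = M := by rw [integral_const_mul, integral_poissonKer_sub hy, mul_one]

/-! ### The conjugate harmonic function. -/

lemma im_cauchyPow_one {w : ℝ → ℝ} (hw : Integrable w) (x : ℝ) {y : ℝ} (hy : 0 < y) :
    (cauchyPow 1 w (upper x y)).im = -π * poisson y w x := by
  have hI : Integrable fun t : ℝ => (w t : ℂ) / (upper x y - t) ^ 1 := integrable_cauchyPow hw hy
  have h := Complex.imCLM.integral_comp_comm hI
  have h' : (cauchyPow 1 w (upper x y)).im = ∫ t, ((w t : ℂ) / (upper x y - t) ^ 1).im := h.symm
  rw [h', poisson, ← integral_const_mul]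
  refine integral_congr_ae (.of_forall fun t => ?_)
  simp only [poissonKer, pow_one, Complex.div_im, Complex.sub_re, Complex.sub_im, upper_re,
    upper_im, Complex.ofReal_re, Complex.ofReal_im, Complex.normSq_apply, sub_zero, zero_mul,
    zero_div, zero_sub]
  field_simp

/-- The harmonic function conjugate to the Poisson extension of `w`. -/
def conjPotential (w : ℝ → ℝ) (x y : ℝ) : ℝ := -(1 / π) * (cauchyPow 1 w (upper x y)).re

lemma continuous_conjPotential {w : ℝ → ℝ} (hw : Integrable w) {y : ℝ} (hy : 0 < y) :
    Continuous fun x => conjPotential w x y :=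
  continuous_const.mul (Complex.continuous_re.comp (continuous_cauchyPow_fst 1 hw hy))

lemma conjPotential_decay {w : ℝ → ℝ} (hw : Integrable w) (hc : HasCompactSupport w)
    {y : ℝ} (hy : 0 < y) :
    ∃ K, 0 < K ∧ ∀ x s, y ≤ s → |conjPotential w x s| ≤ K / (1 + |x|) := by
  obtain ⟨K, hK, h⟩ := cauchyPow_decay 1 hw hc hy
  refine ⟨K, hK, fun x s hs => ?_⟩
  have h1 := norm_cauchyPow_upper_le hK h x hs
  rw [pow_one] at h1
  refine le_trans ?_ h1
  rw [conjPotential, abs_mul, abs_neg, abs_of_pos (by positivity)]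
  have h2 : 1 / π ≤ 1 := by
    rw [div_le_one Real.pi_pos]; linarith [Real.pi_gt_three]
  calc _ ≤ 1 * |(cauchyPow 1 w (upper x s)).re| := by gcongr
    _ ≤ _ := by rw [one_mul]; exact Complex.abs_re_le_norm _

lemma memLp_of_decay {v : ℝ → ℝ} (hv : Continuous v) {K : ℝ}
    (h : ∀ x, |v x| ≤ K / (1 + |x|)) : MemLp v 2 := by
  rw [memLp_two_iff_integrable_sq hv.aestronglyMeasurable]
  refine (integrable_one_add_abs_inv_sq.const_mul (K ^ 2)).mono'
    (hv.pow 2).aestronglyMeasurable (.of_forall fun x => ?_)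
  rw [Real.norm_eq_abs, abs_of_nonneg (sq_nonneg _), ← sq_abs, ← div_eq_mul_inv, ← div_pow]
  have := h x
  gcongr

lemma memLp_conjPotential {w : ℝ → ℝ} (hw : Integrable w) (hc : HasCompactSupport w)
    {y : ℝ} (hy : 0 < y) : MemLp (fun x => conjPotential w x y) 2 := by
  obtain ⟨K, -, h⟩ := conjPotential_decay hw hc hy
  exact memLp_of_decay (continuous_conjPotential hw hy) fun x => h x y le_rfl

/-- This is the L² bound for the Hilbert transform with constant 1. The real part of the square of
the Cauchy integral is π² times the difference of the two squared densities, and its integral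
vanishes. -/
lemma integral_conjPotential_sq_le {w : ℝ → ℝ} (hw : Integrable w) (hw2 : MemLp w 2)
    (hc : HasCompactSupport w) {y : ℝ} (hy : 0 < y) :
    ∫ x, conjPotential w x y ^ 2 ≤ ∫ x, w x ^ 2 := by
  refine le_trans (le_of_eq ?_) (integral_poisson_sq_le hw hw2 hy)
  have h1 := (memLp_conjPotential hw hc hy).integrable_sq
  have h2 := (memLp_poisson hw hw2 hy).integrable_sq
  rw [← sub_eq_zero, ← integral_sub h1 h2]
  have h0 := integral_cauchyPow_sq hw hc hy
  have hre : ∀ x, (cauchyPow 1 w (upper x y) ^ 2).re =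
      π ^ 2 * (conjPotential w x y ^ 2 - poisson y w x ^ 2) := by
    intro x
    have := im_cauchyPow_one hw x hy
    rw [sq, Complex.mul_re, this, conjPotential]
    field_simp
  have hint : Integrable fun x => cauchyPow 1 w (upper x y) ^ 2 := by
    obtain ⟨K, hK, h⟩ := cauchyPow_decay 1 hw hc hy
    refine (integrable_one_add_abs_inv_sq.const_mul (K ^ 2)).mono'
      ((continuous_cauchyPow_fst 1 hw hy).pow 2).aestronglyMeasurable (.of_forall fun x => ?_)
    have := norm_cauchyPow_upper_le hK h x le_rfl
    rw [norm_pow, ← div_eq_mul_inv, ← div_pow]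
    rw [pow_one] at this
    gcongr
  have h3 := Complex.reCLM.integral_comp_comm hint
  simp only [Complex.reCLM_apply] at h3
  rw [h0] at h3
  simp_rw [hre] at h3
  rw [integral_const_mul] at h3
  have : π ^ 2 ≠ 0 := by positivity
  simpa [this] using h3

/-- The derivative of the Poisson extension is the Poisson extension of the derivative. -/
lemma im_cauchyPow_two {w : ℝ → ℝ} (hw : CompactH1 w) (x : ℝ) {y : ℝ} (hy : 0 < y) :
    (cauchyPow 2 w (upper x y)).im = π * poisson y (deriv w) x := by
  have hz : ∀ t : ℝ, upper x y - t ≠ 0 := fun t h0 => by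
    have := congrArg Complex.im h0
    simp at this
    exact hy.ne' this
  have hI : Integrable fun t : ℝ => (w t : ℂ) / (upper x y - t) ^ 2 :=
    integrable_cauchyPow hw.integrable hy
  have h := Complex.imCLM.integral_comp_comm hI
  have h' : (cauchyPow 2 w (upper x y)).im = ∫ t, ((w t : ℂ) / (upper x y - t) ^ 2).im := h.symm
  -- The imaginary part of (z - t)⁻² is the t-derivative of the imaginary part of (z - t)⁻¹;
  -- integration by parts then moves the derivative onto w.
  have hd : ∀ t : ℝ, HasDerivAt (fun t : ℝ => -π * poissonKer y (x - t))
      (((1 : ℂ) / (upper x y - t) ^ 2).im) t := by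
    intro t
    have h1 : HasDerivAt (fun t : ℝ => (upper x y - (t : ℂ))⁻¹) (1 / (upper x y - t) ^ 2) t := by
      have h2 := ((Complex.ofRealCLM.hasDerivAt (x := t)).const_sub (upper x y)).inv (hz t)
      refine h2.congr_deriv ?_
      simp
    have h3 := (Complex.imCLM.hasFDerivAt.comp_hasDerivAt t h1)
    refine h3.congr_of_eventuallyEq (.of_forall fun s => ?_)
    simp only [Complex.imCLM_apply, Function.comp, poissonKer, Complex.inv_im,
      Complex.normSq_apply, Complex.sub_re, Complex.sub_im, upper_re, upper_im,
      Complex.ofReal_re, Complex.ofReal_im, sub_zero]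
    field_simp
  have hc : Continuous fun t : ℝ => ((1 : ℂ) / (upper x y - t) ^ 2).im :=
    Complex.continuous_im.comp (continuous_const.div (by fun_prop) fun t => pow_ne_zero _ (hz t))
  have hg : LocallyAC (fun t : ℝ => -π * poissonKer y (x - t)) := by
    refine .of_contDiff (contDiff_one_iff_deriv.2 ⟨fun t => (hd t).differentiableAt, ?_⟩)
    rwa [show deriv (fun t : ℝ => -π * poissonKer y (x - t)) = _ from funext fun t => (hd t).deriv]
  have hp := hw.ac.integral_deriv_mul hw.supp hg
  simp_rw [fun t => (hd t).deriv] at hp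
  rw [h', poisson, ← integral_const_mul]
  have e1 : ∀ t, ((w t : ℂ) / (upper x y - t) ^ 2).im = w t * ((1 : ℂ) / (upper x y - t) ^ 2).im :=
    fun t => by
      rw [← Complex.im_ofReal_mul, mul_one_div]
  simp_rw [e1]
  rw [← neg_eq_iff_eq_neg.2 hp, ← integral_neg]
  refine integral_congr_ae (.of_forall fun t => ?_)
  simp only
  ring

/-! ### The shifted potential. -/

/-- The harmonic function conjugate to the Poisson extension of `w`, shifted by `y` and cut off
below the half-plane, where it would become singular. -/
def shiftedPotential (w : ℝ → ℝ) (y : ℝ) (x : ℝ × ℝ) : ℝ :=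
  smoothTransition (2 / y * x.2 + 1) * conjPotential w x.1 (x.2 + y)

lemma contDiffOn_cauchyPow (n : ℕ) {w : ℝ → ℝ} (hw : Integrable w) :
    ContDiffOn ℝ ∞ (cauchyPow n w) {z | 0 < z.im} := by
  have ho : IsOpen {z : ℂ | 0 < z.im} := isOpen_lt continuous_const Complex.continuous_im
  have h : DifferentiableOn ℂ (cauchyPow n w) {z | 0 < z.im} := fun z hz =>
    (hasDerivAt_cauchyPow n hw hz).differentiableAt.differentiableWithinAt
  exact (h.contDiffOn (n := ∞) ho).restrict_scalars ℝ

lemma contDiff_upper (y : ℝ) : ContDiff ℝ ∞ fun x : ℝ × ℝ => upper x.1 (x.2 + y) := by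
  simp only [upper_eq]
  have h : ContDiff ℝ ∞ (fun t : ℝ => (t : ℂ)) := Complex.ofRealCLM.contDiff
  exact (h.comp contDiff_fst).add ((h.comp (contDiff_snd.add contDiff_const)).mul contDiff_const)

lemma contDiffAt_cauchyPow_upper (n : ℕ) {w : ℝ → ℝ} (hw : Integrable w) {y : ℝ} {x : ℝ × ℝ}
    (hx : 0 < x.2 + y) : ContDiffAt ℝ ∞ (fun x : ℝ × ℝ => cauchyPow n w (upper x.1 (x.2 + y))) x := by
  have ho : IsOpen {z : ℂ | 0 < z.im} := isOpen_lt continuous_const Complex.continuous_im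
  have h : ContDiffAt ℝ ∞ (cauchyPow n w) (upper x.1 (x.2 + y)) :=
    (contDiffOn_cauchyPow n hw).contDiffAt (ho.mem_nhds hx)
  exact ContDiffAt.comp (g := cauchyPow n w) x h (contDiff_upper y).contDiffAt

lemma contDiffAt_conjPotential {w : ℝ → ℝ} (hw : Integrable w) {y : ℝ} {x : ℝ × ℝ}
    (hx : 0 < x.2 + y) : ContDiffAt ℝ ∞ (fun x : ℝ × ℝ => conjPotential w x.1 (x.2 + y)) x :=
  contDiffAt_const.mul (Complex.reCLM.contDiff.contDiffAt.comp x (contDiffAt_cauchyPow_upper 1 hw hx))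

/-- The conjugate potential is smooth for x₂ > -y, and the cut-off factor vanishes for x₂ ≤ -y/2;
these two regions overlap and cover the plane. -/
lemma contDiff_shiftedPotential {w : ℝ → ℝ} (hw : Integrable w) {y : ℝ} (hy : 0 < y) :
    ContDiff ℝ ∞ (shiftedPotential w y) := by
  rw [contDiff_iff_contDiffAt]
  intro x
  rcases lt_or_ge (-y) x.2 with hx | hx
  · exact (smoothTransition.contDiff.contDiffAt.comp x (by fun_prop)).mul
      (contDiffAt_conjPotential hw (by linarith))
  · refine (contDiffAt_const (c := (0 : ℝ))).congr_of_eventuallyEq ?_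
    have : ∀ᶠ z : ℝ × ℝ in 𝓝 x, z.2 < -(y / 2) :=
      (continuous_snd.tendsto x).eventually_lt_const (by linarith)
    filter_upwards [this] with z hz
    rw [shiftedPotential, smoothTransition.zero_of_nonpos, zero_mul]
    rw [← le_neg_iff_add_nonpos_right, div_mul_eq_mul_div, div_le_iff₀ hy]
    linarith

lemma shiftedPotential_eq {w : ℝ → ℝ} {y : ℝ} (hy : 0 < y) {x : ℝ × ℝ} (hx : 0 ≤ x.2) :
    shiftedPotential w y x = conjPotential w x.1 (x.2 + y) := by
  rw [shiftedPotential, smoothTransition.one_of_one_le, one_mul]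
  have : 0 ≤ 2 / y * x.2 := by positivity
  linarith

lemma fderiv_apply_fst {ζ : ℝ × ℝ → ℝ} {x : ℝ × ℝ} (h : DifferentiableAt ℝ ζ x) :
    HasDerivAt (fun t => ζ (t, x.2)) (fderiv ℝ ζ x (1, 0)) x.1 :=
  HasFDerivAt.comp_hasDerivAt (l := ζ) (l' := fderiv ℝ ζ x) x.1 h.hasFDerivAt
    ((hasDerivAt_id x.1).prodMk (hasDerivAt_const x.1 x.2))

lemma fderiv_apply_snd {ζ : ℝ × ℝ → ℝ} {x : ℝ × ℝ} (h : DifferentiableAt ℝ ζ x) :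
    HasDerivAt (fun t => ζ (x.1, t)) (fderiv ℝ ζ x (0, 1)) x.2 :=
  HasFDerivAt.comp_hasDerivAt (l := ζ) (l' := fderiv ℝ ζ x) x.2 h.hasFDerivAt
    ((hasDerivAt_const x.2 x.1).prodMk (hasDerivAt_id x.2))

/-- The components of the gradient of the shifted potential in the half-plane. -/
lemma grad_shiftedPotential {w : ℝ → ℝ} (hw : Integrable w) {y : ℝ} (hy : 0 < y) {x : ℝ × ℝ}
    (hx : 0 < x.2) : grad (shiftedPotential w y) x =
      !₂[1 / π * (cauchyPow 2 w (upper x.1 (x.2 + y))).re,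
        -(1 / π) * (cauchyPow 2 w (upper x.1 (x.2 + y))).im] := by
  have hd := ((contDiff_shiftedPotential hw hy).differentiable (by simp)) x
  have h1 := fderiv_apply_fst hd
  have h2 := fderiv_apply_snd hd
  have e1 : HasDerivAt (fun t => shiftedPotential w y (t, x.2))
      (1 / π * (cauchyPow 2 w (upper x.1 (x.2 + y))).re) x.1 := by
    have := (Complex.reCLM.hasFDerivAt.comp_hasDerivAt x.1
      (hasDerivAt_cauchyPow_fst 1 hw x.1 (y := x.2 + y) (by linarith))).const_mul (-(1 / π))
    refine (this.congr_deriv (by simp)).congr_of_eventuallyEq (.of_forall fun t => ?_)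
    exact shiftedPotential_eq hy hx.le
  have e2 : HasDerivAt (fun t => shiftedPotential w y (x.1, t))
      (-(1 / π) * (cauchyPow 2 w (upper x.1 (x.2 + y))).im) x.2 := by
    have h3 := (hasDerivAt_cauchyPow_snd 1 hw x.1 (y := x.2 + y) (by linarith)).comp_add_const x.2 y
    have := (Complex.reCLM.hasFDerivAt.comp_hasDerivAt x.2 h3).const_mul (-(1 / π))
    refine (this.congr_deriv (by simp)).congr_of_eventuallyEq ?_
    filter_upwards [lt_mem_nhds hx] with t ht
    exact shiftedPotential_eq hy (x := (x.1, t)) (le_of_lt ht)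
  rw [grad, h1.unique e1, h2.unique e2]

/-! ### Decaying potentials belong to the homogeneous Sobolev space. -/

lemma norm_plane_le (a b : ℝ) : ‖(!₂[a, b] : Plane)‖ ≤ |a| + |b| := by
  rw [EuclideanSpace.norm_eq]
  simp only [Fin.sum_univ_two, Real.norm_eq_abs, sq_abs]
  apply Real.sqrt_le_iff.2
  refine ⟨by positivity, ?_⟩
  simp only [Matrix.cons_val_zero, Matrix.cons_val_one]
  nlinarith [abs_nonneg a, abs_nonneg b, sq_abs a, sq_abs b, mul_nonneg (abs_nonneg a) (abs_nonneg b)]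

lemma inner_plane (p q : Plane) : inner ℝ p q = p 0 * q 0 + p 1 * q 1 := by
  simp [PiLp.inner_apply, Fin.sum_univ_two, mul_comm]

/-- Smooth functions which decay like a harmonic function of finite Dirichlet integral. -/
structure DecayingPotential (u : ℝ × ℝ → ℝ) (K : ℝ) : Prop where
  contDiff : ContDiff ℝ ∞ u
  le : ∀ x : ℝ × ℝ, 0 ≤ x.2 → |u x| ≤ K / (1 + ‖x‖)
  grad_le : ∀ x : ℝ × ℝ, 0 < x.2 → ‖grad u x‖ ≤ K / (1 + ‖x‖) ^ 2

lemma norm_le_norm_upper {x : ℝ × ℝ} (hx : 0 ≤ x.2) {y : ℝ} (hy : 0 < y) :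
    ‖x‖ ≤ ‖upper x.1 (x.2 + y)‖ := by
  rw [Prod.norm_def]
  refine max_le (abs_le_norm_upper _ _) ?_
  have := Complex.abs_im_le_norm (upper x.1 (x.2 + y))
  simp only [upper_im] at this
  rw [Real.norm_eq_abs, abs_of_nonneg hx]
  linarith [le_abs_self (x.2 + y)]

lemma one_div_pi_le : 1 / π ≤ 1 := by
  rw [div_le_one Real.pi_pos]; linarith [Real.pi_gt_three]

/-- The potential and its gradient are parts of Cauchy integrals of orders 1 and 2, evaluated at
height at least y; these orders are the decay rates. -/
lemma decayingPotential_shiftedPotential {w : ℝ → ℝ} (hw : Integrable w)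
    (hc : HasCompactSupport w) {y : ℝ} (hy : 0 < y) :
    ∃ K, DecayingPotential (shiftedPotential w y) K := by
  obtain ⟨K₁, hK₁, h₁⟩ := cauchyPow_decay 1 hw hc hy
  obtain ⟨K₂, hK₂, h₂⟩ := cauchyPow_decay 2 hw hc hy
  refine ⟨K₁ + 2 * K₂, contDiff_shiftedPotential hw hy, fun x hx => ?_, fun x hx => ?_⟩
  · rw [shiftedPotential_eq hy hx, conjPotential, abs_mul, abs_neg, abs_of_pos (by positivity)]
    calc _ ≤ 1 * |(cauchyPow 1 w (upper x.1 (x.2 + y))).re| := by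
          gcongr; exact one_div_pi_le
      _ ≤ ‖cauchyPow 1 w (upper x.1 (x.2 + y))‖ := by rw [one_mul]; exact Complex.abs_re_le_norm _
      _ ≤ K₁ / (1 + ‖upper x.1 (x.2 + y)‖) ^ 1 := h₁ _ (by simpa using hx)
      _ ≤ _ := by
        rw [pow_one]
        gcongr
        · linarith
        · exact norm_le_norm_upper hx hy
  · rw [grad_shiftedPotential hw hy hx]
    refine (norm_plane_le _ _).trans ?_
    rw [abs_mul, abs_mul, abs_neg, abs_of_pos (by positivity : 0 < 1 / π)]
    calc _ ≤ 1 * |(cauchyPow 2 w (upper x.1 (x.2 + y))).re| +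
          1 * |(cauchyPow 2 w (upper x.1 (x.2 + y))).im| := by
          gcongr <;> exact one_div_pi_le
      _ ≤ 2 * ‖cauchyPow 2 w (upper x.1 (x.2 + y))‖ := by
          linarith [Complex.abs_re_le_norm (cauchyPow 2 w (upper x.1 (x.2 + y))),
            Complex.abs_im_le_norm (cauchyPow 2 w (upper x.1 (x.2 + y)))]
      _ ≤ 2 * (K₂ / (1 + ‖upper x.1 (x.2 + y)‖) ^ 2) := by
          gcongr; exact h₂ _ (by simpa using hx.le)
      _ ≤ 2 * (K₂ / (1 + ‖x‖) ^ 2) := by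
          gcongr; exact norm_le_norm_upper hx.le hy
      _ ≤ _ := by rw [← mul_div_assoc]; gcongr; linarith

lemma measurableSet_halfPlane : MeasurableSet halfPlane :=
  measurableSet_lt measurable_const measurable_snd

lemma halfPlaneMeasure_eq :
    halfPlaneMeasure = (volume : Measure ℝ).prod (volume.restrict (Ioi (0 : ℝ))) := by
  have : halfPlane = (univ : Set ℝ) ×ˢ Ioi (0 : ℝ) := by ext; simp [halfPlane]
  rw [halfPlaneMeasure, this, ← Measure.restrict_univ (μ := (volume : Measure ℝ)),
    Measure.prod_restrict, Measure.restrict_univ, Measure.volume_eq_prod]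

lemma ae_halfPlane : ∀ᵐ x ∂halfPlaneMeasure, 0 < x.2 :=
  ae_restrict_mem measurableSet_halfPlane

lemma continuous_grad {u : ℝ × ℝ → ℝ} (hu : ContDiff ℝ ∞ u) : Continuous (grad u) := by
  have h := hu.continuous_fderiv (by simp)
  have h1 : ∀ v : ℝ × ℝ, Continuous fun x => fderiv ℝ u x v := fun v => h.clm_apply continuous_const
  unfold grad
  refine (PiLp.continuous_toLp 2 _).comp (continuous_pi fun i => ?_)
  fin_cases i
  · exact h1 _
  · exact h1 _

lemma integrable_halfPlane_decay : Integrable (fun x : ℝ × ℝ => ((1 + ‖x‖) ^ 4)⁻¹) := by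
  have := integrable_one_add_norm (E := ℝ × ℝ) (μ := volume) (r := 4) (by
    simp; norm_num)
  refine this.congr (.of_forall fun x => ?_)
  simp only
  rw [Real.rpow_neg (by positivity)]
  norm_cast

lemma memLp_halfPlane_decay :
    MemLp (fun x : ℝ × ℝ => ((1 + ‖x‖) ^ 2)⁻¹) 2 halfPlaneMeasure := by
  refine (MemLp.restrict (s := halfPlane) ?_)
  rw [memLp_two_iff_integrable_sq]
  · refine integrable_halfPlane_decay.congr (.of_forall fun x => ?_)
    simp only
    rw [inv_pow, ← pow_mul]
  · have : Continuous (fun x : ℝ × ℝ => ((1 + ‖x‖) ^ 2)⁻¹) := by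
      refine Continuous.inv₀ (by fun_prop) fun x => by positivity
    exact this.aestronglyMeasurable

lemma memLp_of_grad_decay {G : ℝ × ℝ → Plane} (hG : Continuous G) {K : ℝ}
    (h : ∀ x : ℝ × ℝ, 0 < x.2 → ‖G x‖ ≤ K / (1 + ‖x‖) ^ 2) : MemLp G 2 halfPlaneMeasure :=
  (memLp_halfPlane_decay.const_mul K).mono' hG.aestronglyMeasurable (by
    filter_upwards [ae_halfPlane] with x hx
    simpa [div_eq_mul_inv] using h x hx)

/-- Cut-off at scale `n`. -/
def cutoff (χ : ContDiffBump (0 : ℝ × ℝ)) (n : ℕ) (u : ℝ × ℝ → ℝ) (x : ℝ × ℝ) : ℝ :=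
  χ (((n : ℝ) + 1)⁻¹ • x) * u x

lemma grad_mul {f g : ℝ × ℝ → ℝ} {x : ℝ × ℝ} (hf : DifferentiableAt ℝ f x)
    (hg : DifferentiableAt ℝ g x) :
    grad (fun x => f x * g x) x = f x • grad g x + g x • grad f x := by
  ext i
  fin_cases i <;> simp [grad, fderiv_fun_mul hf hg]

lemma isTestFunction_cutoff (χ : ContDiffBump (0 : ℝ × ℝ)) (n : ℕ) {u : ℝ × ℝ → ℝ}
    (hu : ContDiff ℝ ∞ u) : IsTestFunction (cutoff χ n u) := by
  refine ⟨(χ.contDiff.comp (contDiff_const_smul _)).mul hu, ?_⟩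
  have h : HasCompactSupport fun x : ℝ × ℝ => χ (((n : ℝ) + 1)⁻¹ • x) :=
    χ.hasCompactSupport.comp_smul (by positivity)
  exact h.mul_right

lemma cutoff_eventually (χ : ContDiffBump (0 : ℝ × ℝ)) (hχ : χ.rIn = 1) (u : ℝ × ℝ → ℝ)
    (x : ℝ × ℝ) : ∀ᶠ n in atTop, cutoff χ n u =ᶠ[𝓝 x] u := by
  obtain ⟨N, hN⟩ := exists_nat_gt ‖x‖
  filter_upwards [eventually_ge_atTop N] with n hn
  have : ∀ᶠ z in 𝓝 x, ‖z‖ < n + 1 := (continuous_norm.tendsto x).eventually_lt_const (by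
    have : (N : ℝ) ≤ n := by exact_mod_cast hn
    linarith)
  filter_upwards [this] with z hz
  rw [cutoff, χ.one_of_mem_closedBall, one_mul]
  rw [mem_closedBall_zero_iff, hχ, norm_smul, norm_inv, Real.norm_of_nonneg (by positivity)]
  rw [inv_mul_le_iff₀ (by positivity)]
  linarith

lemma abs_cutoff_le (χ : ContDiffBump (0 : ℝ × ℝ)) (n : ℕ) (u : ℝ × ℝ → ℝ) (x : ℝ × ℝ) :
    |cutoff χ n u x| ≤ |u x| := by
  rw [cutoff, abs_mul, abs_of_nonneg χ.nonneg]
  exact mul_le_of_le_one_left (abs_nonneg _) χ.le_one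

/-- Uniformity in n: the gradient of the cut-off factor is O(1 / (n + 1)) and lives where ‖x‖ ≤ 2(n
+ 1), so it is O(1 / (1 + ‖x‖)), and it multiplies a potential of the same order. -/
lemma norm_grad_cutoff_le (χ : ContDiffBump (0 : ℝ × ℝ)) (hχ : χ.rOut = 2) {u : ℝ × ℝ → ℝ} {K : ℝ}
    (hu : DecayingPotential u K) : ∃ K', ∀ n, ∀ x : ℝ × ℝ, 0 < x.2 →
      ‖grad (cutoff χ n u) x‖ ≤ K' / (1 + ‖x‖) ^ 2 := by
  obtain ⟨M, hM⟩ : ∃ M, ∀ x, ‖fderiv ℝ χ x‖ ≤ M :=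
    ((χ.contDiff (n := 1)).continuous_fderiv (by simp)).bounded_above_of_compact_support
      (χ.hasCompactSupport.fderiv (𝕜 := ℝ))
  have hM0 : 0 ≤ M := (norm_nonneg _).trans (hM 0)
  refine ⟨K + K * (6 * M), fun n x hx => ?_⟩
  have hd : Differentiable ℝ χ := (χ.contDiff (n := 1)).differentiable (by simp)
  have hn : (0 : ℝ) < n + 1 := by positivity
  set r := ((n : ℝ) + 1)⁻¹ with hr
  have hr0 : 0 < r := by positivity
  have hf : HasFDerivAt (fun x : ℝ × ℝ => χ (r • x))
      ((fderiv ℝ χ (r • x)).comp (r • ContinuousLinearMap.id ℝ (ℝ × ℝ))) x :=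
    (hd (r • x)).hasFDerivAt.comp x ((hasFDerivAt_id x).const_smul r)
  have hK : 0 ≤ K := by
    have := (abs_nonneg _).trans (hu.le x hx.le)
    rwa [le_div_iff₀ (by positivity), zero_mul] at this
  have e1 : grad (cutoff χ n u) x = χ (r • x) • grad u x + u x • grad (fun x => χ (r • x)) x :=
    grad_mul hf.differentiableAt (hu.contDiff.differentiable (by simp) x)
  have h2 : ‖grad (fun x => χ (r • x)) x‖ ≤ 2 * M * r := by
    refine (norm_plane_le _ _).trans ?_
    rw [hf.fderiv]
    have : ∀ v : ℝ × ℝ, ‖v‖ ≤ 1 → |((fderiv ℝ χ (r • x)).comp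
        (r • ContinuousLinearMap.id ℝ (ℝ × ℝ))) v| ≤ M * r := by
      intro v hv
      simp only [ContinuousLinearMap.comp_apply, smul_apply,
        ContinuousLinearMap.id_apply]
      calc _ ≤ ‖fderiv ℝ χ (r • x)‖ * ‖r • v‖ := ContinuousLinearMap.le_opNorm _ _
        _ ≤ M * (r * 1) := by
          rw [norm_smul, Real.norm_of_nonneg hr0.le]
          gcongr
          exact hM _
        _ = _ := by ring
    linarith [this (1, 0) (by simp [Prod.norm_def]), this (0, 1) (by simp [Prod.norm_def])]
  -- On the support 1 + ‖x‖ ≤ 3(n + 1), which turns 2 * M into 6 * M.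
  have h3 : ‖grad (fun x => χ (r • x)) x‖ ≤ 6 * M / (1 + ‖x‖) := by
    by_cases hx2 : ‖x‖ ≤ 2 * (n + 1)
    · refine h2.trans ?_
      rw [hr, le_div_iff₀ (by positivity), ← div_eq_mul_inv, div_mul_eq_mul_div,
        div_le_iff₀ hn]
      have : (0 : ℝ) ≤ n := by positivity
      nlinarith
    · have : fderiv ℝ χ (r • x) = 0 := by
        refine image_eq_zero_of_notMem_tsupport fun h => hx2 ?_
        have h := tsupport_fderiv_subset ℝ h
        rw [χ.tsupport_eq, hχ, mem_closedBall_zero_iff, norm_smul,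
          Real.norm_of_nonneg hr0.le, hr, inv_mul_le_iff₀ hn] at h
        linarith
      have h4 : grad (fun x => χ (r • x)) x = 0 := by
        ext i
        fin_cases i <;> simp [grad, hf.fderiv, this]
      rw [h4, norm_zero]
      positivity
  rw [e1]
  calc _ ≤ ‖χ (r • x) • grad u x‖ + ‖u x • grad (fun x => χ (r • x)) x‖ := norm_add_le _ _
    _ ≤ 1 * (K / (1 + ‖x‖) ^ 2) + (K / (1 + ‖x‖)) * (6 * M / (1 + ‖x‖)) := by
      rw [norm_smul, norm_smul, Real.norm_of_nonneg χ.nonneg, Real.norm_eq_abs]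
      gcongr
      · exact χ.le_one
      · exact hu.grad_le x hx
      · exact hu.le x hx.le
    _ = _ := by field_simp

lemma exists_cutoff : ∃ χ : ContDiffBump (0 : ℝ × ℝ), χ.rIn = 1 ∧ χ.rOut = 2 :=
  ⟨⟨1, 2, by norm_num, by norm_num⟩, rfl, rfl⟩

lemma grad_congr {u v : ℝ × ℝ → ℝ} {x : ℝ × ℝ} (h : u =ᶠ[𝓝 x] v) : grad u x = grad v x := by
  simp only [grad, h.fderiv_eq]

/-- The cut-off potentials are test functions; their gradients converge pointwise under a majorant
of order (1 + ‖x‖)⁻², which is square integrable in the plane. -/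
lemma DecayingPotential.isHomogeneousSobolevGradient {u : ℝ × ℝ → ℝ} {K : ℝ}
    (hu : DecayingPotential u K) : IsHomogeneousSobolevGradient (grad u) := by
  refine ⟨memLp_of_grad_decay (continuous_grad hu.contDiff) hu.grad_le, fun ε hε => ?_⟩
  obtain ⟨χ, hχ1, hχ2⟩ := exists_cutoff
  obtain ⟨K', hK'⟩ := norm_grad_cutoff_le χ hχ2 hu
  set F : ℕ → ℝ × ℝ → Plane := fun n => grad u - grad (cutoff χ n u) with hF
  have hFc : ∀ n, Continuous (F n) := fun n =>
    (continuous_grad hu.contDiff).sub (continuous_grad (isTestFunction_cutoff χ n hu.contDiff).1)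
  have hb : ∀ n x, 0 < x.2 → ‖F n x‖ ≤ (K + K') / (1 + ‖x‖) ^ 2 := fun n x hx => by
    refine (norm_sub_le _ _).trans ?_
    rw [add_div]
    exact add_le_add (hu.grad_le x hx) (hK' n x hx)
  have hlim : Tendsto (fun n => ∫ x, ‖F n x‖ ^ 2 ∂halfPlaneMeasure) atTop
      (𝓝 (∫ _ : ℝ × ℝ, (0 : ℝ) ∂halfPlaneMeasure)) := by
    refine tendsto_integral_of_dominated_convergence
      (fun x => (K + K') ^ 2 * ((1 + ‖x‖) ^ 4)⁻¹)
      (fun n => ((hFc n).norm.pow 2).aestronglyMeasurable)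
      (integrable_halfPlane_decay.restrict.const_mul _) (fun n => ?_) ?_
    · filter_upwards [ae_halfPlane] with x hx
      rw [Real.norm_of_nonneg (by positivity)]
      calc _ ≤ ((K + K') / (1 + ‖x‖) ^ 2) ^ 2 := by gcongr; exact hb n x hx
        _ = _ := by rw [div_pow, ← pow_mul, div_eq_mul_inv]
    · refine .of_forall fun x => tendsto_const_nhds.congr' ?_
      filter_upwards [cutoff_eventually χ hχ1 u x] with n hn
      simp [hF, grad_congr hn]
  rw [integral_zero] at hlim
  have hL : ∀ n, MemLp (F n) 2 halfPlaneMeasure := fun n => memLp_of_grad_decay (hFc n) (hb n)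
  have he : Tendsto (fun n => eLpNorm (F n) 2 halfPlaneMeasure) atTop (𝓝 0) := by
    have h1 : ∀ n, eLpNorm (F n) 2 halfPlaneMeasure =
        ENNReal.ofReal (√(∫ x, ‖F n x‖ ^ 2 ∂halfPlaneMeasure)) := fun n => by
      rw [(hL n).eLpNorm_eq_integral_rpow_norm (by norm_num) (by norm_num), Real.sqrt_eq_rpow]
      norm_num
    simp_rw [h1]
    have := (ENNReal.continuous_ofReal.tendsto _).comp ((Real.continuous_sqrt.tendsto _).comp hlim)
    rw [Real.sqrt_zero, ENNReal.ofReal_zero] at this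
    exact this
  obtain ⟨n, hn⟩ := (he.eventually_lt_const hε).exists
  exact ⟨_, isTestFunction_cutoff χ n hu.contDiff, hn⟩

lemma MemLp.integrable_inner {α : Type*} [MeasurableSpace α] {μ : Measure α} {F G : α → Plane}
    (hF : MemLp F 2 μ) (hG : MemLp G 2 μ) : Integrable (fun x => (inner ℝ (F x) (G x) : ℝ)) μ := by
  have := L2.integrable_inner (𝕜 := ℝ) (hF.toLp F) (hG.toLp G)
  refine this.congr ?_
  filter_upwards [hF.coeFn_toLp, hG.coeFn_toLp] with x h1 h2
  rw [h1, h2]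

/-- Extends the weak equation from test functions to the shifted potentials, which lack compact
support. Testing with them yields both the energy bound and the interaction formula. -/
lemma DecayingPotential.integral_inner {u : ℝ × ℝ → ℝ} {K : ℝ} (hu : DecayingPotential u K)
    {G : ℝ × ℝ → Plane} (hG : MemLp G 2 halfPlaneMeasure) {k : ℝ → ℝ} (hk : MemLp k 2)
    (h : ∀ ζ, IsTestFunction ζ →
      ∫ x, inner ℝ (G x) (grad ζ x) ∂halfPlaneMeasure = ∫ t : ℝ, k t * ζ (t, 0)) :
    ∫ x, inner ℝ (G x) (grad u x) ∂halfPlaneMeasure = ∫ t : ℝ, k t * u (t, 0) := by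
  obtain ⟨χ, hχ1, hχ2⟩ := exists_cutoff
  obtain ⟨K', hK'⟩ := norm_grad_cutoff_le χ hχ2 hu
  have hu0 : MemLp (fun t : ℝ => u (t, 0)) 2 := by
    refine memLp_of_decay (K := K) (hu.contDiff.continuous.comp (by fun_prop)) fun x => ?_
    simpa [Prod.norm_def] using hu.le (x, 0) le_rfl
  have h1 : Tendsto (fun n => ∫ x, (inner ℝ (G x) (grad (cutoff χ n u) x) : ℝ) ∂halfPlaneMeasure)
      atTop (𝓝 (∫ x, inner ℝ (G x) (grad u x) ∂halfPlaneMeasure)) := by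
    refine tendsto_integral_of_dominated_convergence
      (fun x => ‖G x‖ * (K' * ((1 + ‖x‖) ^ 2)⁻¹))
      (fun n => hG.1.inner
        (continuous_grad (isTestFunction_cutoff χ n hu.contDiff).1).aestronglyMeasurable)
      (hG.norm.integrable_mul (memLp_halfPlane_decay.const_mul K')) (fun n => ?_) ?_
    · filter_upwards [ae_halfPlane] with x hx
      refine (norm_inner_le_norm _ _).trans ?_
      rw [← div_eq_mul_inv]
      gcongr
      exact hK' n x hx
    · refine .of_forall fun x => tendsto_const_nhds.congr' ?_
      filter_upwards [cutoff_eventually χ hχ1 u x] with n hn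
      simp [grad_congr hn]
  have h2 : Tendsto (fun n => ∫ t : ℝ, k t * cutoff χ n u (t, 0)) atTop
      (𝓝 (∫ t : ℝ, k t * u (t, 0))) := by
    refine tendsto_integral_of_dominated_convergence
      (fun t => |k t| * |u (t, 0)|)
      (fun n => hk.1.mul ((isTestFunction_cutoff χ n hu.contDiff).1.continuous.comp
        (by fun_prop)).aestronglyMeasurable)
      (hk.norm.integrable_mul hu0.norm) (fun n => .of_forall fun t => ?_) ?_
    · rw [norm_mul, Real.norm_eq_abs, Real.norm_eq_abs]
      exact mul_le_mul_of_nonneg_left (abs_cutoff_le χ n u _) (abs_nonneg _)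
    · refine .of_forall fun t => tendsto_const_nhds.congr' ?_
      filter_upwards [cutoff_eventually χ hχ1 u (t, 0)] with n hn
      rw [hn.eq_of_nhds]
  simp_rw [fun n => h _ (isTestFunction_cutoff χ n hu.contDiff)] at h1
  exact tendsto_nhds_unique h1 h2

/-! ### The weak equation of the shifted potential. -/

lemma continuousAt_cauchyPow_upper (n : ℕ) {w : ℝ → ℝ} (hw : Integrable w) {y : ℝ} (hy : 0 < y)
    {x : ℝ × ℝ} (hx : 0 ≤ x.2) :
    ContinuousAt (fun x : ℝ × ℝ => cauchyPow n w (upper x.1 (x.2 + y))) x :=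
  (contDiffAt_cauchyPow_upper n hw (by linarith)).continuousAt

lemma integrable_halfPlane_of_continuousAt {F : ℝ × ℝ → ℝ} {S : Set (ℝ × ℝ)} (hS : IsCompact S)
    (h0 : ∀ x, x ∉ S → F x = 0) (hF : ∀ x : ℝ × ℝ, 0 ≤ x.2 → ContinuousAt F x) :
    Integrable F halfPlaneMeasure := by
  have hc : IsClosed {x : ℝ × ℝ | 0 ≤ x.2} := isClosed_le continuous_const continuous_snd
  have h1 : IntegrableOn F (S ∩ {x : ℝ × ℝ | 0 ≤ x.2}) :=
    ContinuousOn.integrableOn_compact (hS.inter_right hc)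
      fun x hx => (hF x hx.2).continuousWithinAt
  refine h1.of_forall_sdiff_eq_zero measurableSet_halfPlane fun x hx => h0 x fun h => hx.2 ⟨h, ?_⟩
  exact le_of_lt (show 0 < x.2 from hx.1)

lemma _root_.HasCompactSupport.comp_prodMk_left {ζ : ℝ × ℝ → ℝ} (h : HasCompactSupport ζ) (s : ℝ) :
    HasCompactSupport fun t => ζ (t, s) :=
  HasCompactSupport.intro (h.isCompact.image continuous_fst) fun _ hx =>
    image_eq_zero_of_notMem_tsupport fun h' => hx ⟨_, h', rfl⟩

lemma _root_.HasCompactSupport.comp_prodMk_right {ζ : ℝ × ℝ → ℝ} (h : HasCompactSupport ζ) (s : ℝ) :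
    HasCompactSupport fun t => ζ (s, t) :=
  HasCompactSupport.intro (h.isCompact.image continuous_snd) fun _ hx =>
    image_eq_zero_of_notMem_tsupport fun h' => hx ⟨_, h', rfl⟩

/-- The shifted potential is the stray field potential of the Poisson extension of `w`. -/
lemma integral_inner_grad_shiftedPotential {w : ℝ → ℝ} (hw : CompactH1 w) {y : ℝ} (hy : 0 < y)
    {ζ : ℝ × ℝ → ℝ} (hζ : IsTestFunction ζ) :
    ∫ x, inner ℝ (grad (shiftedPotential w y) x) (grad ζ x) ∂halfPlaneMeasure =
      ∫ t : ℝ, poisson y (deriv w) t * ζ (t, 0) := by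
  have hwi := hw.integrable
  set c2 : ℝ × ℝ → ℂ := fun x => cauchyPow 2 w (upper x.1 (x.2 + y)) with hc2
  set c3 : ℝ × ℝ → ℂ := fun x => cauchyPow 3 w (upper x.1 (x.2 + y)) with hc3
  have hc2c : ∀ x : ℝ × ℝ, 0 ≤ x.2 → ContinuousAt c2 x := fun x hx =>
    continuousAt_cauchyPow_upper 2 hwi hy hx
  have hc3c : ∀ x : ℝ × ℝ, 0 ≤ x.2 → ContinuousAt c3 x := fun x hx =>
    continuousAt_cauchyPow_upper 3 hwi hy hx
  have hζd : Differentiable ℝ ζ := hζ.1.differentiable (by simp)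
  have hζc : ∀ v, Continuous fun x => fderiv ℝ ζ x v := fun v =>
    (hζ.1.continuous_fderiv (by simp)).clm_apply continuous_const
  have hζ0 : ∀ x, x ∉ tsupport ζ → ζ x = 0 := fun x hx => image_eq_zero_of_notMem_tsupport hx
  have hζ1 : ∀ v x, x ∉ tsupport ζ → fderiv ℝ ζ x v = 0 := fun v x hx => by
    rw [image_eq_zero_of_notMem_tsupport (f := fderiv ℝ ζ) fun h => hx (tsupport_fderiv_subset ℝ h)]
    simp
  -- `D1` is the x₁-derivative of ζ Re `c2` and `D2` the x₂-derivative of ζ Im `c2`. By the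
  -- Cauchy–Riemann equations their terms without derivatives of ζ coincide, so `D1 - D2` is π times
  -- the inner product of the gradients.
  set D1 : ℝ × ℝ → ℝ := fun x => fderiv ℝ ζ x (1, 0) * (c2 x).re + ζ x * (-2 * (c3 x).re) with hD1
  set D2 : ℝ × ℝ → ℝ := fun x => fderiv ℝ ζ x (0, 1) * (c2 x).im + ζ x * (-2 * (c3 x).re) with hD2
  have re_at : ∀ {c : ℝ × ℝ → ℂ} {x}, ContinuousAt c x → ContinuousAt (fun x => (c x).re) x :=
    fun h => Complex.continuous_re.continuousAt.comp h
  have im_at : ∀ {c : ℝ × ℝ → ℂ} {x}, ContinuousAt c x → ContinuousAt (fun x => (c x).im) x :=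
    fun h => Complex.continuous_im.continuousAt.comp h
  have D1c : ∀ x : ℝ × ℝ, 0 ≤ x.2 → ContinuousAt D1 x := fun x hx =>
    ((hζc _).continuousAt.mul (re_at (hc2c x hx))).add
      (hζ.1.continuous.continuousAt.mul (continuousAt_const.mul (re_at (hc3c x hx))))
  have D2c : ∀ x : ℝ × ℝ, 0 ≤ x.2 → ContinuousAt D2 x := fun x hx =>
    ((hζc _).continuousAt.mul (im_at (hc2c x hx))).add
      (hζ.1.continuous.continuousAt.mul (continuousAt_const.mul (re_at (hc3c x hx))))
  have D1i : Integrable D1 halfPlaneMeasure :=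
    integrable_halfPlane_of_continuousAt hζ.2.isCompact
      (fun x hx => by simp [hD1, hζ0 x hx, hζ1 _ x hx]) D1c
  have D2i : Integrable D2 halfPlaneMeasure :=
    integrable_halfPlane_of_continuousAt hζ.2.isCompact
      (fun x hx => by simp [hD2, hζ0 x hx, hζ1 _ x hx]) D2c
  have d1 : ∀ x : ℝ × ℝ, 0 < x.2 → HasDerivAt (fun t => ζ (t, x.2) * (c2 (t, x.2)).re) (D1 x) x.1 := by
    intro x hx
    have h1 := fderiv_apply_fst (hζd x)
    have h2 := Complex.reCLM.hasFDerivAt.comp_hasDerivAt x.1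
      (hasDerivAt_cauchyPow_fst 2 hwi x.1 (y := x.2 + y) (by linarith))
    exact (h1.mul h2).congr_deriv (by simp [hD1, hc2, hc3])
  have d2 : ∀ x : ℝ × ℝ, 0 < x.2 → HasDerivAt (fun t => ζ (x.1, t) * (c2 (x.1, t)).im) (D2 x) x.2 := by
    intro x hx
    have h1 := fderiv_apply_snd (hζd x)
    have h2 := Complex.imCLM.hasFDerivAt.comp_hasDerivAt x.2
      ((hasDerivAt_cauchyPow_snd 2 hwi x.1 (y := x.2 + y) (by linarith)).comp_add_const x.2 y)
    exact (h1.mul h2).congr_deriv (by simp [hD2, hc2, hc3])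
  -- Horizontal lines contribute nothing, as ζ has compact support.
  have I1 : ∫ x, D1 x ∂halfPlaneMeasure = 0 := by
    rw [halfPlaneMeasure_eq] at D1i ⊢
    rw [integral_prod_symm _ D1i]
    refine setIntegral_eq_zero_of_forall_eq_zero fun s hs => ?_
    simp only [mem_Ioi] at hs
    have hsup : HasCompactSupport fun t => ζ (t, s) := hζ.2.comp_prodMk_left s
    have hcont : Continuous fun t => D1 (t, s) := continuous_iff_continuousAt.2 fun t =>
      ContinuousAt.comp (g := D1) (f := fun t => (t, s)) (D1c (t, s) hs.le) (by fun_prop)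
    have hc2s : Continuous fun t => (c2 (t, s)).re := continuous_iff_continuousAt.2 fun t =>
      ContinuousAt.comp (g := fun x => (c2 x).re) (f := fun t => (t, s))
        (re_at (hc2c (t, s) hs.le)) (by fun_prop)
    have hsup2 : HasCompactSupport fun t => D1 (t, s) :=
      HasCompactSupport.intro (hζ.2.isCompact.image continuous_fst) fun x hx => by
        have : (x, s) ∉ tsupport ζ := fun h' => hx ⟨_, h', rfl⟩
        simp [hD1, hζ0 _ this, hζ1 _ _ this]
    refine integral_eq_zero_of_hasDerivAt_of_integrable
      (f := fun t => ζ (t, s) * (c2 (t, s)).re) (fun t => d1 (t, s) hs)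
      (hcont.integrable_of_hasCompactSupport hsup2) ?_
    exact ((hζ.1.continuous.comp (by fun_prop)).mul hc2s).integrable_of_hasCompactSupport
      hsup.mul_right
  -- Vertical half-lines leave the boundary value at height 0, which produces the Neumann datum.
  have I2 : ∫ x, D2 x ∂halfPlaneMeasure = ∫ t, -(ζ (t, 0) * (c2 (t, 0)).im) := by
    rw [halfPlaneMeasure_eq] at D2i ⊢
    rw [integral_prod _ D2i]
    refine integral_congr_ae ?_
    filter_upwards [D2i.prod_right_ae] with s hs
    have hsup : HasCompactSupport fun t => ζ (s, t) := hζ.2.comp_prodMk_right s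
    have := integral_Ioi_of_hasDerivAt_of_tendsto (a := 0)
      (f := fun t => ζ (s, t) * (c2 (s, t)).im) (f' := fun t => D2 (s, t)) (m := 0) ?_
      (fun t ht => d2 (s, t) ht) hs ?_
    · rw [this, zero_sub]
    · refine ContinuousAt.continuousWithinAt ?_
      exact ContinuousAt.comp (g := fun x => ζ x * (c2 x).im) (f := fun t => (s, t))
        (hζ.1.continuous.continuousAt.mul (im_at (hc2c (s, 0) le_rfl))) (by fun_prop)
    · have h0 : HasCompactSupport fun t => ζ (s, t) * (c2 (s, t)).im := hsup.mul_right
      rw [hasCompactSupport_iff_eventuallyEq] at h0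
      refine tendsto_const_nhds.congr' ((h0.filter_mono ?_).mono fun _ h => h.symm)
      rw [coclosedCompact_eq_cocompact]
      exact _root_.atTop_le_cocompact (α := ℝ)
  have e : ∀ᵐ x ∂halfPlaneMeasure, inner ℝ (grad (shiftedPotential w y) x) (grad ζ x) =
      1 / π * (D1 x - D2 x) := by
    filter_upwards [ae_halfPlane] with x hx
    rw [grad_shiftedPotential hwi hy hx, inner_plane]
    simp only [hD1, hD2, grad, hc2]
    simp
    ring
  rw [integral_congr_ae e, integral_const_mul, integral_sub D1i D2i, I1, I2, zero_sub,
    ← integral_neg, ← integral_const_mul]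
  refine integral_congr_ae (.of_forall fun t => ?_)
  simp only [hc2, zero_add, im_cauchyPow_two hw t hy]
  field_simp

/-! ### Boundary limits of Poisson extensions. -/

lemma integral_poisson_mul {v ψ : ℝ → ℝ} (hv : Integrable v) (hψ : Integrable ψ) {y : ℝ}
    (hy : 0 < y) : ∫ x, poisson y v x * ψ x = ∫ t, v t * poisson y ψ t := by
  have hi : Integrable (fun p : ℝ × ℝ => v p.2 * poissonKer y (p.1 - p.2) * ψ p.1)
      (volume.prod volume) := by
    have h1 : Integrable (fun p : ℝ × ℝ => ψ p.1 * v p.2) (volume.prod volume) := hψ.mul_prod hv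
    refine (h1.mul_bdd (c := 1 / (π * y)) (g := fun p : ℝ × ℝ => poissonKer y (p.1 - p.2))
      ((continuous_poissonKer hy).comp (by fun_prop)).aestronglyMeasurable
      (.of_forall fun t => by
        rw [Real.norm_eq_abs, abs_of_nonneg (poissonKer_nonneg hy _)]
        exact poissonKer_le hy _)).congr (.of_forall fun p => ?_)
    simp only
    ring
  have h := integral_integral_swap (f := fun x t => v t * poissonKer y (x - t) * ψ x) hi
  calc _ = ∫ x, ∫ t, v t * poissonKer y (x - t) * ψ x := by
        simp_rw [integral_mul_const]
        rfl
    _ = _ := by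
        rw [h]
        refine integral_congr_ae (.of_forall fun t => ?_)
        simp only [poisson]
        rw [← integral_const_mul]
        refine integral_congr_ae (.of_forall fun x => ?_)
        simp only
        rw [show poissonKer y (x - t) = poissonKer y (t - x) by
          unfold poissonKer; rw [← neg_sub, neg_sq]]
        ring

/-- By symmetry the kernel can act on ψ, whose extensions are uniformly bounded and converge
everywhere; v then only has to be integrable. -/
lemma tendsto_integral_poisson_mul {v ψ : ℝ → ℝ} (hv : Integrable v) (hψ : Continuous ψ)
    (hc : HasCompactSupport ψ) :
    Tendsto (fun y => ∫ x, poisson y v x * ψ x) (𝓝[>] 0) (𝓝 (∫ x, v x * ψ x)) := by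
  have hψi : Integrable ψ := hψ.integrable_of_hasCompactSupport hc
  obtain ⟨M, hM⟩ := hψ.bounded_above_of_compact_support hc
  have h : Tendsto (fun y => ∫ x, v x * poisson y ψ x) (𝓝[>] 0) (𝓝 (∫ x, v x * ψ x)) := by
    refine tendsto_integral_filter_of_dominated_convergence (fun x => |v x| * M) ?_ ?_
      (hv.abs.mul_const M) ?_
    · filter_upwards [self_mem_nhdsWithin] with y hy
      exact hv.1.mul (integrable_poisson hψi hy).1
    · filter_upwards [self_mem_nhdsWithin] with y hy
      refine .of_forall fun x => ?_
      rw [norm_mul, Real.norm_eq_abs, Real.norm_eq_abs]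
      exact mul_le_mul_of_nonneg_left (abs_poisson_le hM hy x) (abs_nonneg _)
    · exact .of_forall fun x => (tendsto_poisson hψi hψ.continuousAt).const_mul _
  refine h.congr' ?_
  filter_upwards [self_mem_nhdsWithin] with y hy
  exact (integral_poisson_mul hv hψi hy).symm

/-! ### Riesz representation and weak convergence. -/

/-- A linear functional dominated by `‖T ·‖` is represented by an element of the closed range
of `T`. -/
lemma exists_riesz_of_le {V H : Type*} [AddCommGroup V] [Module ℝ V] [NormedAddCommGroup H]
    [InnerProductSpace ℝ H] [CompleteSpace H] (T : V →ₗ[ℝ] H) (l : V →ₗ[ℝ] ℝ) {C : ℝ} (hC : 0 ≤ C)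
    (h : ∀ v, |l v| ≤ C * ‖T v‖) :
    ∃ g ∈ T.range.topologicalClosure, ‖g‖ ≤ C ∧ ∀ v, inner ℝ g (T v) = l v := by
  have hker : T.ker ≤ l.ker := fun v hv => by
    have := h v
    rw [LinearMap.mem_ker.1 hv, norm_zero, mul_zero] at this
    exact LinearMap.mem_ker.2 (abs_nonpos_iff.1 this)
  -- The bound forces l to vanish on the kernel of T, so l factors through the range; it is then
  -- extended to H with the same norm.
  let f : T.range →ₗ[ℝ] ℝ := (T.ker.liftQ l hker).comp T.quotKerEquivRange.symm.toLinearMap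
  have hf : ∀ v, f ⟨T v, T.mem_range_self v⟩ = l v := fun v => by
    simp only [f, LinearMap.comp_apply, LinearEquiv.coe_coe,
      LinearMap.quotKerEquivRange_symm_apply_image, Submodule.mkQ_apply, Submodule.liftQ_apply]
  have hb : ∀ x : T.range, ‖f x‖ ≤ C * ‖x‖ := by
    rintro ⟨-, v, rfl⟩
    rw [hf]
    exact h v
  obtain ⟨F, hF, hFn⟩ := exists_extension_norm_eq T.range (f.mkContinuous C hb)
  set S := T.range.topologicalClosure with hS
  have : CompleteSpace S := T.range.isClosed_topologicalClosure.completeSpace_coe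
  set g₀ := (InnerProductSpace.toDual ℝ H).symm F
  -- Projecting the Riesz vector to the closed range changes no inner product with T v and does not
  -- increase the norm.
  refine ⟨S.starProjection g₀, Submodule.starProjection_apply_mem _ _, ?_, fun v => ?_⟩
  · refine (S.norm_starProjection_apply_le g₀).trans ?_
    rw [LinearIsometryEquiv.norm_map, hFn]
    exact f.mkContinuous_norm_le hC hb
  · have hv : T v ∈ S := T.range.le_topologicalClosure (T.mem_range_self v)
    rw [S.inner_starProjection_left_eq_right, Submodule.starProjection_eq_self_iff.2 hv,
      InnerProductSpace.toDual_symm_apply, ← hf v]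
    exact hF ⟨T v, T.mem_range_self v⟩

/-- For a bounded family, weak convergence tested on a subspace extends to its closure, by
approximation of g. -/
lemma tendsto_inner_of_mem_closure {V H ι : Type*} [AddCommGroup V] [Module ℝ V]
    [NormedAddCommGroup H] [InnerProductSpace ℝ H] (T : V →ₗ[ℝ] H) {F : Filter ι} {U : ι → H}
    {G g : H} {C : ℝ} (hU : ∀ᶠ i in F, ‖U i‖ ≤ C)
    (hT : ∀ v, Tendsto (fun i => (inner ℝ (U i) (T v) : ℝ)) F (𝓝 (inner ℝ G (T v))))
    (hg : g ∈ T.range.topologicalClosure) :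
    Tendsto (fun i => (inner ℝ g (U i) : ℝ)) F (𝓝 (inner ℝ g G)) := by
  rw [Metric.tendsto_nhds]
  intro ε hε
  set B := |C| + ‖G‖ + 1 with hB
  have hB0 : 0 < B := by positivity
  obtain ⟨-, ⟨v, rfl⟩, hv⟩ := Metric.mem_closure_iff.1 hg (ε / (2 * B)) (by positivity)
  rw [dist_eq_norm] at hv
  filter_upwards [hU, Metric.tendsto_nhds.1 (hT v) (ε / 2) (by positivity)] with i hi hi2
  rw [Real.dist_eq] at hi2 ⊢
  have e : (inner ℝ g (U i) : ℝ) - inner ℝ g G =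
      inner ℝ (g - T v) (U i - G) + (inner ℝ (U i) (T v) - inner ℝ G (T v)) := by
    rw [inner_sub_left, inner_sub_right, inner_sub_right, real_inner_comm (T v) (U i),
      real_inner_comm (T v) G]
    ring
  rw [e]
  have h1 : |(inner ℝ (g - T v) (U i - G) : ℝ)| ≤ ε / (2 * B) * B := by
    refine (abs_real_inner_le_norm _ _).trans ?_
    gcongr
    refine (norm_sub_le _ _).trans ?_
    linarith [le_abs_self C]
  have h2 : ε / (2 * B) * B = ε / 2 := by field_simp
  calc _ ≤ _ := abs_add_le _ _
    _ < ε := by linarith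

/-! ### Test functions and their gradients in L². -/

lemma isTestFunction_add {ζ η : ℝ × ℝ → ℝ} (hζ : IsTestFunction ζ) (hη : IsTestFunction η) :
    IsTestFunction (ζ + η) := ⟨hζ.1.add hη.1, hζ.2.add hη.2⟩

/-- The space of test functions. -/
def testSpace : Submodule ℝ (ℝ × ℝ → ℝ) where
  carrier := {ζ | IsTestFunction ζ}
  add_mem' := isTestFunction_add
  zero_mem' := ⟨contDiff_const, HasCompactSupport.zero⟩
  smul_mem' c _ hζ := ⟨hζ.1.const_smul c, hζ.2.smul_left (f := fun _ => c)⟩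

lemma memLp_grad {ζ : ℝ × ℝ → ℝ} (hζ : IsTestFunction ζ) : MemLp (grad ζ) 2 halfPlaneMeasure := by
  refine MemLp.restrict _ ((continuous_grad hζ.1).memLp_of_hasCompactSupport ?_)
  refine HasCompactSupport.intro (hζ.2.fderiv (𝕜 := ℝ)).isCompact fun x hx => ?_
  have := image_eq_zero_of_notMem_tsupport hx
  ext i
  fin_cases i <;> simp [grad, this]

/-- Plane fields of finite Dirichlet integral. -/
abbrev FieldSpace : Type := Lp Plane 2 halfPlaneMeasure

/-- The gradient as a linear map on test functions. -/
def gradLin : testSpace →ₗ[ℝ] FieldSpace where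
  toFun ζ := (memLp_grad ζ.2).toLp (grad ζ)
  map_add' ζ η := by
    rw [← MemLp.toLp_add]
    congr 1
    ext x i
    have h1 := (ζ.2.1.differentiable (by simp)) x
    have h2 := (η.2.1.differentiable (by simp)) x
    fin_cases i <;> simp [grad, fderiv_add h1 h2]
  map_smul' c ζ := by
    rw [RingHom.id_apply, ← MemLp.toLp_const_smul]
    congr 1
    ext x i
    have h1 := (ζ.2.1.differentiable (by simp)) x
    fin_cases i <;> simp [grad, fderiv_const_smul h1]

lemma inner_toLp {α : Type*} [MeasurableSpace α] {μ : Measure α} {E : Type*}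
    [NormedAddCommGroup E] [InnerProductSpace ℝ E] {F G : α → E} (hF : MemLp F 2 μ)
    (hG : MemLp G 2 μ) : inner ℝ (hF.toLp F) (hG.toLp G) = ∫ x, (inner ℝ (F x) (G x) : ℝ) ∂μ := by
  rw [L2.inner_def]
  refine integral_congr_ae ?_
  filter_upwards [hF.coeFn_toLp, hG.coeFn_toLp] with x h1 h2
  rw [h1, h2]

lemma norm_toLp_sq {α : Type*} [MeasurableSpace α] {μ : Measure α} {E : Type*}
    [NormedAddCommGroup E] [InnerProductSpace ℝ E] {F : α → E} (hF : MemLp F 2 μ) :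
    ‖hF.toLp F‖ ^ 2 = ∫ x, ‖F x‖ ^ 2 ∂μ := by
  rw [← real_inner_self_eq_norm_sq, inner_toLp]
  simp

lemma mem_closure_gradLin {G : ℝ × ℝ → Plane} (hG : IsHomogeneousSobolevGradient G) :
    hG.1.toLp G ∈ gradLin.range.topologicalClosure := by
  refine EMetric.mem_closure_iff.2 fun ε hε => ?_
  obtain ⟨ζ, hζ, h⟩ := hG.2 ε hε
  exact ⟨_, ⟨⟨ζ, hζ⟩, rfl⟩, (Lp.edist_toLp_toLp _ _ _ (memLp_grad hζ)).trans_lt h⟩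

lemma isHomogeneousSobolevGradient_of_mem {g : FieldSpace}
    (hg : g ∈ gradLin.range.topologicalClosure) : IsHomogeneousSobolevGradient g := by
  refine ⟨Lp.memLp g, fun ε hε => ?_⟩
  obtain ⟨-, ⟨ζ, rfl⟩, h⟩ := EMetric.mem_closure_iff.1 hg ε hε
  refine ⟨ζ, ζ.2, ?_⟩
  rw [Lp.edist_def] at h
  refine lt_of_eq_of_lt (eLpNorm_congr_ae ?_) h
  have : (gradLin ζ : ℝ × ℝ → Plane) =ᵐ[halfPlaneMeasure] grad ζ := (memLp_grad ζ.2).coeFn_toLp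
  exact (ae_eq_refl _).sub this.symm

lemma eq_zero_of_mem_closure {g : FieldSpace} (hg : g ∈ gradLin.range.topologicalClosure)
    (h : ∀ ζ, inner ℝ g (gradLin ζ) = 0) : g = 0 := by
  -- The constant family g converges weakly to 0 against the range, hence against g itself.
  have := tendsto_inner_of_mem_closure (F := (⊤ : Filter ℕ)) gradLin (U := fun _ => g) (G := 0)
    (C := ‖g‖) (.of_forall fun _ => le_rfl)
    (fun v => by simp only [h v, inner_zero_left]; exact tendsto_const_nhds) hg
  have h2 := tendsto_nhds_unique (tendsto_const_nhds) this
  rw [inner_zero_right] at h2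
  exact inner_self_eq_zero.1 h2

/-- The trace of a test function on the boundary. -/
lemma IsTestFunction.continuous_trace {ζ : ℝ × ℝ → ℝ} (hζ : IsTestFunction ζ) :
    Continuous fun t : ℝ => ζ (t, 0) := hζ.1.continuous.comp (by fun_prop)

lemma IsTestFunction.hasCompactSupport_trace {ζ : ℝ × ℝ → ℝ} (hζ : IsTestFunction ζ) :
    HasCompactSupport fun t : ℝ => ζ (t, 0) := hζ.2.comp_prodMk_left 0

lemma IsTestFunction.memLp_trace {ζ : ℝ × ℝ → ℝ} (hζ : IsTestFunction ζ) :
    MemLp (fun t : ℝ => ζ (t, 0)) 2 :=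
  hζ.continuous_trace.memLp_of_hasCompactSupport hζ.hasCompactSupport_trace

/-! ### Stray fields of compactly supported functions and their interaction. -/

lemma shiftedPotential_trace {w : ℝ → ℝ} {y : ℝ} (hy : 0 < y) (t : ℝ) :
    shiftedPotential w y (t, 0) = conjPotential w t y := by
  rw [shiftedPotential_eq hy le_rfl, zero_add]

/-- The gradient of the shifted potential as an element of `L²`. -/
lemma CompactH1.memLp_grad_shiftedPotential {w : ℝ → ℝ} (hw : CompactH1 w) {y : ℝ} (hy : 0 < y) :
    IsHomogeneousSobolevGradient (grad (shiftedPotential w y)) := by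
  obtain ⟨K, hK⟩ := decayingPotential_shiftedPotential hw.integrable hw.supp hy
  exact hK.isHomogeneousSobolevGradient

/-- Testing the equation with the potential itself gives a boundary integral of the Poisson
extension of w' against the conjugate potential. Both factors contract L², so the bound does not
depend on y. -/
lemma CompactH1.norm_grad_shiftedPotential_sq_le {w : ℝ → ℝ} (hw : CompactH1 w) {y : ℝ}
    (hy : 0 < y) : ‖(hw.memLp_grad_shiftedPotential hy).1.toLp _‖ ^ 2 ≤
      √(∫ x, deriv w x ^ 2) * √(∫ x, w x ^ 2) := by
  obtain ⟨K, hK⟩ := decayingPotential_shiftedPotential hw.integrable hw.supp hy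
  rw [← real_inner_self_eq_norm_sq, inner_toLp, hK.integral_inner
    (hw.memLp_grad_shiftedPotential hy).1 (memLp_poisson hw.integrable_deriv hw.memLp hy)
    (fun ζ hζ => integral_inner_grad_shiftedPotential hw hy hζ)]
  simp_rw [shiftedPotential_trace hy]
  refine (le_abs_self _).trans ((abs_integral_mul_le
    (memLp_poisson hw.integrable_deriv hw.memLp hy)
    (memLp_conjPotential hw.integrable hw.supp hy)).trans ?_)
  exact mul_le_mul
    (Real.sqrt_le_sqrt (integral_poisson_sq_le hw.integrable_deriv hw.memLp hy))
    (Real.sqrt_le_sqrt (integral_conjPotential_sq_le hw.integrable hw.memLp_two hw.supp hy))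
    (Real.sqrt_nonneg _) (Real.sqrt_nonneg _)

/-- Compactly supported `H¹` functions have a stray field, which is the weak limit of the gradients
of the shifted potentials. -/
lemma CompactH1.exists_strayField {w : ℝ → ℝ} (hw : CompactH1 w) :
    ∃ U : FieldSpace, IsStrayField w U ∧
      ‖U‖ ^ 2 ≤ √(∫ x, deriv w x ^ 2) * √(∫ x, w x ^ 2) ∧
      ∀ (f : ℝ → ℝ) (G : ℝ × ℝ → Plane), IsStrayField f G → MemLp (deriv f) 2 →
        Tendsto (fun y => ∫ t, deriv f t * conjPotential w t y) (𝓝[>] 0)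
          (𝓝 (∫ x, inner ℝ (G x) (U x) ∂halfPlaneMeasure)) := by
  set A := √(∫ x, deriv w x ^ 2) * √(∫ x, w x ^ 2) with hA
  have hA0 : 0 ≤ A := by positivity
  have hwi : ∀ ζ : testSpace, Integrable fun t => deriv w t * (ζ : ℝ × ℝ → ℝ) (t, 0) := fun ζ =>
    hw.memLp.integrable_mul ζ.2.memLp_trace
  let l : testSpace →ₗ[ℝ] ℝ :=
    { toFun := fun ζ => ∫ t, deriv w t * (ζ : ℝ × ℝ → ℝ) (t, 0)
      map_add' := fun ζ η => by
        rw [← integral_add (hwi ζ) (hwi η)]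
        simp [mul_add]
      map_smul' := fun c ζ => by
        rw [RingHom.id_apply, smul_eq_mul, ← integral_const_mul]
        simp [mul_left_comm] }
  have hlim : ∀ ζ : testSpace, Tendsto (fun y => ∫ t, poisson y (deriv w) t *
      (ζ : ℝ × ℝ → ℝ) (t, 0)) (𝓝[>] 0) (𝓝 (l ζ)) := fun ζ =>
    tendsto_integral_poisson_mul hw.integrable_deriv ζ.2.continuous_trace
      ζ.2.hasCompactSupport_trace
  classical
  let U : ℝ → FieldSpace := fun y =>
    if hy : 0 < y then (hw.memLp_grad_shiftedPotential hy).1.toLp _ else 0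
  have hUn : ∀ y, 0 < y → ‖U y‖ ≤ √A := fun y hy => by
    simp only [U, dif_pos hy]
    exact Real.le_sqrt_of_sq_le (hw.norm_grad_shiftedPotential_sq_le hy)
  have hUi : ∀ y, 0 < y → ∀ ζ : testSpace, inner ℝ (U y) (gradLin ζ) =
      ∫ t, poisson y (deriv w) t * (ζ : ℝ × ℝ → ℝ) (t, 0) := fun y hy ζ => by
    simp only [U, dif_pos hy, gradLin, LinearMap.coe_mk, AddHom.coe_mk, inner_toLp]
    exact integral_inner_grad_shiftedPotential hw hy ζ.2
  -- For each y the functional is an inner product with a field of norm at most `√A`; the bound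
  -- survives y → 0.
  have hbound : ∀ ζ, |l ζ| ≤ √A * ‖gradLin ζ‖ := fun ζ => by
    refine le_of_tendsto (hlim ζ).abs ?_
    filter_upwards [self_mem_nhdsWithin] with y hy
    rw [← hUi y hy]
    refine (abs_real_inner_le_norm _ _).trans ?_
    gcongr
    exact hUn y hy
  obtain ⟨g, hg, hgn, hgi⟩ := exists_riesz_of_le gradLin l (Real.sqrt_nonneg A) hbound
  refine ⟨g, ⟨isHomogeneousSobolevGradient_of_mem hg, fun ζ hζ => ?_⟩, ?_, fun f G hG hf => ?_⟩
  · have := hgi ⟨ζ, hζ⟩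
    rw [L2.inner_def] at this
    refine Eq.trans (integral_congr_ae ?_) this
    have : (gradLin ⟨ζ, hζ⟩ : ℝ × ℝ → Plane) =ᵐ[halfPlaneMeasure] grad ζ :=
      (memLp_grad hζ).coeFn_toLp
    filter_upwards [this] with x hx
    rw [hx]
  · calc ‖g‖ ^ 2 ≤ √A ^ 2 := by gcongr
      _ = A := Real.sq_sqrt hA0
  -- The fields U y converge weakly to g, so they may be tested with G. For fixed y, the equation of
  -- G tested with the shifted potential gives the integral of f' times the conjugate potential.
  · have ht := tendsto_inner_of_mem_closure (F := 𝓝[>] (0 : ℝ)) gradLin (U := U) (G := g)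
      (C := √A) (g := hG.1.1.toLp G) (by
        filter_upwards [self_mem_nhdsWithin] with y hy using hUn y hy)
      (fun ζ => by
        rw [hgi ζ]
        refine (hlim ζ).congr' ?_
        filter_upwards [self_mem_nhdsWithin] with y hy using (hUi y hy ζ).symm)
      (mem_closure_gradLin hG.1)
    have e : inner ℝ (hG.1.1.toLp G) g = ∫ x, (inner ℝ (G x) (g x) : ℝ) ∂halfPlaneMeasure := by
      rw [L2.inner_def]
      refine integral_congr_ae ?_
      filter_upwards [hG.1.1.coeFn_toLp] with x hx
      rw [hx]
    rw [e] at ht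
    refine ht.congr' ?_
    filter_upwards [self_mem_nhdsWithin] with y hy
    obtain ⟨K, hK⟩ := decayingPotential_shiftedPotential hw.integrable hw.supp hy
    simp only [U, dif_pos (show 0 < y from hy), inner_toLp]
    rw [hK.integral_inner hG.1.1 hf hG.2]
    simp_rw [shiftedPotential_trace hy]

/-- The compactly supported elements of `H¹(ℝ)` form a vector space. -/
def compactH1Space : Submodule ℝ (ℝ → ℝ) where
  carrier := {w | CompactH1 w}
  add_mem' := CompactH1.add
  zero_mem' := CompactH1.of_contDiff contDiff_const HasCompactSupport.zero
  smul_mem' c _ hw := hw.const_smul c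

lemma conjPotential_add {w v : ℝ → ℝ} (hw : Integrable w) (hv : Integrable v) (x : ℝ) {y : ℝ}
    (hy : 0 < y) : conjPotential (w + v) x y = conjPotential w x y + conjPotential v x y := by
  have : cauchyPow 1 (w + v) (upper x y) = cauchyPow 1 w (upper x y) + cauchyPow 1 v (upper x y) := by
    unfold cauchyPow
    rw [← integral_add (integrable_cauchyPow hw hy) (integrable_cauchyPow hv hy)]
    simp [add_div]
  rw [conjPotential, this, Complex.add_re]
  simp only [conjPotential]
  ring

lemma conjPotential_smul {w : ℝ → ℝ} (c x y : ℝ) :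
    conjPotential (c • w) x y = c * conjPotential w x y := by
  have : cauchyPow 1 (c • w) (upper x y) = c * cauchyPow 1 w (upper x y) := by
    unfold cauchyPow
    rw [← integral_const_mul]
    simp [mul_div_assoc]
  rw [conjPotential, this, Complex.re_ofReal_mul]
  simp only [conjPotential]
  ring

/-- If `f' ∈ L²`, then the interaction of the stray fields of `f` and of compactly supported `w` is
given by an `L²` density. -/
lemma exists_strayField_density {f : ℝ → ℝ} {G : ℝ × ℝ → Plane} (hG : IsStrayField f G)
    (hf : MemLp (deriv f) 2) : ∃ g : ℝ → ℝ, MemLp g 2 ∧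
      ∀ w, CompactH1 w → Tendsto (fun y => ∫ t, deriv f t * conjPotential w t y) (𝓝[>] 0)
          (𝓝 (∫ t, g t * w t)) := by
  have hex : ∀ w : compactH1Space, ∃ L, Tendsto (fun y => ∫ t, deriv f t *
      conjPotential (w : ℝ → ℝ) t y) (𝓝[>] 0) (𝓝 L) := fun w => by
    obtain ⟨U, -, -, h⟩ := CompactH1.exists_strayField w.2
    exact ⟨_, h f G hG hf⟩
  choose L hL using hex
  have hint : ∀ (w : compactH1Space) {y : ℝ}, 0 < y →
      Integrable (fun t => deriv f t * conjPotential (w : ℝ → ℝ) t y) := fun w y hy =>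
    hf.integrable_mul (memLp_conjPotential (CompactH1.integrable w.2) w.2.supp hy)
  let l : compactH1Space →ₗ[ℝ] ℝ :=
    { toFun := L
      map_add' := fun w v => by
        refine tendsto_nhds_unique (hL (w + v)) (((hL w).add (hL v)).congr' ?_)
        filter_upwards [self_mem_nhdsWithin] with y hy
        rw [← integral_add (hint w hy) (hint v hy)]
        refine integral_congr_ae (.of_forall fun t => ?_)
        simp only [Submodule.coe_add, conjPotential_add (CompactH1.integrable w.2)
          (CompactH1.integrable v.2) t hy]
        ring
      map_smul' := fun c w => by
        refine tendsto_nhds_unique (hL (c • w)) (((hL w).const_mul c).congr fun y => ?_)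
        rw [← integral_const_mul]
        refine integral_congr_ae (.of_forall fun t => ?_)
        simp only [Submodule.coe_smul, conjPotential_smul]
        ring }
  let T : compactH1Space →ₗ[ℝ] Lp ℝ 2 (volume : Measure ℝ) :=
    { toFun := fun w => (CompactH1.memLp_two w.2).toLp w
      map_add' := fun w v => MemLp.toLp_add _ _
      map_smul' := fun c w => MemLp.toLp_const_smul _ _ }
  -- Only the L² norm of w enters, because the conjugate potential is bounded by it; hence the
  -- interaction has an L² density.
  have hb : ∀ w, |l w| ≤ √(∫ t, deriv f t ^ 2) * ‖T w‖ := fun w => by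
    refine le_of_tendsto (hL w).abs ?_
    filter_upwards [self_mem_nhdsWithin] with y hy
    refine (abs_integral_mul_le hf
      (memLp_conjPotential (CompactH1.integrable w.2) w.2.supp hy)).trans ?_
    gcongr
    refine Real.sqrt_le_iff.2 ⟨norm_nonneg _, ?_⟩
    have : ‖T w‖ ^ 2 = ∫ t, (w : ℝ → ℝ) t ^ 2 := by
      refine (norm_toLp_sq (CompactH1.memLp_two w.2)).trans ?_
      simp
    rw [this]
    exact integral_conjPotential_sq_le (CompactH1.integrable w.2) (CompactH1.memLp_two w.2)
      w.2.supp hy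
  obtain ⟨g, -, -, hg⟩ := exists_riesz_of_le T l (Real.sqrt_nonneg _) hb
  refine ⟨g, Lp.memLp g, fun w hw => ?_⟩
  have h1 := hg ⟨w, hw⟩
  rw [L2.inner_def] at h1
  have h2 : ∫ t, g t * w t = l ⟨w, hw⟩ := by
    rw [← h1]
    refine integral_congr_ae ?_
    have : (T ⟨w, hw⟩ : ℝ → ℝ) =ᵐ[volume] w := (CompactH1.memLp_two hw).coeFn_toLp
    filter_upwards [this] with t ht
    rw [ht]
    simp [mul_comm]
  rw [h2]
  exact hL ⟨w, hw⟩

/-! ### Uniqueness of the stray field. -/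

/-- The stray field is unique, so that its Dirichlet integral is the stray field energy. -/
lemma strayFieldIntegral_eq {f : ℝ → ℝ} {G : ℝ × ℝ → Plane} (hG : IsStrayField f G) :
    strayFieldIntegral f = ENNReal.ofReal (∫ x, ‖G x‖ ^ 2 ∂halfPlaneMeasure) := by
  have hval : ∫⁻ x, ‖G x‖ₑ ^ 2 ∂halfPlaneMeasure =
      ENNReal.ofReal (∫ x, ‖G x‖ ^ 2 ∂halfPlaneMeasure) := by
    rw [ofReal_integral_eq_lintegral_ofReal
      ((memLp_two_iff_integrable_sq_norm hG.1.1.1).1 hG.1.1) (.of_forall fun _ => by positivity)]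
    refine lintegral_congr fun x => ?_
    rw [ENNReal.ofReal_pow (norm_nonneg _), ofReal_norm]
  rw [← hval]
  refine le_antisymm (iInf₂_le G hG) (le_iInf₂ fun G' hG' => le_of_eq (lintegral_congr_ae ?_))
  -- The difference of two stray fields lies in the closure of the gradients and is orthogonal to
  -- all of them.
  have h0 : hG.1.1.toLp G - hG'.1.1.toLp G' = 0 := by
    refine eq_zero_of_mem_closure (sub_mem (mem_closure_gradLin hG.1) (mem_closure_gradLin hG'.1))
      fun ζ => ?_
    rw [inner_sub_left]
    simp only [gradLin, LinearMap.coe_mk, AddHom.coe_mk, inner_toLp]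
    rw [hG.2 _ ζ.2, hG'.2 _ ζ.2, sub_self]
  have h1 := (MemLp.toLp_eq_toLp_iff _ _).1 (sub_eq_zero.1 h0)
  filter_upwards [h1] with x hx
  rw [hx]

/-! ### The energy in terms of the phase. -/

lemma comp_ofPhase_zero (ψ : ℝ → ℝ) : comp (ofPhase ψ) 0 = fun x => cos (ψ x) := by
  ext x; simp [comp, ofPhase]

lemma comp_ofPhase_one (ψ : ℝ → ℝ) : comp (ofPhase ψ) 1 = fun x => sin (ψ x) := by
  ext x; simp [comp, ofPhase]

/-- Arc against chord: the chord has length 2 |sin((a - b)/2)|, and Jordan's inequality bounds the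
sine below on [0, π/2]. -/
lemma abs_sub_le_cos_sin {a b : ℝ} (h : |a - b| < π) :
    |a - b| ≤ π * (|cos a - cos b| + |sin a - sin b|) := by
  have h1 : 2 / π * |(a - b) / 2| ≤ |sin ((a - b) / 2)| := by
    have h2 := Real.mul_le_sin (x := |(a - b) / 2|) (abs_nonneg _) (by
      rw [abs_div, abs_two]; linarith)
    rcases abs_choice ((a - b) / 2) with h | h <;> rw [h] at h2 ⊢
    · exact h2.trans (le_abs_self _)
    · rw [Real.sin_neg] at h2
      exact h2.trans (neg_le_abs _)
  have h3 : (cos a - cos b) ^ 2 + (sin a - sin b) ^ 2 = 4 * sin ((a - b) / 2) ^ 2 := by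
    have h4 : sin ((a - b) / 2) ^ 2 = (1 - cos (a - b)) / 2 := by
      rw [Real.sin_sq_eq_half_sub, show 2 * ((a - b) / 2) = a - b by ring]; ring
    rw [h4, Real.cos_sub]
    nlinarith [Real.sin_sq_add_cos_sq a, Real.sin_sq_add_cos_sq b]
  have h5 : 2 * |sin ((a - b) / 2)| ≤ |cos a - cos b| + |sin a - sin b| := by
    refine abs_le_of_sq_le_sq' ?_ (by positivity) |>.2
    rw [mul_pow, sq_abs]
    nlinarith [sq_abs (cos a - cos b), sq_abs (sin a - sin b),
      mul_nonneg (abs_nonneg (cos a - cos b)) (abs_nonneg (sin a - sin b))]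
  have h6 : |a - b| = π * (2 / π * |(a - b) / 2|) := by
    rw [abs_div, abs_two]; field_simp
  rw [h6]
  have := abs_nonneg (sin ((a - b) / 2))
  gcongr
  linarith

lemma locallyAC_of_memH1LocCircle {φ : ℝ → ℝ} (hφ : Continuous φ)
    (hm : MemH1LocCircle (ofPhase φ)) : LocallyAC φ := by
  have h0 := LocallyAC.of_le fun a b hab => (hm.1 0 a b hab).1
  have h1 := LocallyAC.of_le fun a b hab => (hm.1 1 a b hab).1
  rw [comp_ofPhase_zero] at h0
  rw [comp_ofPhase_one] at h1
  exact .of_dist_le hφ h0 h1 Real.pi_pos fun x y hxy => by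
    simp only [Real.dist_eq] at hxy ⊢
    exact abs_sub_le_cos_sin hxy

/-- Twice the anisotropy potential in terms of the phase. -/
def well (h p : ℝ) : ℝ := (1 - cos p) * (2 * h - 1 - cos p)

lemma two_mul_anisotropy {h : ℝ} (hh : 1 < h) (ψ : ℝ → ℝ) (x : ℝ) :
    2 * anisotropy h (ofPhase ψ x) = well h (ψ x) := by
  simp [anisotropy, ofPhase, wellHeight, min_eq_right hh.le, well]
  ring

/-- Here h > 1 becomes coercivity: the energy then controls the integral of 1 - cos φ, and hence
that of sin² φ. -/
lemma le_well (h p : ℝ) : 2 * (h - 1) * (1 - cos p) ≤ well h p := by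
  unfold well
  nlinarith [Real.cos_le_one p]

lemma well_nonneg {h : ℝ} (hh : 1 < h) (p : ℝ) : 0 ≤ well h p :=
  (mul_nonneg (by linarith) (by linarith [Real.cos_le_one p])).trans (le_well h p)

lemma continuous_well (h : ℝ) : Continuous (well h) := by unfold well; fun_prop

lemma hasDerivAt_well (h p : ℝ) : HasDerivAt (well h) (2 * sin p * (h - cos p)) p := by
  have h1 := (Real.hasDerivAt_cos p).const_sub 1
  have h2 := (Real.hasDerivAt_cos p).const_sub (2 * h - 1)
  exact (h1.mul h2).congr_deriv (by ring)

lemma ae_deriv_cos {ψ : ℝ → ℝ} (hψ : LocallyAC ψ) :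
    ∀ᵐ x, deriv (fun x => cos (ψ x)) x = -sin (ψ x) * deriv ψ x := by
  filter_upwards [hψ.ae_hasDerivAt] with x hx using hx.cos.deriv

lemma ae_deriv_sin {ψ : ℝ → ℝ} (hψ : LocallyAC ψ) :
    ∀ᵐ x, deriv (fun x => sin (ψ x)) x = cos (ψ x) * deriv ψ x := by
  filter_upwards [hψ.ae_hasDerivAt] with x hx using hx.sin.deriv

lemma energy_ofPhase {h : ℝ} (hh : 1 < h) {ψ : ℝ → ℝ} (hψ : LocallyAC ψ) :
    energy h (ofPhase ψ) = 2⁻¹ * (∫⁻ x, ENNReal.ofReal (deriv ψ x ^ 2 + well h (ψ x))) +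
      2⁻¹ * strayFieldIntegral (fun x => cos (ψ x)) := by
  unfold energy
  rw [comp_ofPhase_zero, comp_ofPhase_one]
  congr 2
  refine lintegral_congr_ae ?_
  filter_upwards [ae_deriv_cos hψ, ae_deriv_sin hψ] with x h1 h2
  rw [two_mul_anisotropy hh, h1, h2]
  congr 2
  nlinarith [Real.sin_sq_add_cos_sq (ψ x)]

/-- The phase `ψ` has finite energy, and `G` is its stray field. -/
structure FiniteEnergyPhase (h : ℝ) (ψ : ℝ → ℝ) (G : ℝ × ℝ → Plane) : Prop where
  ac : LocallyAC ψ
  memLp : MemLp (deriv ψ) 2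
  integrable_well : Integrable fun x => well h (ψ x)
  strayField : IsStrayField (fun x => cos (ψ x)) G

namespace FiniteEnergyPhase

variable {h : ℝ} {ψ : ℝ → ℝ} {G : ℝ × ℝ → Plane}

lemma energy_eq (hh : 1 < h) (hψ : FiniteEnergyPhase h ψ G) : energy h (ofPhase ψ) =
    ENNReal.ofReal (2⁻¹ * ((∫ x, (deriv ψ x ^ 2 + well h (ψ x))) +
      ∫ x, ‖G x‖ ^ 2 ∂halfPlaneMeasure)) := by
  have e := ofReal_integral_eq_lintegral_ofReal (hψ.memLp.integrable_sq.add hψ.integrable_well)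
    (.of_forall fun x => add_nonneg (sq_nonneg _) (well_nonneg hh _))
  simp only [Pi.add_apply] at e
  rw [energy_ofPhase hh hψ.ac, strayFieldIntegral_eq hψ.strayField, ← mul_add,
    ENNReal.ofReal_mul (by norm_num), ENNReal.ofReal_add, ← e]
  · congr 1
    rw [ENNReal.ofReal_inv_of_pos two_pos]
    simp
  · exact integral_nonneg fun x => add_nonneg (sq_nonneg _) (well_nonneg hh _)
  · exact integral_nonneg fun x => by positivity

lemma memLp_deriv_cos (hψ : FiniteEnergyPhase h ψ G) : MemLp (deriv fun x => cos (ψ x)) 2 := by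
  refine hψ.memLp.mono (aestronglyMeasurable_deriv _ _) ?_
  filter_upwards [ae_deriv_cos hψ.ac] with x hx
  rw [hx, norm_mul, norm_neg]
  exact mul_le_of_le_one_left (norm_nonneg _) (Real.abs_sin_le_one _)

lemma memLp_deriv_sin (hψ : FiniteEnergyPhase h ψ G) : MemLp (deriv fun x => sin (ψ x)) 2 := by
  refine hψ.memLp.mono (aestronglyMeasurable_deriv _ _) ?_
  filter_upwards [ae_deriv_sin hψ.ac] with x hx
  rw [hx, norm_mul]
  exact mul_le_of_le_one_left (norm_nonneg _) (Real.abs_cos_le_one _)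

lemma mem_admissible (hh : 1 < h) (hψ : FiniteEnergyPhase h ψ G) {p q : ℝ}
    (hp : Tendsto ψ atTop (𝓝 p)) (hq : Tendsto ψ atBot (𝓝 q)) {D : ℝ}
    (hD : D = (p - q) / (2 * π)) : ofPhase ψ ∈ admissible h D := by
  refine ⟨⟨fun i => ?_, fun x => ?_⟩, ?_, ψ, hψ.ac.continuous, rfl, p, q, hp, hq, hD⟩
  · intro a b _
    fin_cases i
    · simp only [Fin.zero_eta, comp_ofPhase_zero]
      exact ⟨hψ.ac.cos a b, hψ.memLp_deriv_cos.restrict _⟩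
    · simp only [Fin.mk_one, comp_ofPhase_one]
      exact ⟨hψ.ac.sin a b, hψ.memLp_deriv_sin.restrict _⟩
  · rw [EuclideanSpace.norm_eq]
    simp [ofPhase, Fin.sum_univ_two]
  · rw [hψ.energy_eq hh]
    exact ENNReal.ofReal_lt_top

end FiniteEnergyPhase

lemma exists_finiteEnergyPhase {h : ℝ} (hh : 1 < h) {φ : ℝ → ℝ} (hφ : Continuous φ)
    (hm : MemH1LocCircle (ofPhase φ)) (he : energy h (ofPhase φ) < ⊤) :
    ∃ G, FiniteEnergyPhase h φ G := by
  have hac := locallyAC_of_memH1LocCircle hφ hm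
  rw [energy_ofPhase hh hac, ENNReal.add_lt_top] at he
  have h2 : (2⁻¹ : ℝ≥0∞) ≠ 0 := by simp
  have he1 : ∫⁻ x, ENNReal.ofReal (deriv φ x ^ 2 + well h (φ x)) < ⊤ := by
    by_contra hc
    rw [not_lt, top_le_iff] at hc
    rw [hc, ENNReal.mul_top h2] at he
    exact he.1.ne rfl
  have he2 : strayFieldIntegral (fun x => cos (φ x)) < ⊤ := by
    by_contra hc
    rw [not_lt, top_le_iff] at hc
    rw [hc, ENNReal.mul_top h2] at he
    exact he.2.ne rfl
  -- A finite infimum shows that a stray field exists, since the empty infimum is ∞.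
  obtain ⟨G, hG, -⟩ : ∃ G, ∃ _ : IsStrayField (fun x => cos (φ x)) G,
      ∫⁻ x, ‖G x‖ₑ ^ 2 ∂halfPlaneMeasure < ⊤ := by
    simpa only [strayFieldIntegral, iInf_lt_iff] using he2
  have hm1 : AEStronglyMeasurable fun x => deriv φ x ^ 2 :=
    (aestronglyMeasurable_deriv _ _).pow 2
  have hm2 : AEStronglyMeasurable fun x => well h (φ x) :=
    ((continuous_well h).comp hφ).aestronglyMeasurable
  have hi : Integrable fun x => deriv φ x ^ 2 + well h (φ x) := by
    refine ⟨hm1.add hm2, ?_⟩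
    rw [hasFiniteIntegral_iff_ofReal
      (.of_forall fun x => add_nonneg (sq_nonneg _) (well_nonneg hh _))]
    exact he1
  refine ⟨G, hac, ?_, ?_, hG⟩
  · rw [memLp_two_iff_integrable_sq (aestronglyMeasurable_deriv _ _)]
    refine hi.mono' hm1 (.of_forall fun x => ?_)
    rw [Real.norm_of_nonneg (sq_nonneg _)]
    linarith [well_nonneg hh (φ x)]
  · refine hi.mono' hm2 (.of_forall fun x => ?_)
    rw [Real.norm_of_nonneg (well_nonneg hh _)]
    linarith [sq_nonneg (deriv φ x)]

/-! ### The first variation. -/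

lemma IsHomogeneousSobolevGradient.add {G U : ℝ × ℝ → Plane} (hG : IsHomogeneousSobolevGradient G)
    (hU : IsHomogeneousSobolevGradient U) : IsHomogeneousSobolevGradient (G + U) := by
  refine ⟨hG.1.add hU.1, fun ε hε => ?_⟩
  obtain ⟨ζ, hζ, h1⟩ := hG.2 (ε / 2) (ENNReal.half_pos hε.ne')
  obtain ⟨η, hη, h2⟩ := hU.2 (ε / 2) (ENNReal.half_pos hε.ne')
  refine ⟨ζ + η, isTestFunction_add hζ hη, ?_⟩
  have e : G + U - grad (ζ + η) = (G - grad ζ) + (U - grad η) := by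
    have : grad (ζ + η) = grad ζ + grad η := by
      ext x i
      have h1 := (hζ.1.differentiable (by simp)) x
      have h2 := (hη.1.differentiable (by simp)) x
      fin_cases i <;> simp [grad, fderiv_add h1 h2]
    rw [this]; abel
  rw [e]
  calc _ ≤ _ := eLpNorm_add_le (hG.1.1.sub (memLp_grad hζ).1) (hU.1.1.sub (memLp_grad hη).1)
        (by norm_num)
    _ < ε / 2 + ε / 2 := ENNReal.add_lt_add h1 h2
    _ = ε := ENNReal.add_halves ε

lemma IsStrayField.add {f w v : ℝ → ℝ} {G U : ℝ × ℝ → Plane} (hG : IsStrayField f G)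
    (hU : IsStrayField w U) (hf : MemLp (deriv f) 2) (hw : MemLp (deriv w) 2)
    (hv : ∀ᵐ t, deriv v t = deriv f t + deriv w t) : IsStrayField v (G + U) := by
  refine ⟨hG.1.add hU.1, fun ζ hζ => ?_⟩
  have h1 : Integrable fun t => deriv f t * ζ (t, 0) := hf.integrable_mul hζ.memLp_trace
  have h2 : Integrable fun t => deriv w t * ζ (t, 0) := hw.integrable_mul hζ.memLp_trace
  have e : ∫ t, deriv v t * ζ (t, 0) = ∫ t, (deriv f t * ζ (t, 0) + deriv w t * ζ (t, 0)) := by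
    refine integral_congr_ae ?_
    filter_upwards [hv] with t ht
    rw [ht]; ring
  rw [e, integral_add h1 h2, ← hG.2 ζ hζ, ← hU.2 ζ hζ,
    ← integral_add (MemLp.integrable_inner hG.1.1 (memLp_grad hζ))
      (MemLp.integrable_inner hU.1.1 (memLp_grad hζ))]
  simp [inner_add_left]

/-- The change of `cos φ` under the variation `φ + t η`. -/
lemma compactH1_variation {φ η : ℝ → ℝ} (hφ : LocallyAC φ) (hφ2 : MemLp (deriv φ) 2)
    (hη : ContDiff ℝ 1 η) (hc : HasCompactSupport η) (t : ℝ) :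
    CompactH1 (fun x => cos (φ x + t * η x) - cos (φ x)) ∧
    ∀ᵐ x, |deriv (fun x => cos (φ x + t * η x) - cos (φ x)) x| ≤
      |t| * (|η x| * |deriv φ x| + |deriv η x|) := by
  have hη' := LocallyAC.of_contDiff hη
  have hac := (hφ.add (hη'.const_mul t)).cos.sub hφ.cos
  have hae : ∀ᵐ x, |deriv (fun x => cos (φ x + t * η x) - cos (φ x)) x| ≤
      |t| * (|η x| * |deriv φ x| + |deriv η x|) := by
    filter_upwards [hφ.ae_hasDerivAt] with x hx
    have h1 : HasDerivAt η (deriv η x) x := ((hη.differentiable (by simp)) x).hasDerivAt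
    have hd : HasDerivAt (fun x => cos (φ x + t * η x) - cos (φ x))
        (-sin (φ x + t * η x) * (deriv φ x + t * deriv η x) - -sin (φ x) * deriv φ x) x :=
      (hx.add (h1.const_mul t)).cos.sub hx.cos
    rw [hd.deriv]
    -- This grouping exhibits a factor t in each term: by the Lipschitz bound for the sine in the
    -- first, explicitly in the second.
    have e : -sin (φ x + t * η x) * (deriv φ x + t * deriv η x) - -sin (φ x) * deriv φ x =
        -((sin (φ x + t * η x) - sin (φ x)) * deriv φ x) - t * (sin (φ x + t * η x) * deriv η x) := by
      ring
    rw [e]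
    have h2 : |sin (φ x + t * η x) - sin (φ x)| ≤ |t| * |η x| := by
      refine (Real.abs_sin_sub_sin_le _ _).trans ?_
      rw [add_sub_cancel_left, abs_mul]
    calc _ ≤ |sin (φ x + t * η x) - sin (φ x)| * |deriv φ x| +
          |t| * (|sin (φ x + t * η x)| * |deriv η x|) := by
          refine (abs_sub _ _).trans ?_
          rw [abs_neg, abs_mul, abs_mul, abs_mul]
      _ ≤ |t| * |η x| * |deriv φ x| + |t| * (1 * |deriv η x|) := by
          gcongr
          exact Real.abs_sin_le_one _
      _ = _ := by ring
  obtain ⟨M, hM⟩ := hη.continuous.bounded_above_of_compact_support hc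
  have hM0 : 0 ≤ M := (norm_nonneg _).trans (hM 0)
  refine ⟨⟨hac, ?_, ?_⟩, hae⟩
  · refine HasCompactSupport.intro hc.isCompact fun x hx => ?_
    simp [image_eq_zero_of_notMem_tsupport hx]
  · have hη2 : MemLp (deriv η) 2 :=
      (hη.continuous_deriv le_rfl).memLp_of_hasCompactSupport hc.deriv
    refine (((hφ2.norm.const_mul M).add hη2.norm).const_mul |t|).mono'
      (aestronglyMeasurable_deriv _ _) ?_
    filter_upwards [hae] with x hx
    refine hx.trans ?_
    simp only [Pi.add_apply, Real.norm_eq_abs]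
    gcongr
    exact hM x

/-- The variation of the nonquadratic part of the energy. -/
lemma tendsto_integral_slope {φ η k : ℝ → ℝ} {F F' : ℝ → ℝ} {L : ℝ} (hφ : Continuous φ)
    (hη : Continuous η) (hF : ∀ p, HasDerivAt F (F' p) p) (hL : ∀ p, |F' p| ≤ L)
    (hk : Integrable fun x => k x * η x) (hkm : AEStronglyMeasurable k) :
    Tendsto (fun t : ℝ => ∫ x, t⁻¹ * (k x * (F (φ x + t * η x) - F (φ x)))) (𝓝[>] 0)
      (𝓝 (∫ x, k x * (F' (φ x) * η x))) := by
  have hlip : ∀ a b, |F a - F b| ≤ L * |a - b| := fun a b =>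
    Convex.norm_image_sub_le_of_norm_hasDerivWithin_le (𝕜 := ℝ) (s := univ)
      (fun x _ => (hF x).hasDerivWithinAt) (fun x _ => hL x) convex_univ (mem_univ b) (mem_univ a)
  have hFc : Continuous F := continuous_iff_continuousAt.2 fun p => (hF p).continuousAt
  refine tendsto_integral_filter_of_dominated_convergence (fun x => L * |k x * η x|)
    (.of_forall fun t => ?_) ?_ (hk.abs.const_mul L) (.of_forall fun x => ?_)
  · refine (hkm.mul ?_).const_mul _
    exact ((hFc.comp (hφ.add (continuous_const.mul hη))).sub (hFc.comp hφ)).aestronglyMeasurable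
  · filter_upwards [self_mem_nhdsWithin] with t ht
    refine .of_forall fun x => ?_
    simp only [mem_Ioi] at ht
    rw [Real.norm_eq_abs, abs_mul, abs_mul, abs_of_pos (inv_pos.2 ht), abs_mul]
    have := hlip (φ x + t * η x) (φ x)
    rw [add_sub_cancel_left, abs_mul, abs_of_pos ht] at this
    calc _ ≤ t⁻¹ * (|k x| * (L * (t * |η x|))) := by gcongr
      _ = _ := by field_simp
  · have h1 : HasDerivAt (fun t : ℝ => F (φ x + t * η x)) (F' (φ x) * η x) 0 := by
      have h2 : HasDerivAt (fun t : ℝ => φ x + t * η x) (η x) 0 := by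
        simpa using ((hasDerivAt_id (0 : ℝ)).mul_const (η x)).const_add (φ x)
      have h3 : HasDerivAt F (F' (φ x)) (φ x + 0 * η x) := by simpa using hF (φ x)
      exact h3.comp 0 h2
    have h4 := (hasDerivAt_iff_tendsto_slope_zero.1 h1).mono_left
      (nhdsWithin_mono 0 fun t (ht : 0 < t) => ht.ne')
    have h5 := h4.const_mul (k x)
    refine h5.congr fun t => ?_
    simp only [zero_add, zero_mul, add_zero, smul_eq_mul]
    ring

/-- The phase `φ` minimises the energy under compactly supported perturbations. -/
def IsLocalMinimiser (h : ℝ) (φ : ℝ → ℝ) : Prop :=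
  ∀ ψ G, FiniteEnergyPhase h ψ G → HasCompactSupport (fun x => ψ x - φ x) →
    energy h (ofPhase φ) ≤ energy h (ofPhase ψ)

-- Compare φ with φ + tη for t > 0. With w the change of cos φ and U its stray field, the energy of
-- G + U exceeds that of G by the cross term 2 ∫ g w and by ‖U‖² = O(t²). Division by t and t → 0
-- leave the first variation; an inequality suffices, as η can be replaced by -η.
set_option maxHeartbeats 800000 in
lemma variation_nonneg {h : ℝ} (hh : 1 < h) {φ : ℝ → ℝ} {G : ℝ × ℝ → Plane}
    (hφ : FiniteEnergyPhase h φ G) (hmin : IsLocalMinimiser h φ) {g : ℝ → ℝ} (hg2 : MemLp g 2)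
    (hg : ∀ w, CompactH1 w → Tendsto (fun y => ∫ t, deriv (fun x => cos (φ x)) t *
      conjPotential w t y) (𝓝[>] 0) (𝓝 (∫ t, g t * w t)))
    {η : ℝ → ℝ} (hη : ContDiff ℝ 1 η) (hc : HasCompactSupport η) :
    0 ≤ (∫ x, deriv φ x * deriv η x) + ∫ x, sin (φ x) * (h - cos (φ x) - g x) * η x := by
  have hη2 : MemLp (deriv η) 2 :=
    (hη.continuous_deriv le_rfl).memLp_of_hasCompactSupport hc.deriv
  have hη0 : MemLp η 2 := hη.continuous.memLp_of_hasCompactSupport hc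
  have hηi : Integrable η := hη.continuous.integrable_of_hasCompactSupport hc
  have hφc := hφ.ac.continuous
  obtain ⟨M, hM⟩ := hη.continuous.bounded_above_of_compact_support hc
  have hM0 : 0 ≤ M := (norm_nonneg _).trans (hM 0)
  set P := ∫ x, deriv φ x * deriv η x with hP
  set Q := ∫ x, deriv η x ^ 2 with hQ
  have hb2 : MemLp (fun x => |η x| * |deriv φ x| + |deriv η x|) 2 := by
    refine ((hφ.memLp.norm.const_mul M).add hη2.norm).mono'
      ((hη.continuous.abs.aestronglyMeasurable.mul hφ.memLp.norm.1).add hη2.norm.1)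
      (.of_forall fun x => ?_)
    simp only [Pi.add_apply, Real.norm_eq_abs]
    rw [abs_of_nonneg (by positivity)]
    gcongr
    exact hM x
  -- With these constants ‖w'‖ ≤ t B and ‖w‖ ≤ t E, whence ‖U‖² ≤ t² B E.
  set B := √(∫ x, (|η x| * |deriv φ x| + |deriv η x|) ^ 2) with hB
  set E := √(∫ x, η x ^ 2) with hE
  have key : ∀ t : ℝ, 0 < t → 0 ≤ 2 * P + t * Q +
      (∫ x, t⁻¹ * (1 * (well h (φ x + t * η x) - well h (φ x)))) +
      2 * (∫ x, t⁻¹ * (g x * (cos (φ x + t * η x) - cos (φ x)))) + t * (B * E) := by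
    intro t ht
    obtain ⟨hw, hwd⟩ := compactH1_variation hφ.ac hφ.memLp hη hc t
    set w : ℝ → ℝ := fun x => cos (φ x + t * η x) - cos (φ x) with hwdef
    obtain ⟨U, hU, hUn, hUl⟩ := hw.exists_strayField
    -- Both sides are limits of the same integrals as y → 0.
    have hGU : ∫ x, (inner ℝ (G x) (U x) : ℝ) ∂halfPlaneMeasure = ∫ x, g x * w x :=
      tendsto_nhds_unique (hUl _ G hφ.strayField hφ.memLp_deriv_cos) (hg w hw)
    have hψac : LocallyAC (fun x => φ x + t * η x) :=
      hφ.ac.add ((LocallyAC.of_contDiff hη).const_mul t)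
    have hψd : ∀ᵐ x, deriv (fun x => φ x + t * η x) x = deriv φ x + t * deriv η x := by
      filter_upwards [hφ.ac.ae_hasDerivAt] with x hx
      exact (hx.add ((hη.differentiable (by simp) x).hasDerivAt.const_mul t)).deriv
    have hψ2 : MemLp (deriv fun x => φ x + t * η x) 2 :=
      (hφ.memLp.add (hη2.const_mul t)).ae_eq (hψd.mono fun x hx => hx.symm)
    have hdiff : Integrable fun x => well h (φ x + t * η x) - well h (φ x) := by
      refine Continuous.integrable_of_hasCompactSupport ?_ ?_
      · exact ((continuous_well h).comp hψac.continuous).sub ((continuous_well h).comp hφc)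
      · refine HasCompactSupport.intro hc.isCompact fun x hx => ?_
        simp [image_eq_zero_of_notMem_tsupport hx]
    have hψw : Integrable fun x => well h (φ x + t * η x) :=
      (hdiff.add hφ.integrable_well).congr (.of_forall fun x => by simp)
    have hcosd : ∀ᵐ x, deriv (fun x => cos (φ x + t * η x)) x =
        deriv (fun x => cos (φ x)) x + deriv w x := by
      filter_upwards [hφ.ac.cos.ae_hasDerivAt, hw.ac.ae_hasDerivAt] with x h1 h2
      rw [← (h1.add h2).deriv]
      congr 1
      ext x
      simp [hwdef]
    have hψ : FiniteEnergyPhase h (fun x => φ x + t * η x) (G + U) :=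
      ⟨hψac, hψ2, hψw, hφ.strayField.add hU hφ.memLp_deriv_cos hw.memLp hcosd⟩
    have hle := hmin _ _ hψ (by
      refine HasCompactSupport.intro hc.isCompact fun x hx => ?_
      simp [image_eq_zero_of_notMem_tsupport hx])
    rw [hφ.energy_eq hh, hψ.energy_eq hh, ENNReal.ofReal_le_ofReal_iff (by
      refine mul_nonneg (by norm_num) (add_nonneg ?_ ?_)
      · exact integral_nonneg fun x => add_nonneg (sq_nonneg _) (well_nonneg hh _)
      · exact integral_nonneg fun x => by positivity)] at hle
    have hU2 : MemLp (U : ℝ × ℝ → Plane) 2 halfPlaneMeasure := Lp.memLp U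
    have hG2 := hφ.strayField.1.1
    have e1 : ∫ x, ‖(G + U) x‖ ^ 2 ∂halfPlaneMeasure =
        ∫ x, ‖G x‖ ^ 2 ∂halfPlaneMeasure + 2 * (∫ x, g x * w x) + ‖U‖ ^ 2 := by
      have hUs : ‖U‖ ^ 2 = ∫ x, ‖U x‖ ^ 2 ∂halfPlaneMeasure := by
        rw [← norm_toLp_sq hU2, Lp.toLp_coeFn]
      rw [hUs, ← hGU, ← integral_const_mul, ← integral_add, ← integral_add]
      · refine integral_congr_ae (.of_forall fun x => ?_)
        simp only [Pi.add_apply]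
        rw [@norm_add_sq_real]
      · exact ((memLp_two_iff_integrable_sq_norm hG2.1).1 hG2).add
          ((MemLp.integrable_inner hG2 hU2).const_mul 2)
      · exact (memLp_two_iff_integrable_sq_norm hU2.1).1 hU2
      · exact (memLp_two_iff_integrable_sq_norm hG2.1).1 hG2
      · exact (MemLp.integrable_inner hG2 hU2).const_mul 2
    have i1 : Integrable fun x => 2 * t * (deriv φ x * deriv η x) :=
      (hφ.memLp.integrable_mul hη2).const_mul (2 * t)
    have i2 : Integrable fun x => t ^ 2 * deriv η x ^ 2 := hη2.integrable_sq.const_mul (t ^ 2)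
    have i3 : Integrable fun x => deriv φ x ^ 2 + well h (φ x) :=
      hφ.memLp.integrable_sq.add hφ.integrable_well
    have e2 : ∫ x, (deriv (fun x => φ x + t * η x) x ^ 2 + well h (φ x + t * η x)) =
        (∫ x, (deriv φ x ^ 2 + well h (φ x))) + (2 * t * P + t ^ 2 * Q +
          ∫ x, (well h (φ x + t * η x) - well h (φ x))) := by
      have i4 : Integrable fun x => 2 * t * (deriv φ x * deriv η x) + t ^ 2 * deriv η x ^ 2 :=
        i1.add i2
      have i5 : Integrable fun x => 2 * t * (deriv φ x * deriv η x) + t ^ 2 * deriv η x ^ 2 +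
        (well h (φ x + t * η x) - well h (φ x)) := i4.add hdiff
      rw [hP, hQ, ← integral_const_mul, ← integral_const_mul, ← integral_add i1 i2,
        ← integral_add i4 hdiff, ← integral_add i3 i5]
      refine integral_congr_ae ?_
      filter_upwards [hψd] with x hx
      rw [hx]
      ring
    have e3 : ∫ x, t⁻¹ * (1 * (well h (φ x + t * η x) - well h (φ x))) =
        t⁻¹ * ∫ x, (well h (φ x + t * η x) - well h (φ x)) := by
      rw [integral_const_mul]; simp
    have e4 : ∫ x, t⁻¹ * (g x * (cos (φ x + t * η x) - cos (φ x))) =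
        t⁻¹ * ∫ x, g x * w x := by rw [integral_const_mul]
    have e5 : ‖U‖ ^ 2 ≤ t ^ 2 * (B * E) := by
      refine hUn.trans ?_
      have b1 : √(∫ x, deriv w x ^ 2) ≤ t * B := by
        rw [hB, ← Real.sqrt_sq ht.le, ← Real.sqrt_mul (sq_nonneg t), ← integral_const_mul]
        refine Real.sqrt_le_sqrt (integral_mono_ae hw.memLp.integrable_sq
          (hb2.integrable_sq.const_mul _) ?_)
        filter_upwards [hwd] with x hx
        rw [← sq_abs, ← mul_pow]
        rw [abs_of_pos ht] at hx
        gcongr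
      have b2 : √(∫ x, w x ^ 2) ≤ t * E := by
        rw [hE, ← Real.sqrt_sq ht.le, ← Real.sqrt_mul (sq_nonneg t), ← integral_const_mul]
        refine Real.sqrt_le_sqrt (integral_mono hw.memLp_two.integrable_sq
          (hη0.integrable_sq.const_mul _) fun x => ?_)
        simp only
        rw [← sq_abs, ← sq_abs (η x), ← mul_pow]
        have : |w x| ≤ t * |η x| := by
          refine (Real.abs_cos_sub_cos_le _ _).trans ?_
          rw [add_sub_cancel_left, abs_mul, abs_of_pos ht]
        gcongr
      calc _ ≤ (t * B) * (t * E) := by gcongr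
        _ = _ := by ring
    rw [e1, e2] at hle
    rw [e3, e4]
    have h6 : 0 ≤ 2 * t * P + t ^ 2 * Q + (∫ x, (well h (φ x + t * η x) - well h (φ x))) +
        2 * (∫ x, g x * w x) + t ^ 2 * (B * E) := by linarith
    have h7 := mul_nonneg (inv_pos.2 ht).le h6
    calc 0 ≤ _ := h7
      _ = _ := by field_simp
  have l1 : Tendsto (fun t : ℝ => ∫ x, t⁻¹ * (1 * (well h (φ x + t * η x) - well h (φ x))))
      (𝓝[>] 0) (𝓝 (∫ x, 1 * (2 * sin (φ x) * (h - cos (φ x)) * η x))) :=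
    tendsto_integral_slope (k := fun _ => 1) hφc hη.continuous (hasDerivAt_well h)
      (L := 2 * 1 * (h + 1))
      (fun p => by
        rw [abs_mul, abs_mul, abs_two]
        gcongr
        · exact Real.abs_sin_le_one p
        · rw [abs_le]
          constructor <;> linarith [Real.cos_le_one p, Real.neg_one_le_cos p])
      (by simpa using hηi) aestronglyMeasurable_const
  have hgη : Integrable fun x => g x * η x := hg2.integrable_mul hη0
  have l2 : Tendsto (fun t : ℝ => ∫ x, t⁻¹ * (g x * (cos (φ x + t * η x) - cos (φ x))))
      (𝓝[>] 0) (𝓝 (∫ x, g x * (-sin (φ x) * η x))) :=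
    tendsto_integral_slope (k := g) hφc hη.continuous Real.hasDerivAt_cos (L := 1)
      (fun p => by rw [abs_neg]; exact Real.abs_sin_le_one p) hgη hg2.1
  have hid : Tendsto (fun t : ℝ => t) (𝓝[>] (0 : ℝ)) (𝓝 0) := nhdsWithin_le_nhds
  have lim := ((((tendsto_const_nhds (x := 2 * P)).add (hid.mul_const Q)).add l1).add
    (l2.const_mul 2)).add (hid.mul_const (B * E))
  have hnn := ge_of_tendsto lim (by
    filter_upwards [self_mem_nhdsWithin] with t ht using key t ht)
  have j1 : Integrable fun x => 1 * (2 * sin (φ x) * (h - cos (φ x)) * η x) := by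
    refine Continuous.integrable_of_hasCompactSupport (by fun_prop) ?_
    exact hc.mul_left.mul_left
  have j2 : Integrable fun x => g x * (-sin (φ x) * η x) := by
    refine (hgη.norm.mono' (hg2.1.mul (by
      exact ((Real.continuous_sin.comp hφc).neg.mul hη.continuous).aestronglyMeasurable)) (.of_forall fun x => ?_))
    rw [norm_mul, norm_mul, norm_mul, norm_neg, Real.norm_eq_abs (sin _)]
    gcongr
    exact mul_le_of_le_one_left (norm_nonneg _) (Real.abs_sin_le_one _)
  have e : 2 * ∫ x, sin (φ x) * (h - cos (φ x) - g x) * η x =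
      (∫ x, 1 * (2 * sin (φ x) * (h - cos (φ x)) * η x)) +
        2 * ∫ x, g x * (-sin (φ x) * η x) := by
    rw [← integral_const_mul, ← integral_const_mul, ← integral_add j1 (j2.const_mul 2)]
    refine integral_congr_ae (.of_forall fun x => ?_)
    simp only
    ring
  simp only [zero_mul, add_zero] at hnn
  linarith

/-- The weak Euler–Lagrange equation. -/
lemma weak_euler_lagrange {h : ℝ} (hh : 1 < h) {φ : ℝ → ℝ} {G : ℝ × ℝ → Plane}
    (hφ : FiniteEnergyPhase h φ G) (hmin : IsLocalMinimiser h φ) {g : ℝ → ℝ} (hg2 : MemLp g 2)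
    (hg : ∀ w, CompactH1 w → Tendsto (fun y => ∫ t, deriv (fun x => cos (φ x)) t *
      conjPotential w t y) (𝓝[>] 0) (𝓝 (∫ t, g t * w t)))
    {η : ℝ → ℝ} (hη : ContDiff ℝ 1 η) (hc : HasCompactSupport η) :
    ∫ x, deriv φ x * deriv η x = -∫ x, sin (φ x) * (h - cos (φ x) - g x) * η x := by
  have h1 := variation_nonneg hh hφ hmin hg2 hg hη hc
  have h2 := variation_nonneg hh hφ hmin hg2 hg hη.neg (hc.neg)
  have e1 : ∫ x, deriv φ x * deriv (fun x => -η x) x = -∫ x, deriv φ x * deriv η x := by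
    rw [← integral_neg]; simp
  have e2 : ∫ x, sin (φ x) * (h - cos (φ x) - g x) * -η x =
      -∫ x, sin (φ x) * (h - cos (φ x) - g x) * η x := by
    rw [← integral_neg]; simp
  rw [e1, e2] at h2
  linarith

/-! ### Regularity for weak equations on the line. -/

/-- A locally integrable function whose distributional derivative vanishes is constant. -/
lemma ae_eq_const_of_integral_mul_deriv_eq_zero {k : ℝ → ℝ} (hk : LocallyIntegrable k)
    (h : ∀ η : ℝ → ℝ, ContDiff ℝ 1 η → HasCompactSupport η → ∫ x, k x * deriv η x = 0) :
    ∃ c, ∀ᵐ x, k x = c := by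
  let b : ContDiffBump (0 : ℝ) := ⟨1, 2, by norm_num, by norm_num⟩
  set θ₀ : ℝ → ℝ := b.normed volume with hθ₀
  have hθ₀c : Continuous θ₀ := b.continuous_normed
  have hθ₀s : HasCompactSupport θ₀ := b.hasCompactSupport_normed
  have hθ₀i : ∫ x, θ₀ x = 1 := b.integral_normed
  have hki : ∀ θ : ℝ → ℝ, Continuous θ → HasCompactSupport θ → Integrable fun x => k x * θ x :=
    fun θ hθ hs => by
      simpa [mul_comm] using hk.integrable_smul_left_of_hasCompactSupport hθ hs
  refine ⟨∫ x, k x * θ₀ x, ?_⟩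
  refine ae_eq_of_integral_contDiff_smul_eq hk
    (continuous_const.locallyIntegrable) fun θ hθ hs => ?_
  have hθc := hθ.continuous
  set I := ∫ x, θ x with hI
  -- Subtracting a multiple of the bump makes the mean zero, so that the primitive of u has compact
  -- support and is an admissible test function.
  set u : ℝ → ℝ := fun x => θ x - I * θ₀ x with hu
  have huc : Continuous u := hθc.sub (continuous_const.mul hθ₀c)
  have hus : HasCompactSupport u := hs.sub (hθ₀s.mul_left)
  have hui : ∫ x, u x = 0 := by
    rw [hu, integral_sub (hθc.integrable_of_hasCompactSupport hs)
      ((hθ₀c.integrable_of_hasCompactSupport hθ₀s).const_mul I), integral_const_mul, hθ₀i]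
    simp [hI]
  obtain ⟨R, hR, hsub⟩ := hus.exists_Ioo_support
  have hu0 : ∀ x, x ∉ Ioo (-R) R → u x = 0 := fun x hx =>
    image_eq_zero_of_notMem_tsupport fun h => hx (hsub h)
  set η : ℝ → ℝ := fun x => ∫ t in (-R)..x, u t with hη
  have hd : ∀ x, HasDerivAt η (u x) x := fun x =>
    intervalIntegral.integral_hasDerivAt_right (huc.intervalIntegrable _ _)
      huc.stronglyMeasurable.stronglyMeasurableAtFilter huc.continuousAt
  have hde : deriv η = u := funext fun x => (hd x).deriv
  have hη1 : ContDiff ℝ 1 η :=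
    contDiff_one_iff_deriv.2 ⟨fun x => (hd x).differentiableAt, by rwa [hde]⟩
  have hηs : HasCompactSupport η := by
    refine HasCompactSupport.intro (isCompact_Icc (a := -R) (b := R)) fun x hx => ?_
    rw [mem_Icc, not_and_or, not_le, not_le] at hx
    rcases hx with hx | hx
    · refine intervalIntegral.integral_zero_ae (.of_forall fun t ht => hu0 t fun h => ?_)
      rw [uIoc_of_ge hx.le] at ht
      exact absurd ht.2 (not_le.2 h.1)
    · have : η x = ∫ t, u t := by
        refine intervalIntegral.integral_eq_integral_of_support_subset fun t ht => ?_
        by_contra hc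
        refine ht (hu0 t fun h => hc ⟨h.1, h.2.le.trans hx.le⟩)
      rw [this, hui]
  have := h η hη1 hηs
  rw [hde] at this
  have e : ∫ x, k x * u x = (∫ x, k x * θ x) - I * ∫ x, k x * θ₀ x := by
    rw [← integral_const_mul, ← integral_sub (hki θ hθc hs) ((hki θ₀ hθ₀c hθ₀s).const_mul I)]
    refine integral_congr_ae (.of_forall fun x => ?_)
    simp only [hu]
    ring
  rw [e, sub_eq_zero] at this
  simp only [smul_eq_mul]
  rw [integral_mul_const, ← hI, ← this]
  simp [mul_comm]

/-- Regularity for the weak equation `φ'' = R` on the line. -/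
lemma hasDerivAt_of_weak_eq {φ R : ℝ → ℝ} (hφ : LocallyAC φ) (hφ2 : MemLp (deriv φ) 2)
    (hR : LocallyIntegrable R)
    (h : ∀ η : ℝ → ℝ, ContDiff ℝ 1 η → HasCompactSupport η →
      ∫ x, deriv φ x * deriv η x = -∫ x, R x * η x) :
    ∃ c, ∀ x, HasDerivAt φ (c + ∫ t in (0 : ℝ)..x, R t) x := by
  set S : ℝ → ℝ := fun x => ∫ t in (0 : ℝ)..x, R t with hS
  have hSac : LocallyAC S := LocallyAC.of_integral hR 0
  have hSd : ∀ᵐ x, deriv S x = R x := by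
    filter_upwards [LocallyIntegrable.ae_hasDerivAt_integral hR] with x hx
    exact (hx 0).deriv
  have hφl : LocallyIntegrable (deriv φ) := hφ2.locallyIntegrable (by norm_num)
  -- The weak equation says that φ' minus the primitive of R has vanishing distributional
  -- derivative.
  obtain ⟨c, hc⟩ := ae_eq_const_of_integral_mul_deriv_eq_zero
    (k := fun x => deriv φ x - S x) (hφl.sub hSac.continuous.locallyIntegrable) (by
      intro η hη hs
      have hη' := hη.continuous_deriv le_rfl
      have i1 : Integrable fun x => deriv φ x * deriv η x := by
        simpa [mul_comm] using hφl.integrable_smul_left_of_hasCompactSupport hη' hs.deriv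
      have i2 : Integrable fun x => S x * deriv η x :=
        (hSac.continuous.mul hη').integrable_of_hasCompactSupport hs.deriv.mul_left
      simp only [sub_mul]
      rw [integral_sub i1 i2, h η hη hs]
      have h3 := LocallyAC.integral_deriv_mul (.of_contDiff hη) hs hSac
      have h4 : ∫ x, η x * deriv S x = ∫ x, R x * η x := by
        refine integral_congr_ae ?_
        filter_upwards [hSd] with x hx
        rw [hx, mul_comm]
      rw [h4] at h3
      have h5 : ∫ x, S x * deriv η x = ∫ x, deriv η x * S x := by simp [mul_comm]
      rw [h5, h3]
      ring)
  refine ⟨c, fun x => ?_⟩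
  have hcS : Continuous fun x => c + S x := continuous_const.add hSac.continuous
  have hint : ∀ x, φ x = φ 0 + ∫ t in (0 : ℝ)..x, (c + S t) := by
    intro x
    have h1 := (hφ 0 x).integral_deriv_eq_sub
    have h2 : ∫ t in (0 : ℝ)..x, deriv φ t = ∫ t in (0 : ℝ)..x, (c + S t) := by
      refine intervalIntegral.integral_congr_ae ?_
      filter_upwards [hc] with t ht _
      linarith
    rw [← h2, h1]; ring
  have h3 : HasDerivAt (fun x => φ 0 + ∫ t in (0 : ℝ)..x, (c + S t)) (c + S x) x :=
    (intervalIntegral.integral_hasDerivAt_right (hcS.intervalIntegrable _ _)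
      hcS.stronglyMeasurable.stronglyMeasurableAtFilter hcS.continuousAt).const_add _
  rwa [show (fun x => φ 0 + ∫ t in (0 : ℝ)..x, (c + S t)) = φ from funext fun x => (hint x).symm]
    at h3

/-- Cauchy–Schwarz with the indicator of the interval: primitives of L² functions are Hölder
continuous of exponent 1/2. -/
lemma abs_intervalIntegral_le_sqrt {R : ℝ → ℝ} (hR : MemLp R 2) (a b : ℝ) :
    |∫ x in a..b, R x| ≤ √(∫ x, R x ^ 2) * √|b - a| := by
  have h1 : MemLp ((uIoc a b).indicator fun _ => (1 : ℝ)) 2 :=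
    memLp_indicator_const 2 measurableSet_uIoc 1 (Or.inr (by simp [uIoc]))
  have h2 := abs_integral_mul_le hR h1
  have e1 : ∫ x, R x * (uIoc a b).indicator (fun _ => (1 : ℝ)) x = ∫ x in uIoc a b, R x := by
    rw [← integral_indicator measurableSet_uIoc]
    refine integral_congr_ae (.of_forall fun x => ?_)
    by_cases hx : x ∈ uIoc a b <;> simp [hx]
  have e2 : ∫ x, (uIoc a b).indicator (fun _ => (1 : ℝ)) x ^ 2 = |b - a| := by
    have : ∀ x, (uIoc a b).indicator (fun _ => (1 : ℝ)) x ^ 2 =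
        (uIoc a b).indicator (fun _ => (1 : ℝ)) x := fun x => by
      by_cases hx : x ∈ uIoc a b <;> simp [hx]
    simp_rw [this]
    rw [integral_indicator measurableSet_uIoc]
    simp [uIoc, Measure.real, max_sub_min_eq_abs']
    exact abs_sub_comm a b
  rw [e1, e2] at h2
  rwa [← Real.norm_eq_abs, intervalIntegral.norm_intervalIntegral_eq, Real.norm_eq_abs]

/-- A function with square integrable derivative, itself square integrable, is bounded. -/
lemma exists_bound_of_memLp {v R : ℝ → ℝ} {c : ℝ} (hv : ∀ x, v x = c + ∫ t in (0 : ℝ)..x, R t)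
    (hv2 : MemLp v 2) (hR : MemLp R 2) : ∃ M, ∀ x, |v x| ≤ M := by
  have hRl : LocallyIntegrable R := hR.locallyIntegrable (by norm_num)
  have hac : LocallyAC v := by
    have := LocallyAC.add (f := fun _ => c) (.of_contDiff contDiff_const)
      (LocallyAC.of_integral hRl 0)
    rwa [show v = fun x => c + ∫ t in (0 : ℝ)..x, R t from funext hv]
  have hd : ∀ᵐ x, deriv v x = R x := by
    filter_upwards [LocallyIntegrable.ae_hasDerivAt_integral hRl] with x hx
    rw [show v = fun x => c + ∫ t in (0 : ℝ)..x, R t from funext hv]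
    exact ((hx 0).const_add c).deriv
  have hi : Integrable fun x => 2 * (v x * R x) := (hv2.integrable_mul hR).const_mul 2
  set A := ∫ x, |2 * (v x * R x)| with hA
  refine ⟨√(v 0 ^ 2 + A), fun x => Real.abs_le_sqrt ?_⟩
  -- The derivative of v² is 2 v R, which is integrable, so v² differs from its value at 0 by a
  -- bounded amount.
  have h1 := (hac 0 x).integral_deriv_mul_eq_sub (hac 0 x)
  have h2 : ∫ t in (0 : ℝ)..x, deriv v t * v t + v t * deriv v t =
      ∫ t in (0 : ℝ)..x, 2 * (v t * R t) := by
    refine intervalIntegral.integral_congr_ae ?_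
    filter_upwards [hd] with t ht _
    rw [ht]; ring
  have h3 : |∫ t in (0 : ℝ)..x, 2 * (v t * R t)| ≤ A := by
    rw [← Real.norm_eq_abs, intervalIntegral.norm_intervalIntegral_eq]
    exact (norm_integral_le_integral_norm _).trans
      (setIntegral_le_integral hi.abs (.of_forall fun _ => abs_nonneg _))
  rw [h2] at h1
  have := (abs_le.1 h3).2
  nlinarith

/-! ### The Dirichlet-to-Neumann operator through second differences. -/

/-- Bounded functions whose derivative is square integrable and Hölder continuous of exponent
`1/2`. -/
structure HolderDeriv (f : ℝ → ℝ) (B K : ℝ) : Prop where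
  hasDerivAt : ∀ x, HasDerivAt f (deriv f x) x
  memLp : MemLp (deriv f) 2
  bound : ∀ x, |f x| ≤ B
  holder : ∀ a b, |deriv f a - deriv f b| ≤ K * √|a - b|

/-- The symmetric second difference. -/
def secondDiff (f : ℝ → ℝ) (x s : ℝ) : ℝ := f (x + s) + f (x - s) - 2 * f x

/-- The Dirichlet-to-Neumann operator in terms of second differences. -/
def dirichletToNeumann (f : ℝ → ℝ) (x : ℝ) : ℝ :=
  1 / π * ∫ s in Ioi (0 : ℝ), secondDiff f x s / s ^ 2

/-- An integrable majorant for second difference quotients. -/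
def majorant (B K s : ℝ) : ℝ :=
  (Ioc (0 : ℝ) 1).indicator (fun s => 2 * K * s ^ (-(1 / 2 : ℝ))) s +
    (Ioi (1 : ℝ)).indicator (fun s => 4 * B * s ^ (-2 : ℝ)) s

lemma integrable_majorant (B K : ℝ) : Integrable (majorant B K) := by
  refine Integrable.add ?_ ?_
  · rw [integrable_indicator_iff measurableSet_Ioc]
    refine Integrable.const_mul ?_ _
    rw [← IntegrableOn, ← intervalIntegrable_iff_integrableOn_Ioc_of_le zero_le_one]
    exact intervalIntegral.intervalIntegrable_rpow' (by norm_num)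
  · rw [integrable_indicator_iff measurableSet_Ioi]
    exact (integrableOn_Ioi_rpow_of_lt (by norm_num) one_pos).const_mul _

namespace HolderDeriv

variable {f : ℝ → ℝ} {B K : ℝ}

lemma continuous (hf : HolderDeriv f B K) : Continuous f :=
  continuous_iff_continuousAt.2 fun x => (hf.hasDerivAt x).continuousAt

lemma hasDerivAt_secondDiff (hf : HolderDeriv f B K) (x s : ℝ) :
    HasDerivAt (secondDiff f x) (deriv f (x + s) - deriv f (x - s)) s := by
  have h1 := (hf.hasDerivAt (x + s)).comp_const_add x s
  have h2 := (hf.hasDerivAt (x - s)).comp_const_sub x s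
  exact ((h1.add h2).sub_const _).congr_deriv (by ring)

lemma nonneg_const (hf : HolderDeriv f B K) : 0 ≤ K := by
  have := (abs_nonneg _).trans (hf.holder 1 0)
  simpa using this

lemma nonneg_bound (hf : HolderDeriv f B K) : 0 ≤ B := (abs_nonneg _).trans (hf.bound 0)

/-- The s-derivative is a difference of values of f' at distance 2s, hence O(√s). The resulting
power 3/2 makes the quotient by s² integrable at 0. -/
lemma abs_secondDiff_le (hf : HolderDeriv f B K) (x : ℝ) {s : ℝ} (hs : 0 < s) :
    |secondDiff f x s| ≤ 2 * K * (s * √s) := by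
  have h := Convex.norm_image_sub_le_of_norm_hasDerivWithin_le (𝕜 := ℝ) (s := Icc 0 s)
    (f := secondDiff f x) (C := K * (2 * √s))
    (fun t _ => (hf.hasDerivAt_secondDiff x t).hasDerivWithinAt) (fun t ht => by
      refine (hf.holder _ _).trans ?_
      have h1 : √|x + t - (x - t)| ≤ 2 * √s := by
        rw [show x + t - (x - t) = 2 * t by ring, abs_of_nonneg (by linarith [ht.1])]
        refine Real.sqrt_le_iff.2 ⟨by positivity, ?_⟩
        rw [mul_pow, Real.sq_sqrt hs.le]
        linarith [ht.2]
      exact mul_le_mul_of_nonneg_left h1 hf.nonneg_const) (convex_Icc _ _)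
    (left_mem_Icc.2 hs.le) (right_mem_Icc.2 hs.le)
  have h0 : secondDiff f x 0 = 0 := by simp [secondDiff]; ring
  rw [h0, sub_zero, sub_zero, Real.norm_eq_abs, Real.norm_eq_abs, abs_of_pos hs] at h
  linarith

lemma abs_secondDiff_le_bound (hf : HolderDeriv f B K) (x s : ℝ) :
    |secondDiff f x s| ≤ 4 * B := by
  have h1 := abs_le.1 (hf.bound (x + s))
  have h2 := abs_le.1 (hf.bound (x - s))
  have h3 := abs_le.1 (hf.bound x)
  rw [secondDiff, abs_le]
  constructor <;> linarith [h1.1, h1.2, h2.1, h2.2, h3.1, h3.2]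

lemma abs_secondDiff_div_le (hf : HolderDeriv f B K) (x : ℝ) {s : ℝ} (hs : 0 < s) :
    |secondDiff f x s / s ^ 2| ≤ majorant B K s := by
  rw [abs_div, abs_of_pos (by positivity : 0 < s ^ 2), majorant]
  rcases le_or_gt s 1 with h | h
  · have hm : s ∈ Ioc (0 : ℝ) 1 := ⟨hs, h⟩
    rw [indicator_of_mem hm, indicator_of_notMem (by simpa using h),
      add_zero, div_le_iff₀ (by positivity), mul_assoc]
    refine (hf.abs_secondDiff_le x hs).trans (le_of_eq ?_)
    congr 1
    rw [Real.rpow_neg hs.le, ← Real.sqrt_eq_rpow]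
    have := Real.sq_sqrt hs.le
    have h2 : √s ≠ 0 := (Real.sqrt_pos.2 hs).ne'
    field_simp
    rw [this]
  · rw [indicator_of_notMem (fun h' => absurd h'.2 (not_le.2 h)), indicator_of_mem (mem_Ioi.2 h),
      zero_add, Real.rpow_neg hs.le, Real.rpow_two, ← div_eq_mul_inv]
    gcongr
    exact hf.abs_secondDiff_le_bound x s

lemma continuous_secondDiff (hf : HolderDeriv f B K) (x : ℝ) : Continuous (secondDiff f x) := by
  have := hf.continuous
  unfold secondDiff
  fun_prop

lemma aestronglyMeasurable_secondDiff_div (hf : HolderDeriv f B K) (x : ℝ) (μ : Measure ℝ) :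
    AEStronglyMeasurable (fun s => secondDiff f x s / s ^ 2) μ :=
  ((hf.continuous_secondDiff x).measurable.div (by fun_prop)).aestronglyMeasurable

lemma integrableOn_secondDiff_div (hf : HolderDeriv f B K) (x : ℝ) :
    IntegrableOn (fun s => secondDiff f x s / s ^ 2) (Ioi 0) :=
  (integrable_majorant B K).integrableOn.mono' (hf.aestronglyMeasurable_secondDiff_div x _)
    ((ae_restrict_mem measurableSet_Ioi).mono fun _ hs => hf.abs_secondDiff_div_le x hs)

/-- The majorant does not depend on x, which permits dominated convergence. -/
lemma continuous_dirichletToNeumann (hf : HolderDeriv f B K) :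
    Continuous (dirichletToNeumann f) := by
  refine continuous_const.mul (continuous_of_dominated (bound := majorant B K)
    (fun x => hf.aestronglyMeasurable_secondDiff_div x _)
    (fun x => (ae_restrict_mem measurableSet_Ioi).mono fun _ hs => hf.abs_secondDiff_div_le x hs)
    (integrable_majorant B K).integrableOn (.of_forall fun s => ?_))
  have := hf.continuous
  unfold secondDiff
  fun_prop

/-- For fixed s the second difference tends to 0 when f has a limit; the uniform majorant carries
this to the integral. -/
lemma tendsto_dirichletToNeumann (hf : HolderDeriv f B K) {p : ℝ} (hp : Tendsto f atTop (𝓝 p)) :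
    Tendsto (dirichletToNeumann f) atTop (𝓝 0) := by
  have h : Tendsto (fun x => ∫ s in Ioi (0 : ℝ), secondDiff f x s / s ^ 2) atTop
      (𝓝 (∫ s in Ioi (0 : ℝ), (0 : ℝ))) := by
    refine tendsto_integral_filter_of_dominated_convergence (majorant B K)
      (.of_forall fun x => hf.aestronglyMeasurable_secondDiff_div x _)
      (.of_forall fun x => (ae_restrict_mem measurableSet_Ioi).mono
        fun _ hs => hf.abs_secondDiff_div_le x hs)
      (integrable_majorant B K).integrableOn (.of_forall fun s => ?_)
    have h1 := hp.comp (tendsto_atTop_add_const_right atTop s tendsto_id)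
    have h2 := hp.comp (tendsto_atTop_add_const_right atTop (-s) tendsto_id)
    have h3 := ((h1.add h2).sub (hp.const_mul 2)).div_const (s ^ 2)
    rw [show (p + p - 2 * p) / s ^ 2 = 0 by ring_nf] at h3
    exact h3
  have h' := h.const_mul (1 / π)
  rw [integral_zero, mul_zero] at h'
  exact h'

/-- The second difference form of the Dirichlet-to-Neumann operator is its principal value. -/
lemma hasDirichletToNeumann (hf : HolderDeriv f B K) (x : ℝ) :
    HasDirichletToNeumann f x (dirichletToNeumann f x) := by
  have hfc := hf.continuous
  set q : ℝ → ℝ := fun s => (f (x + s) - f x) / s ^ 2 with hq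
  have hqi : ∀ ε : ℝ, 0 < ε → IntegrableOn q {s | ε < |s|} := by
    intro ε hε
    have hm : MeasurableSet {s : ℝ | ε < |s|} := measurableSet_lt measurable_const (by fun_prop)
    have hi : Integrable fun s : ℝ => 2 * B * ((ε⁻¹ + 1) ^ 2 * ((1 + |s|) ^ 2)⁻¹) :=
      (integrable_one_add_abs_inv_sq.const_mul _).const_mul _
    refine hi.integrableOn.mono' ?_ ((ae_restrict_mem hm).mono fun s hs => ?_)
    · refine Measurable.aestronglyMeasurable ?_
      exact ((hfc.measurable.comp (measurable_const_add x)).sub_const _).div (by fun_prop)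
    · have hs' : ε < |s| := hs
      have hs0 : 0 < |s| := hε.trans hs'
      rw [hq, Real.norm_eq_abs, abs_div, abs_of_nonneg (sq_nonneg s), ← sq_abs s]
      have h1 : |f (x + s) - f x| ≤ 2 * B := by
        refine (abs_sub _ _).trans ?_
        linarith [hf.bound (x + s), hf.bound x]
      have h2 : 1 + |s| ≤ (ε⁻¹ + 1) * |s| := by
        have : 1 ≤ ε⁻¹ * |s| := by
          rw [inv_mul_eq_div, le_div_iff₀ hε]; linarith
        linarith
      have h3 : (|s| ^ 2)⁻¹ ≤ (ε⁻¹ + 1) ^ 2 * ((1 + |s|) ^ 2)⁻¹ := by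
        rw [← div_eq_mul_inv, inv_eq_one_div, div_le_div_iff₀ (by positivity) (by positivity),
          one_mul, ← mul_pow]
        gcongr
      rw [div_eq_mul_inv]
      have := hf.nonneg_bound
      gcongr
  have hset : ∀ ε : ℝ, (fun s => x + s) ⁻¹' {t | ε < |t - x|} = {s | ε < |s|} := fun ε => by
    ext s; simp
  have hme : MeasurableEmbedding (fun s : ℝ => x + s) := measurableEmbedding_addLeft x
  have hmp : MeasurePreserving (fun s : ℝ => x + s) := measurePreserving_add_left volume x
  have hqf : (fun t => (f t - f x) / (t - x) ^ 2) ∘ (fun s => x + s) = q := by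
    ext s; simp [hq]
  refine ⟨fun ε hε => ?_, ?_⟩
  · rw [← hmp.integrableOn_comp_preimage hme, hset, hqf]
    exact hqi ε hε
  -- Folding s and -s together replaces the truncated difference quotient by the second difference,
  -- whose integral converges absolutely at 0.
  · have hint : ∀ ε : ℝ, 0 < ε → ∫ t in {t | ε < |t - x|}, (f t - f x) / (t - x) ^ 2 =
        ∫ s in Ioi ε, secondDiff f x s / s ^ 2 := by
      intro ε hε
      have e1 := hmp.setIntegral_preimage_emb hme (fun t => (f t - f x) / (t - x) ^ 2)
        {t | ε < |t - x|}
      rw [hset] at e1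
      have e2 : {s : ℝ | ε < |s|} = Iio (-ε) ∪ Ioi ε := by
        ext s
        simp only [mem_ofPred_eq, mem_union, mem_Iio, mem_Ioi, lt_abs]
        constructor
        · rintro (h | h)
          · exact Or.inr h
          · exact Or.inl (by linarith)
        · rintro (h | h)
          · exact Or.inr (by linarith)
          · exact Or.inl h
      have hI := hqi ε hε
      rw [e2] at hI e1
      have h1 : IntegrableOn q (Iio (-ε)) := hI.mono_set subset_union_left
      have h2 : IntegrableOn q (Ioi ε) := hI.mono_set subset_union_right
      have h3 : ∫ s in Iio (-ε), q s = ∫ s in Ioi ε, q (-s) := by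
        rw [integral_comp_neg_Ioi, integral_Iic_eq_integral_Iio]
      have h4 : IntegrableOn (fun s => q (-s)) (Ioi ε) := by
        have := (Measure.measurePreserving_neg (volume : Measure ℝ)).integrableOn_comp_preimage
          (MeasurableEquiv.neg ℝ).measurableEmbedding (f := q) (s := Iio (-ε))
        have h5 := this.2 h1
        have h6 : Neg.neg ⁻¹' Iio (-ε) = Ioi ε := by ext s; simp
        rw [h6] at h5
        exact h5
      have e3 : ∀ s, (f (x + s) - f x) / (x + s - x) ^ 2 = q s := fun s => by simp [hq]
      simp only [e3] at e1
      rw [← e1, setIntegral_union (by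
        rw [Set.disjoint_left]
        intro s h7 h8
        simp only [mem_Iio, mem_Ioi] at h7 h8
        linarith) measurableSet_Ioi h1 h2, h3, ← integral_add h4 h2]
      refine integral_congr_ae (.of_forall fun s => ?_)
      simp only [hq, secondDiff, neg_sq, ← sub_eq_add_neg]
      rw [← add_div]
      congr 1
      ring
    have hcov : AECover (volume.restrict (Ioi (0 : ℝ))) (𝓝[>] (0 : ℝ)) fun ε : ℝ => Ioi ε :=
      aecover_Ioi_of_Ioi nhdsWithin_le_nhds
    have ht := hcov.integral_tendsto_of_countably_generated (hf.integrableOn_secondDiff_div x)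
    refine (ht.const_mul (1 / π)).congr' ?_
    filter_upwards [self_mem_nhdsWithin] with ε hε
    rw [hint ε hε, Measure.restrict_restrict measurableSet_Ioi,
      inter_eq_self_of_subset_left (Ioi_subset_Ioi (le_of_lt hε))]

end HolderDeriv

/-! ### The interaction density for regular functions. -/

/-- The conjugate Poisson kernel, up to the factor `1 / π`. -/
def conjKer (y s : ℝ) : ℝ := s / (s ^ 2 + y ^ 2)

lemma continuous_conjKer {y : ℝ} (hy : 0 < y) : Continuous (conjKer y) := by
  unfold conjKer
  exact continuous_id.div (by fun_prop) fun s => by positivity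

lemma abs_conjKer_le {y : ℝ} (hy : 0 < y) (s : ℝ) : |conjKer y s| ≤ (y⁻¹ + 1) / (1 + |s|) := by
  rw [conjKer, abs_div, abs_of_pos (by positivity : 0 < s ^ 2 + y ^ 2), ← sq_abs s,
    div_le_div_iff₀ (by positivity) (by positivity)]
  have h1 : y⁻¹ * y ^ 2 = y := by field_simp
  have h2 : |s| ≤ y⁻¹ * (|s| ^ 2 + y ^ 2) := by
    have : |s| * y ≤ |s| ^ 2 + y ^ 2 := by nlinarith [sq_nonneg (|s| - y), sq_nonneg |s|]
    rw [inv_mul_eq_div, le_div_iff₀ hy]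
    exact this
  nlinarith [sq_nonneg y]

lemma memLp_conjKer {y : ℝ} (hy : 0 < y) : MemLp (conjKer y) 2 :=
  memLp_of_decay (continuous_conjKer hy) (abs_conjKer_le hy)

lemma conjPotential_eq {w : ℝ → ℝ} (hw : Integrable w) (t : ℝ) {y : ℝ} (hy : 0 < y) :
    conjPotential w t y = -(1 / π) * ∫ s, w s * conjKer y (t - s) := by
  have hI : Integrable fun s : ℝ => (w s : ℂ) / (upper t y - s) ^ 1 := integrable_cauchyPow hw hy
  have h := Complex.reCLM.integral_comp_comm hI
  have h' : (cauchyPow 1 w (upper t y)).re = ∫ s, ((w s : ℂ) / (upper t y - s) ^ 1).re := h.symm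
  rw [conjPotential, h']
  congr 1
  refine integral_congr_ae (.of_forall fun s => ?_)
  simp only [conjKer, pow_one, Complex.div_re, Complex.sub_re, Complex.sub_im, upper_re,
    upper_im, Complex.ofReal_re, Complex.ofReal_im, Complex.normSq_apply, sub_zero, zero_mul,
    zero_div, add_zero]
  ring

lemma integral_eq_integral_Ioi_add {u : ℝ → ℝ} (hu : Integrable u) :
    ∫ s, u s = ∫ s in Ioi (0 : ℝ), (u s + u (-s)) := by
  have h1 : IntegrableOn (fun s => u (-s)) (Ioi 0) := hu.comp_neg.integrableOn
  rw [integral_add hu.integrableOn h1, integral_comp_neg_Ioi, neg_zero, add_comm,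
    ← intervalIntegral.integral_Iic_add_Ioi hu.integrableOn hu.integrableOn]

namespace HolderDeriv

variable {f : ℝ → ℝ} {B K : ℝ}

lemma integrable_deriv_mul_conjKer (hf : HolderDeriv f B K) (x : ℝ) {y : ℝ} (hy : 0 < y) :
    Integrable fun s => deriv f (x + s) * conjKer y s :=
  (hf.memLp.comp_measurePreserving (measurePreserving_add_left volume x)).integrable_mul
    (memLp_conjKer hy)

/-- The kernel is at most s⁻² in absolute value for every y, so one majorant serves for the limit y
→ 0. -/
lemma abs_secondDiff_mul_le (hf : HolderDeriv f B K) (x y : ℝ) {s : ℝ} (hs : 0 < s) :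
    |secondDiff f x s * ((s ^ 2 - y ^ 2) / (s ^ 2 + y ^ 2) ^ 2)| ≤ majorant B K s := by
  refine le_trans ?_ (hf.abs_secondDiff_div_le x hs)
  rw [abs_mul, div_eq_mul_inv (secondDiff f x s), abs_mul]
  refine mul_le_mul_of_nonneg_left ?_ (abs_nonneg _)
  rw [abs_div, abs_of_pos (by positivity : 0 < (s ^ 2 + y ^ 2) ^ 2),
    abs_of_pos (by positivity : 0 < (s ^ 2)⁻¹), inv_eq_one_div,
    div_le_div_iff₀ (by positivity) (by positivity)]
  have : |s ^ 2 - y ^ 2| ≤ s ^ 2 + y ^ 2 := by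
    rw [abs_le]; constructor <;> nlinarith [sq_nonneg s, sq_nonneg y]
  nlinarith [sq_nonneg s, sq_nonneg y, mul_nonneg (sq_nonneg s) (sq_nonneg y), sq_nonneg (y ^ 2)]

/-- The conjugate kernel is odd, so folding yields the derivative of the second difference.
Integrate by parts: the boundary terms vanish because the kernel is 0 at the origin and decays at
infinity. -/
lemma integral_deriv_mul_conjKer (hf : HolderDeriv f B K) (x : ℝ) {y : ℝ} (hy : 0 < y) :
    ∫ s, deriv f (x + s) * conjKer y s =
      ∫ s in Ioi (0 : ℝ), secondDiff f x s * ((s ^ 2 - y ^ 2) / (s ^ 2 + y ^ 2) ^ 2) := by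
  have hi := hf.integrable_deriv_mul_conjKer x hy
  rw [integral_eq_integral_Ioi_add hi]
  set u : ℝ → ℝ := fun s => deriv f (x + s) * conjKer y s + deriv f (x + -s) * conjKer y (-s)
  set v : ℝ → ℝ := fun s => secondDiff f x s * ((s ^ 2 - y ^ 2) / (s ^ 2 + y ^ 2) ^ 2)
  have hu : IntegrableOn u (Ioi 0) := (hi.add hi.comp_neg).integrableOn
  have hvc : Continuous v := (hf.continuous_secondDiff x).mul
    (Continuous.div (by fun_prop) (by fun_prop) fun s => by positivity)
  have hv : IntegrableOn v (Ioi 0) := by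
    refine (integrable_majorant B K).integrableOn.mono' hvc.aestronglyMeasurable
      ((ae_restrict_mem measurableSet_Ioi).mono fun s hs => ?_)
    exact hf.abs_secondDiff_mul_le x y hs
  have hd : ∀ s : ℝ, HasDerivAt (fun s => secondDiff f x s * conjKer y s) (u s - v s) s := by
    intro s
    have h1 : HasDerivAt (conjKer y) ((1 * (s ^ 2 + y ^ 2) - s * (2 * s)) / (s ^ 2 + y ^ 2) ^ 2) s := by
      have h2 : HasDerivAt (fun s : ℝ => s ^ 2 + y ^ 2) (2 * s) s := by
        simpa using (hasDerivAt_pow 2 s).add_const (y ^ 2)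
      exact (hasDerivAt_id s).div h2 (by positivity)
    refine ((hf.hasDerivAt_secondDiff x s).mul h1).congr_deriv ?_
    simp only [u, v, conjKer, neg_sq, ← sub_eq_add_neg]
    field_simp
    ring
  have h := integral_Ioi_of_hasDerivAt_of_tendsto (a := (0 : ℝ))
    (f := fun s => secondDiff f x s * conjKer y s) (f' := fun s => u s - v s) (m := 0)
    (hd 0).continuousAt.continuousWithinAt (fun s _ => hd s) (hu.sub hv) ?_
  · rw [integral_sub hu hv] at h
    have h0 : secondDiff f x 0 * conjKer y 0 = 0 := by simp [conjKer]
    rw [h0, sub_zero, sub_eq_zero] at h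
    exact h
  · have hb : Tendsto (fun s : ℝ => 4 * B * ((y⁻¹ + 1) / (1 + |s|))) atTop (𝓝 (4 * B * 0)) :=
      (tendsto_const_nhds.div_atTop
        (tendsto_atTop_add_const_left _ _ tendsto_abs_atTop_atTop)).const_mul _
    rw [mul_zero] at hb
    refine squeeze_zero_norm (fun s => ?_) hb
    rw [norm_mul]
    exact mul_le_mul (hf.abs_secondDiff_le_bound x s) (abs_conjKer_le hy s) (abs_nonneg _)
      (by linarith [hf.nonneg_bound])

/-- The density of the stray field interaction for regular `f`. -/
lemma tendsto_integral_deriv_mul_conjPotential (hf : HolderDeriv f B K) {w : ℝ → ℝ}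
    (hw : Integrable w) :
    Tendsto (fun y => ∫ t, deriv f t * conjPotential w t y) (𝓝[>] 0)
      (𝓝 (∫ x, -dirichletToNeumann f x * w x)) := by
  set I : ℝ → ℝ → ℝ := fun y x =>
    ∫ s in Ioi (0 : ℝ), secondDiff f x s * ((s ^ 2 - y ^ 2) / (s ^ 2 + y ^ 2) ^ 2) with hI
  have hdc : AEStronglyMeasurable (deriv f) := hf.memLp.1
  -- Neither f' nor the kernel need be integrable; their product is dominated by the sum of their
  -- squares, each integrable against |w|.
  have hprod : ∀ y : ℝ, 0 < y → Integrable
      (fun p : ℝ × ℝ => w p.1 * (deriv f p.2 * conjKer y (p.2 - p.1))) (volume.prod volume) := by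
    intro y hy
    have hk2 := (memLp_conjKer hy).integrable_sq
    have hf2 := hf.memLp.integrable_sq
    have h1 : Integrable (fun p : ℝ × ℝ => |w p.1| * deriv f p.2 ^ 2) (volume.prod volume) :=
      hw.abs.mul_prod hf2
    have h2 : Integrable (fun p : ℝ × ℝ => |w p.1| * conjKer y (p.2 - p.1) ^ 2)
        (volume.prod volume) := by
      have h3 := (hw.abs.convolution_integrand (ContinuousLinearMap.mul ℝ ℝ) hk2
        (μ := volume) (ν := volume)).swap
      exact h3
    refine (h1.add h2).mono' ?_ (.of_forall fun p => ?_)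
    · refine hw.1.comp_fst.mul (hdc.comp_snd.mul ?_)
      exact ((continuous_conjKer hy).comp (by fun_prop)).aestronglyMeasurable
    · simp only [Pi.add_apply, Real.norm_eq_abs, abs_mul]
      rw [← mul_add]
      refine mul_le_mul_of_nonneg_left ?_ (abs_nonneg _)
      rw [← sq_abs (deriv f p.2), ← sq_abs (conjKer y _)]
      nlinarith [sq_nonneg (|deriv f p.2| - |conjKer y (p.2 - p.1)|), sq_nonneg |deriv f p.2|,
        sq_nonneg |conjKer y (p.2 - p.1)|]
  have hswap : ∀ y : ℝ, 0 < y → ∫ t, deriv f t * conjPotential w t y =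
      -(1 / π) * ∫ x, w x * I y x := by
    intro y hy
    have h1 := integral_integral_swap
      (f := fun x t => w x * (deriv f t * conjKer y (t - x))) (hprod y hy)
    have h2 : ∀ x, ∫ t, w x * (deriv f t * conjKer y (t - x)) = w x * I y x := by
      intro x
      rw [integral_const_mul, hI]
      simp only
      rw [← hf.integral_deriv_mul_conjKer x hy,
        ← integral_add_left_eq_self (fun t => deriv f t * conjKer y (t - x)) x]
      simp
    simp_rw [h2] at h1
    rw [h1, ← integral_const_mul]
    refine integral_congr_ae (.of_forall fun t => ?_)
    simp only
    rw [conjPotential_eq hw t hy]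
    have h3 : ∫ x, w x * (deriv f t * conjKer y (t - x)) =
        deriv f t * ∫ x, w x * conjKer y (t - x) := by
      rw [← integral_const_mul]
      refine integral_congr_ae (.of_forall fun x => ?_)
      simp only; ring
    rw [h3]; ring
  have hIb : ∀ y x, |I y x| ≤ ∫ s in Ioi (0 : ℝ), majorant B K s := fun y x => by
    rw [← Real.norm_eq_abs]
    exact norm_integral_le_of_norm_le (integrable_majorant B K).integrableOn
      ((ae_restrict_mem measurableSet_Ioi).mono fun s hs => hf.abs_secondDiff_mul_le x y hs)
  have hlim : ∀ x, Tendsto (fun y => I y x) (𝓝[>] 0)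
      (𝓝 (∫ s in Ioi (0 : ℝ), secondDiff f x s / s ^ 2)) := by
    intro x
    refine tendsto_integral_filter_of_dominated_convergence (majorant B K)
      (.of_forall fun y => ?_)
      (.of_forall fun y => (ae_restrict_mem measurableSet_Ioi).mono
        fun s hs => hf.abs_secondDiff_mul_le x y hs)
      (integrable_majorant B K).integrableOn
      ((ae_restrict_mem measurableSet_Ioi).mono fun s hs => ?_)
    · exact ((hf.continuous_secondDiff x).measurable.mul (by fun_prop)).aestronglyMeasurable
    · have hs0 : (s : ℝ) ≠ 0 := ne_of_gt hs
      have hc : ContinuousAt (fun y : ℝ => secondDiff f x s * ((s ^ 2 - y ^ 2) / (s ^ 2 + y ^ 2) ^ 2))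
          0 := by
        refine continuousAt_const.mul (ContinuousAt.div (by fun_prop) (by fun_prop) ?_)
        positivity
      have := hc.tendsto.mono_left (nhdsWithin_le_nhds (s := Ioi (0 : ℝ)))
      refine this.trans (le_of_eq ?_)
      congr 1
      field_simp
      ring
  have hIm : ∀ y : ℝ, 0 < y → AEStronglyMeasurable (fun x => w x * I y x) := by
    intro y hy
    refine ((hprod y hy).integral_prod_left.1).congr (.of_forall fun x => ?_)
    simp only
    rw [integral_const_mul, hI]
    simp only
    rw [← hf.integral_deriv_mul_conjKer x hy,
      ← integral_add_left_eq_self (fun t => deriv f t * conjKer y (t - x)) x]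
    simp
  have hmain : Tendsto (fun y => ∫ x, w x * I y x) (𝓝[>] 0)
      (𝓝 (∫ x, w x * ∫ s in Ioi (0 : ℝ), secondDiff f x s / s ^ 2)) := by
    refine tendsto_integral_filter_of_dominated_convergence
      (fun x => |w x| * ∫ s in Ioi (0 : ℝ), majorant B K s) ?_ ?_ (hw.abs.mul_const _)
      (.of_forall fun x => (hlim x).const_mul _)
    · filter_upwards [self_mem_nhdsWithin] with y hy using hIm y hy
    · refine .of_forall fun y => .of_forall fun x => ?_
      rw [norm_mul]
      exact mul_le_mul_of_nonneg_left (hIb y x) (norm_nonneg _)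
  have hfin := hmain.const_mul (-(1 / π))
  have e : -(1 / π) * ∫ x, w x * ∫ s in Ioi (0 : ℝ), secondDiff f x s / s ^ 2 =
      ∫ x, -dirichletToNeumann f x * w x := by
    rw [← integral_const_mul]
    refine integral_congr_ae (.of_forall fun x => ?_)
    simp only [dirichletToNeumann]
    ring
  rw [e] at hfin
  refine hfin.congr' ?_
  filter_upwards [self_mem_nhdsWithin] with y hy using (hswap y hy).symm

end HolderDeriv

lemma HolderDeriv.abs_dirichletToNeumann_le {f : ℝ → ℝ} {B K : ℝ} (hf : HolderDeriv f B K)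
    (x : ℝ) : |dirichletToNeumann f x| ≤ ∫ s in Ioi (0 : ℝ), majorant B K s := by
  have h : ‖∫ s in Ioi (0 : ℝ), secondDiff f x s / s ^ 2‖ ≤
      ∫ s in Ioi (0 : ℝ), majorant B K s :=
    norm_integral_le_of_norm_le (integrable_majorant B K).integrableOn
      ((ae_restrict_mem measurableSet_Ioi).mono fun s hs => hf.abs_secondDiff_div_le x hs)
  rw [dirichletToNeumann, abs_mul, abs_of_pos (by positivity : 0 < 1 / π)]
  exact (mul_le_of_le_one_left (abs_nonneg _) one_div_pi_le).trans h

/-! ### The Euler–Lagrange equation. -/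

lemma FiniteEnergyPhase.integrable_one_sub_cos {h : ℝ} (hh : 1 < h) {φ : ℝ → ℝ}
    {G : ℝ × ℝ → Plane} (hφ : FiniteEnergyPhase h φ G) : Integrable fun x => 1 - cos (φ x) := by
  have h1 : 0 < 2 * (h - 1) := by linarith
  refine (hφ.integrable_well.const_mul (2 * (h - 1))⁻¹).mono'
    (continuous_const.sub (Real.continuous_cos.comp hφ.ac.continuous)).aestronglyMeasurable
    (.of_forall fun x => ?_)
  rw [Real.norm_of_nonneg (by linarith [Real.cos_le_one (φ x)]), inv_mul_eq_div, le_div_iff₀ h1]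
  linarith [le_well h (φ x)]

lemma FiniteEnergyPhase.memLp_sin {h : ℝ} (hh : 1 < h) {φ : ℝ → ℝ} {G : ℝ × ℝ → Plane}
    (hφ : FiniteEnergyPhase h φ G) : MemLp (fun x => sin (φ x)) 2 := by
  have hm : AEStronglyMeasurable fun x => sin (φ x) :=
    (Real.continuous_sin.comp hφ.ac.continuous).aestronglyMeasurable
  rw [memLp_two_iff_integrable_sq hm]
  refine ((hφ.integrable_one_sub_cos hh).const_mul 2).mono' (hm.pow 2) (.of_forall fun x => ?_)
  rw [Real.norm_of_nonneg (sq_nonneg _)]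
  nlinarith [Real.sin_sq_add_cos_sq (φ x), Real.cos_le_one (φ x)]

/-- Minimisers are twice continuously differentiable and satisfy the Euler–Lagrange equation. -/
theorem euler_lagrange {h : ℝ} (hh : 1 < h) {φ : ℝ → ℝ} {G : ℝ × ℝ → Plane}
    (hφ : FiniteEnergyPhase h φ G) (hmin : IsLocalMinimiser h φ) :
    ContDiff ℝ 2 φ ∧ (∃ K, HolderDeriv (fun x => cos (φ x)) 1 K) ∧
      ∀ x, HasDerivAt (deriv φ)
        (sin (φ x) * (h - cos (φ x) + dirichletToNeumann (fun x => cos (φ x)) x)) x := by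
  obtain ⟨g, hg2, hg⟩ := exists_strayField_density hφ.strayField hφ.memLp_deriv_cos
  have hφc := hφ.ac.continuous
  set R : ℝ → ℝ := fun x => sin (φ x) * (h - cos (φ x) - g x) with hR
  -- The term with g is in L² because g is; the other one because sin φ is.
  have hR2 : MemLp R 2 := by
    refine (((hφ.memLp_sin hh).norm.const_mul (h + 1)).add hg2.norm).mono' ?_
      (.of_forall fun x => ?_)
    · exact (Real.continuous_sin.comp hφc).aestronglyMeasurable.mul
        ((continuous_const.sub (Real.continuous_cos.comp hφc)).aestronglyMeasurable.sub hg2.1)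
    · simp only [hR, Pi.add_apply, Real.norm_eq_abs, abs_mul]
      have h1 : |h - cos (φ x) - g x| ≤ (h + 1) + |g x| := by
        refine (abs_sub _ _).trans ?_
        gcongr
        rw [abs_le]
        constructor <;> linarith [Real.cos_le_one (φ x), Real.neg_one_le_cos (φ x)]
      calc _ ≤ |sin (φ x)| * ((h + 1) + |g x|) := by gcongr
        _ = (h + 1) * |sin (φ x)| + |sin (φ x)| * |g x| := by ring
        _ ≤ _ := by
          gcongr
          exact mul_le_of_le_one_left (abs_nonneg _) (Real.abs_sin_le_one _)
  have hRl : LocallyIntegrable R := hR2.locallyIntegrable (by norm_num)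
  obtain ⟨c, hc⟩ := hasDerivAt_of_weak_eq hφ.ac hφ.memLp hRl
    fun η hη hs => weak_euler_lagrange hh hφ hmin hg2 hg hη hs
  have hdφ : ∀ x, deriv φ x = c + ∫ t in (0 : ℝ)..x, R t := fun x => (hc x).deriv
  have hd : ∀ x, HasDerivAt φ (deriv φ x) x := fun x => by rw [hdφ]; exact hc x
  obtain ⟨M, hM⟩ := exists_bound_of_memLp hdφ hφ.memLp hR2
  have hM0 : 0 ≤ M := (abs_nonneg _).trans (hM 0)
  set A := √(∫ x, R x ^ 2) with hA
  have hA0 : 0 ≤ A := Real.sqrt_nonneg _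
  have hφh : ∀ a b, |deriv φ a - deriv φ b| ≤ A * √|a - b| := by
    intro a b
    have : deriv φ a - deriv φ b = ∫ t in b..a, R t := by
      rw [hdφ, hdφ, add_sub_add_left_eq_sub,
        intervalIntegral.integral_interval_sub_left (hRl.integrableOn_isCompact
          isCompact_uIcc).intervalIntegrable (hRl.integrableOn_isCompact
          isCompact_uIcc).intervalIntegrable]
    rw [this]
    exact abs_intervalIntegral_le_sqrt hR2 b a
  have hφl : ∀ a b, |φ a - φ b| ≤ M * |a - b| := fun a b =>
    Convex.norm_image_sub_le_of_norm_hasDerivWithin_le (𝕜 := ℝ) (s := univ)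
      (fun x _ => (hd x).hasDerivWithinAt) (fun x _ => hM x) convex_univ (mem_univ b) (mem_univ a)
  have hfd : ∀ x, HasDerivAt (fun x => cos (φ x)) (-sin (φ x) * deriv φ x) x := fun x =>
    (hd x).cos
  have hfe : ∀ x, deriv (fun x => cos (φ x)) x = -sin (φ x) * deriv φ x := fun x => (hfd x).deriv
  -- The constant collects M² + A from points at distance at most 1 and 2M from points further
  -- apart, where √|a - b| ≥ 1.
  have hH : HolderDeriv (fun x => cos (φ x)) 1 (M * M + A + 2 * M) := by
    refine ⟨fun x => by rw [hfe]; exact hfd x, hφ.memLp_deriv_cos,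
      fun x => Real.abs_cos_le_one _, fun a b => ?_⟩
    rw [hfe, hfe]
    have hs : ∀ x, |sin (φ x)| ≤ 1 := fun x => Real.abs_sin_le_one _
    rcases le_or_gt |a - b| 1 with hab | hab
    · have h1 : |a - b| ≤ √|a - b| := Real.le_sqrt_of_sq_le (by nlinarith [abs_nonneg (a - b)])
      have e : -sin (φ a) * deriv φ a - -sin (φ b) * deriv φ b =
          -((sin (φ a) - sin (φ b)) * deriv φ a) - sin (φ b) * (deriv φ a - deriv φ b) := by ring
      rw [e]
      calc _ ≤ |sin (φ a) - sin (φ b)| * |deriv φ a| +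
            |sin (φ b)| * |deriv φ a - deriv φ b| := by
            refine (abs_sub _ _).trans ?_
            rw [abs_neg, abs_mul, abs_mul]
        _ ≤ (M * √|a - b|) * M + 1 * (A * √|a - b|) := by
            gcongr
            · exact (Real.abs_sin_sub_sin_le _ _).trans ((hφl a b).trans (by gcongr))
            · exact hM a
            · exact hs b
            · exact hφh a b
        _ ≤ _ := by nlinarith [Real.sqrt_nonneg |a - b|]
    · have h1 : 1 ≤ √|a - b| := Real.one_le_sqrt.2 hab.le
      calc _ ≤ |sin (φ a)| * |deriv φ a| + |sin (φ b)| * |deriv φ b| := by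
            refine (abs_sub _ _).trans ?_
            rw [abs_mul, abs_mul, abs_neg, abs_neg]
        _ ≤ 1 * M + 1 * M := by
            gcongr
            · exact hs a
            · exact hM a
            · exact hs b
            · exact hM b
        _ ≤ _ := by nlinarith [mul_nonneg hM0 hM0]
  have hΛc := hH.continuous_dirichletToNeumann
  -- Both functions represent the same limit against all smooth w of compact support.
  have hgae : ∀ᵐ x, g x = -dirichletToNeumann (fun x => cos (φ x)) x := by
    refine ae_eq_of_integral_contDiff_smul_eq (hg2.locallyIntegrable (by norm_num))
      (hΛc.neg.locallyIntegrable) fun w hw hs => ?_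
    have hw' : CompactH1 w := .of_contDiff (hw.of_le (by exact_mod_cast le_top)) hs
    have := tendsto_nhds_unique (hg w hw')
      (hH.tendsto_integral_deriv_mul_conjPotential hw'.integrable)
    simpa only [smul_eq_mul, mul_comm] using this
  set Q : ℝ → ℝ := fun x =>
    sin (φ x) * (h - cos (φ x) + dirichletToNeumann (fun x => cos (φ x)) x) with hQ
  have hQc : Continuous Q := by
    have h1 := Real.continuous_sin.comp hφc
    have h2 := Real.continuous_cos.comp hφc
    exact h1.mul ((continuous_const.sub h2).add hΛc)
  have hdQ : ∀ x, HasDerivAt (deriv φ) (Q x) x := by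
    intro x
    have e : deriv φ = fun x => c + ∫ t in (0 : ℝ)..x, Q t := by
      ext x
      rw [hdφ]
      congr 1
      refine intervalIntegral.integral_congr_ae ?_
      filter_upwards [hgae] with t ht _
      simp only [hR, hQ, ht, sub_neg_eq_add]
    rw [e]
    exact (intervalIntegral.integral_hasDerivAt_right (hQc.intervalIntegrable _ _)
      hQc.stronglyMeasurable.stronglyMeasurableAtFilter hQc.continuousAt).const_add _
  refine ⟨?_, ⟨_, hH⟩, hdQ⟩
  rw [show (2 : WithTop ℕ∞) = 1 + 1 by norm_num, contDiff_succ_iff_deriv]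
  refine ⟨fun x => (hd x).differentiableAt, by simp, contDiff_one_iff_deriv.2
    ⟨fun x => (hdQ x).differentiableAt, ?_⟩⟩
  rwa [show deriv (deriv φ) = Q from funext fun x => (hdQ x).deriv]

/-! ### Uniqueness and decay for the differential equation. -/

/-- Backward uniqueness for `ψ'' = q sin ψ`. -/
lemma eq_zero_of_le_of_pendulum {ψ ψ' q : ℝ → ℝ} {Q x₀ : ℝ} (hψ : ∀ x, HasDerivAt ψ (ψ' x) x)
    (hψ' : ∀ x, HasDerivAt ψ' (sin (ψ x) * q x) x) (hq : ∀ x, |q x| ≤ Q)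
    (h0 : ψ x₀ = 0) (h1 : ψ' x₀ = 0) {x : ℝ} (hx : x ≤ x₀) : ψ x = 0 := by
  -- The logarithmic derivative of ψ² + ψ'² is at least -(1 + Q), so the weight makes E
  -- nondecreasing; it vanishes at x₀, hence to the left of it.
  set E : ℝ → ℝ := fun x => (ψ x ^ 2 + ψ' x ^ 2) * exp ((1 + Q) * x) with hE
  have hd : ∀ x, HasDerivAt E ((2 * ψ x * ψ' x + 2 * ψ' x * (sin (ψ x) * q x) +
      (1 + Q) * (ψ x ^ 2 + ψ' x ^ 2)) * exp ((1 + Q) * x)) x := by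
    intro x
    have e1 : HasDerivAt (fun x => exp ((1 + Q) * x)) (exp ((1 + Q) * x) * (1 + Q)) x := by
      have := ((hasDerivAt_id x).const_mul (1 + Q)).exp
      simpa using this
    have e2 := (((hψ x).pow 2).add ((hψ' x).pow 2)).mul e1
    refine e2.congr_deriv ?_
    simp only [Pi.add_apply, Pi.pow_apply]
    push_cast
    ring
  have hmono : Monotone E := by
    refine monotone_of_deriv_nonneg (fun x => (hd x).differentiableAt) fun x => ?_
    rw [(hd x).deriv]
    refine mul_nonneg ?_ (exp_pos _).le
    have e3 : |ψ' x * (sin (ψ x) * q x)| ≤ |ψ' x| * (|ψ x| * Q) := by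
      rw [abs_mul, abs_mul]
      exact mul_le_mul_of_nonneg_left (mul_le_mul Real.abs_sin_le_abs (hq x) (abs_nonneg _)
        (abs_nonneg _)) (abs_nonneg _)
    have hQ : 0 ≤ Q := (abs_nonneg _).trans (hq x)
    have e4 := (abs_le.1 e3).1
    have e5 : 2 * (|ψ' x| * |ψ x|) ≤ ψ x ^ 2 + ψ' x ^ 2 := by
      nlinarith [sq_nonneg (|ψ' x| - |ψ x|), sq_abs (ψ x), sq_abs (ψ' x)]
    nlinarith [sq_nonneg (ψ x + ψ' x), mul_le_mul_of_nonneg_left e5 hQ]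
  have h2 := hmono hx
  simp only [hE, h0, h1] at h2
  have h3 : ψ x ^ 2 + ψ' x ^ 2 ≤ 0 := by
    by_contra hc
    have := mul_pos (not_le.1 hc) (exp_pos ((1 + Q) * x))
    norm_num at h2
    linarith
  nlinarith [sq_nonneg (ψ x), sq_nonneg (ψ' x), pow_eq_zero_iff (two_ne_zero) (a := ψ x)]

/-- Exponential decay of positive solutions of `φ'' = q sin φ` with `q` eventually bounded below. -/
lemma exists_exp_decay {φ φ' q : ℝ → ℝ} {Q κ : ℝ} (hφ : ∀ x, HasDerivAt φ (φ' x) x)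
    (hφ' : ∀ x, HasDerivAt φ' (sin (φ x) * q x) x) (hq : ∀ x, |q x| ≤ Q) (hκ : 0 < κ)
    (hqκ : ∀ᶠ x in atTop, 2 * κ ≤ q x) (hpos : ∀ x, 0 < φ x) (hlim : Tendsto φ atTop (𝓝 0)) :
    ∃ a c, 0 < c ∧ ∀ x, a ≤ x → φ' x ≤ 0 ∧
      max |φ x| (max |φ' x| |sin (φ x) * q x|) ≤ exp (c * (a - x)) := by
  obtain ⟨a₀, ha₀⟩ := eventually_atTop.1 (hqκ.and (hlim.eventually_le_const one_pos))
  set c := √κ with hc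
  have hc0 : 0 < c := Real.sqrt_pos.2 hκ
  have hc2 : c * c = κ := Real.mul_self_sqrt hκ.le
  -- For 0 < φ ≤ 1 one has sin φ ≥ φ / 2, which with q ≥ 2κ gives φ'' ≥ κ φ.
  have hconv : ∀ x, a₀ ≤ x → κ * φ x ≤ sin (φ x) * q x := by
    intro x hx
    obtain ⟨h1, h2⟩ := ha₀ x hx
    have h3 : φ x / 2 ≤ sin (φ x) := by
      have h4 := Real.mul_le_sin (hpos x).le (by linarith [Real.pi_gt_three])
      refine le_trans ?_ h4
      rw [div_mul_eq_mul_div, div_le_div_iff₀ two_pos Real.pi_pos]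
      nlinarith [Real.pi_le_four, hpos x]
    nlinarith [hpos x]
  have hmono : MonotoneOn φ' (Ici a₀) := by
    refine monotoneOn_of_deriv_nonneg (convex_Ici a₀)
      (fun x _ => (hφ' x).continuousAt.continuousWithinAt)
      (fun x _ => (hφ' x).differentiableAt.differentiableWithinAt) fun x hx => ?_
    rw [interior_Ici] at hx
    rw [(hφ' x).deriv]
    exact (mul_nonneg hκ.le (hpos x).le).trans (hconv x (le_of_lt hx))
  have hmvt : ∀ x y, a₀ ≤ x → x < y → φ' x * (y - x) ≤ φ y - φ x ∧ φ y - φ x ≤ φ' y * (y - x) := by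
    intro x y hx hxy
    obtain ⟨z, hz, hzd⟩ := exists_hasDerivAt_eq_slope φ φ' hxy
      (fun z _ => (hφ z).continuousAt.continuousWithinAt) fun z _ => hφ z
    have hyx : 0 < y - x := by linarith
    have e : φ y - φ x = φ' z * (y - x) := by rw [hzd]; field_simp
    rw [e]
    constructor
    · exact mul_le_mul_of_nonneg_right (hmono hx (hx.trans hz.1.le) hz.1.le) hyx.le
    · exact mul_le_mul_of_nonneg_right
        (hmono (hx.trans hz.1.le) (hx.trans hxy.le) hz.2.le) hyx.le
  -- By convexity a positive slope would persist and lift φ by 2 over the length 2 / φ' x, although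
  -- φ ≤ 1.
  have hneg : ∀ x, a₀ ≤ x → φ' x ≤ 0 := by
    intro x hx
    by_contra hcon
    rw [not_le] at hcon
    have h1 := (hmvt x (x + 2 / φ' x) hx (by linarith [div_pos two_pos hcon])).1
    have h2 := (ha₀ (x + 2 / φ' x) (by linarith [div_pos two_pos hcon])).2
    rw [add_sub_cancel_left, mul_div_cancel₀ _ hcon.ne'] at h1
    linarith [hpos x]
  have hexp : ∀ (b : ℝ) x, HasDerivAt (fun x => exp (b * x)) (exp (b * x) * b) x := fun b x => by
    simpa using ((hasDerivAt_id x).const_mul b).exp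
  -- Factor φ'' - c² φ as (d/dx - c)(φ' + c φ): the product u is nondecreasing, and it is at most c
  -- exp(-c x), which tends to 0.
  have hfirst : ∀ x, a₀ ≤ x → φ' x + c * φ x ≤ 0 := by
    set u : ℝ → ℝ := fun x => (φ' x + c * φ x) * exp (-c * x) with hu
    have hud : ∀ x, HasDerivAt u ((sin (φ x) * q x - κ * φ x) * exp (-c * x)) x := fun x => by
      refine (((hφ' x).add ((hφ x).const_mul c)).mul (hexp (-c) x)).congr_deriv ?_
      rw [← hc2]
      simp only [Pi.add_apply]
      ring
    have humono : MonotoneOn u (Ici a₀) := by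
      refine monotoneOn_of_deriv_nonneg (convex_Ici a₀)
        (fun x _ => (hud x).continuousAt.continuousWithinAt)
        (fun x _ => (hud x).differentiableAt.differentiableWithinAt) fun x hx => ?_
      rw [interior_Ici] at hx
      rw [(hud x).deriv]
      exact mul_nonneg (sub_nonneg.2 (hconv x (le_of_lt hx))) (exp_pos _).le
    have hulim : Tendsto (fun x => c * exp (-c * x)) atTop (𝓝 0) := by
      have : Tendsto (fun x => -c * x) atTop atBot :=
        tendsto_id.const_mul_atTop_of_neg (by linarith)
      simpa using (tendsto_exp_atBot.comp this).const_mul c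
    intro x hx
    have h1 : u x ≤ 0 := by
      refine ge_of_tendsto hulim ?_
      filter_upwards [eventually_ge_atTop x] with y hy
      refine (humono hx (hx.trans hy) hy).trans ?_
      have h2 := hneg y (hx.trans hy)
      have h3 := (ha₀ y (hx.trans hy)).2
      refine mul_le_mul_of_nonneg_right ?_ (exp_pos _).le
      nlinarith
    by_contra hcon
    exact absurd h1 (not_le.2 (mul_pos (not_le.1 hcon) (exp_pos _)))
  have hdecay : ∀ x, a₀ ≤ x → φ x ≤ exp (c * (a₀ - x)) := by
    set u : ℝ → ℝ := fun x => φ x * exp (c * x) with hu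
    have hud : ∀ x, HasDerivAt u ((φ' x + c * φ x) * exp (c * x)) x := fun x =>
      ((hφ x).mul (hexp c x)).congr_deriv (by ring)
    have huanti : AntitoneOn u (Ici a₀) := by
      refine antitoneOn_of_deriv_nonpos (convex_Ici a₀)
        (fun x _ => (hud x).continuousAt.continuousWithinAt)
        (fun x _ => (hud x).differentiableAt.differentiableWithinAt) fun x hx => ?_
      rw [interior_Ici] at hx
      rw [(hud x).deriv]
      exact mul_nonpos_of_nonpos_of_nonneg (hfirst x (le_of_lt hx)) (exp_pos _).le
    intro x hx
    have h1 := huanti (mem_Ici.2 le_rfl) hx hx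
    have h2 := (ha₀ a₀ le_rfl).2
    simp only [hu] at h1
    rw [mul_sub, exp_sub, le_div_iff₀ (exp_pos _)]
    nlinarith [exp_pos (c * a₀)]
  have hQ0 : 0 ≤ Q := (abs_nonneg _).trans (hq 0)
  have hl0 : 0 ≤ log (1 + Q) := Real.log_nonneg (by linarith)
  have hl : 0 ≤ log (1 + Q) / c := div_nonneg hl0 hc0.le
  -- The shift by 1 serves the bound |φ'(x)| ≤ φ(x - 1) from convexity; the logarithm absorbs the
  -- factor 1 + Q needed for φ''.
  refine ⟨a₀ + 1 + log (1 + Q) / c, c, hc0, fun x hx => ⟨hneg x (by linarith), ?_⟩⟩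
  have e : exp (c * (a₀ + 1 + log (1 + Q) / c - x)) = (1 + Q) * exp (c * (a₀ + 1 - x)) := by
    rw [show c * (a₀ + 1 + log (1 + Q) / c - x) = log (1 + Q) + c * (a₀ + 1 - x) by
      field_simp; ring, exp_add, exp_log (by linarith)]
  rw [e]
  have b1 : φ x ≤ exp (c * (a₀ + 1 - x)) :=
    (hdecay x (by linarith)).trans (exp_le_exp.2 (by nlinarith))
  have b2 : |φ' x| ≤ exp (c * (a₀ + 1 - x)) := by
    have h1 := (hmvt (x - 1) x (by linarith) (by linarith)).2
    have h2 := hdecay (x - 1) (by linarith)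
    rw [abs_of_nonpos (hneg x (by linarith)), show a₀ + 1 - x = a₀ - (x - 1) by ring]
    linarith [hpos x]
  have b3 : |sin (φ x) * q x| ≤ Q * exp (c * (a₀ + 1 - x)) := by
    rw [abs_mul, mul_comm]
    gcongr
    · exact hq x
    · exact Real.abs_sin_le_abs.trans (by rwa [abs_of_pos (hpos x)])
  have hE := exp_pos (c * (a₀ + 1 - x))
  refine max_le ?_ (max_le ?_ ?_)
  · rw [abs_of_pos (hpos x)]; nlinarith
  · nlinarith
  · nlinarith

/-! ### Quadratic decay under the Dirichlet-to-Neumann operator. -/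

/-- If `f` is integrable and decays exponentially in `C²` at `+∞`, then its image under the
Dirichlet-to-Neumann operator decays quadratically. -/
lemma exists_dirichletToNeumann_decay {f f'' : ℝ → ℝ} {B K a c : ℝ} (hc : 0 < c)
    (hf : HolderDeriv f B K) (hi : Integrable f) (hf'' : ∀ x, HasDerivAt (deriv f) (f'' x) x)
    (h0 : ∀ x, a ≤ x → |f x| ≤ exp (c * (a - x)))
    (h2 : ∀ x, a ≤ x → |f'' x| ≤ 2 * exp (c * (a - x))) :
    ∃ C, 0 < C ∧ ∀ x, a < x → |dirichletToNeumann f x| ≤ C / (x - a) ^ 2 := by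
  set L := ∫ x, |f x| with hL
  have hL0 : 0 ≤ L := integral_nonneg fun _ => abs_nonneg _
  refine ⟨4 * (4 * (6 / c ^ 3) + 2 * L + 2 * (1 / c)), by positivity, fun x hx => ?_⟩
  -- For s ≤ r the points x ± s stay to the right of a + r, where f'' is at most 2 exp(-c r).
  set r := (x - a) / 2 with hr
  have hr0 : 0 < r := by rw [hr]; linarith
  have hxr : x - a = 2 * r := by rw [hr]; ring
  -- A cubic bound on the exponential suffices: integrating the near part over length r costs one
  -- power.
  have e1 : exp (-(c * r)) ≤ 6 / c ^ 3 / r ^ 3 := by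
    have := Real.pow_div_factorial_le_exp (c * r) (by positivity) 3
    rw [exp_neg, inv_le_comm₀ (exp_pos _) (by positivity)]
    refine le_trans (le_of_eq ?_) this
    norm_num [Nat.factorial]
    field_simp
  have e2 : |f x| ≤ 1 / c / r := by
    refine (h0 x hx.le).trans ?_
    rw [show c * (a - x) = -(2 * (c * r)) by rw [← neg_sub, hxr]; ring, exp_neg,
      inv_le_comm₀ (exp_pos _) (by positivity)]
    have := Real.add_one_le_exp (2 * (c * r))
    have h3 : 0 < c * r := by positivity
    refine le_trans (le_of_eq ?_) (show c * r ≤ _ by linarith)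
    field_simp
  have near : ∀ s ∈ Ioc 0 r, |secondDiff f x s / s ^ 2| ≤ 4 * (6 / c ^ 3 / r ^ 3) := by
    intro s hs
    have hd1 : ∀ t ∈ Icc 0 s, |deriv f (x + t) - deriv f (x - t)| ≤ 4 * exp (-(c * r)) * s := by
      intro t ht
      have h3 := Convex.norm_image_sub_le_of_norm_hasDerivWithin_le (𝕜 := ℝ) (f := deriv f)
        (s := Ici (a + r)) (C := 2 * exp (-(c * r)))
        (fun z _ => (hf'' z).hasDerivWithinAt) (fun z hz => by
          simp only [mem_Ici] at hz
          refine (h2 z (by linarith)).trans ?_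
          gcongr
          nlinarith) (convex_Ici _) (x := x - t) (y := x + t)
        (by simp only [mem_Ici]; linarith [ht.2, hs.2])
        (by simp only [mem_Ici]; linarith [ht.1])
      rw [show x + t - (x - t) = 2 * t by ring, Real.norm_eq_abs, Real.norm_eq_abs,
        abs_of_nonneg (by linarith [ht.1] : 0 ≤ 2 * t)] at h3
      refine h3.trans ?_
      nlinarith [ht.2, exp_pos (-(c * r))]
    have h4 := Convex.norm_image_sub_le_of_norm_hasDerivWithin_le (𝕜 := ℝ) (s := Icc 0 s)
      (f := secondDiff f x) (fun t _ => (hf.hasDerivAt_secondDiff x t).hasDerivWithinAt) hd1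
      (convex_Icc _ _) (left_mem_Icc.2 hs.1.le) (right_mem_Icc.2 hs.1.le)
    have h5 : secondDiff f x 0 = 0 := by simp [secondDiff]; ring
    rw [h5, sub_zero, sub_zero, Real.norm_eq_abs, Real.norm_eq_abs, abs_of_pos hs.1] at h4
    have hs2 : 0 < s ^ 2 := pow_pos hs.1 2
    rw [abs_div, abs_of_pos hs2, div_le_iff₀ hs2]
    nlinarith
  have hmaj : Integrable fun s => (|f (x + s)| + |f (x - s)|) * (r ^ 2)⁻¹ :=
    ((hi.abs.comp_add_left x).add (hi.abs.comp_sub_left x)).mul_const _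
  have htail : IntegrableOn (fun s : ℝ => 2 * |f x| * s ^ (-2 : ℝ)) (Ioi r) :=
    (integrableOn_Ioi_rpow_of_lt (by norm_num) hr0).const_mul _
  -- On the translates s⁻² ≤ r⁻², and the integrability of f does the rest. The central value keeps
  -- s⁻², which integrates to 1 / r, and itself contributes another 1 / r.
  have far : ∀ s ∈ Ioi r, |secondDiff f x s / s ^ 2| ≤
      (|f (x + s)| + |f (x - s)|) * (r ^ 2)⁻¹ + 2 * |f x| * s ^ (-2 : ℝ) := by
    intro s hs
    simp only [mem_Ioi] at hs
    have hs0 : 0 < s := hr0.trans hs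
    rw [abs_div, abs_of_pos (by positivity : 0 < s ^ 2), div_eq_mul_inv,
      Real.rpow_neg hs0.le, Real.rpow_two]
    have h3 : |secondDiff f x s| ≤ (|f (x + s)| + |f (x - s)|) + 2 * |f x| := by
      refine (abs_sub _ _).trans ?_
      rw [abs_mul, abs_two]
      gcongr
      exact abs_add_le _ _
    calc _ ≤ ((|f (x + s)| + |f (x - s)|) + 2 * |f x|) * (s ^ 2)⁻¹ := by gcongr
      _ ≤ _ := by
        rw [add_mul]
        gcongr
  have hI := hf.integrableOn_secondDiff_div x
  have I1 : |∫ s in Ioc 0 r, secondDiff f x s / s ^ 2| ≤ 4 * (6 / c ^ 3 / r ^ 3) * r := by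
    have := norm_setIntegral_le_of_norm_le_const (μ := volume) (s := Ioc 0 r)
      (f := fun s => secondDiff f x s / s ^ 2) (by simp) near
    simpa [Measure.real, hr0.le] using this
  have I2 : |∫ s in Ioi r, secondDiff f x s / s ^ 2| ≤
      (L + L) * (r ^ 2)⁻¹ + 2 * |f x| * (1 / r) := by
    have h3 : ‖∫ s in Ioi r, secondDiff f x s / s ^ 2‖ ≤ ∫ s in Ioi r,
        ((|f (x + s)| + |f (x - s)|) * (r ^ 2)⁻¹ + 2 * |f x| * s ^ (-2 : ℝ)) :=
      norm_integral_le_of_norm_le (hmaj.integrableOn.add htail)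
        ((ae_restrict_mem measurableSet_Ioi).mono far)
    refine h3.trans ?_
    rw [integral_add hmaj.integrableOn htail]
    refine add_le_add ?_ (le_of_eq ?_)
    · refine (setIntegral_le_integral hmaj (.of_forall fun s => by positivity)).trans
        (le_of_eq ?_)
      rw [integral_mul_const, integral_add (hi.abs.comp_add_left x) (hi.abs.comp_sub_left x),
        integral_add_left_eq_self (fun s => |f s|), integral_sub_left_eq_self (fun s => |f s|)]
    · rw [integral_const_mul, integral_Ioi_rpow_of_lt (by norm_num) hr0]
      norm_num
      left
      rw [Real.rpow_neg_one]
  have hsplit : ∫ s in Ioi (0 : ℝ), secondDiff f x s / s ^ 2 =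
      (∫ s in Ioc 0 r, secondDiff f x s / s ^ 2) + ∫ s in Ioi r, secondDiff f x s / s ^ 2 := by
    rw [← Ioc_union_Ioi_eq_Ioi hr0.le, setIntegral_union (Ioc_disjoint_Ioi le_rfl)
      measurableSet_Ioi (hI.mono_set Ioc_subset_Ioi_self) (hI.mono_set (Ioi_subset_Ioi hr0.le))]
  rw [dirichletToNeumann, abs_mul, abs_of_pos (by positivity : 0 < 1 / π), hsplit]
  refine (mul_le_of_le_one_left (abs_nonneg _) one_div_pi_le).trans ((abs_add_le _ _).trans
    ((add_le_add I1 I2).trans ?_))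
  have h6 : 2 * |f x| * (1 / r) ≤ 2 * (1 / c / r) * (1 / r) := by gcongr
  refine (add_le_add_right (add_le_add_right h6 _) _).trans (le_of_eq ?_)
  rw [hxr]
  field_simp
  ring

/-! ### Liftings, degree and positivity of the phase. -/

/-- The difference of the liftings divided by 2π is continuous with integer values, hence constant.
-/
lemma exists_eq_add_of_ofPhase_eq {φ χ : ℝ → ℝ} (hφ : Continuous φ) (hχ : Continuous χ)
    (he : ofPhase φ = ofPhase χ) : ∃ k, ∀ x, φ x = χ x + k := by
  have h1 : ∀ x, ∃ n : ℤ, (n : ℝ) = (φ x - χ x) / (2 * π) := by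
    intro x
    have hc : cos (φ x) = cos (χ x) := by
      simpa only [comp_ofPhase_zero] using congrFun (congrArg (fun m => comp m 0) he) x
    have hs : sin (φ x) = sin (χ x) := by
      simpa only [comp_ofPhase_one] using congrFun (congrArg (fun m => comp m 1) he) x
    have : cos (φ x - χ x) = 1 := by
      rw [Real.cos_sub, hc, hs]
      nlinarith [Real.sin_sq_add_cos_sq (χ x)]
    obtain ⟨n, hn⟩ := (Real.cos_eq_one_iff _).1 this
    refine ⟨n, ?_⟩
    rw [← hn]
    field_simp
  choose n hn using h1
  have hc : Continuous n := by
    rw [Int.isClosedEmbedding_coe_real.isInducing.continuous_iff]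
    have : ((↑) : ℤ → ℝ) ∘ n = fun x => (φ x - χ x) / (2 * π) := funext hn
    rw [this]
    exact (hφ.sub hχ).div_const _
  refine ⟨φ 0 - χ 0, fun x => ?_⟩
  have h2 : n x = n 0 := PreconnectedSpace.constant inferInstance hc
  have h3 := hn x
  rw [h2, hn 0] at h3
  rw [div_left_inj' (by positivity : 2 * π ≠ 0)] at h3
  linarith

lemma HasDegree.tendsto_atBot {φ : ℝ → ℝ} {D : ℝ} (hφ : Continuous φ)
    (hD : HasDegree (ofPhase φ) D) (hlim : Tendsto φ atTop (𝓝 0)) :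
    Tendsto φ atBot (𝓝 (-(2 * π * D))) := by
  obtain ⟨χ, hχ, he, p, q, hp, hq, hpq⟩ := hD
  obtain ⟨k, hk⟩ := exists_eq_add_of_ofPhase_eq hφ hχ he
  have e : φ = fun x => χ x + k := funext hk
  have h1 : p + k = 0 := tendsto_nhds_unique (hp.add_const k) (e ▸ hlim)
  have h2 : -(2 * π * D) = q + k := by
    rw [hpq]
    field_simp
    linarith
  rw [h2, e]
  exact hq.add_const k

lemma abs_deriv_abs_le {φ : ℝ → ℝ} (hφ : Continuous φ) (x : ℝ) :
    |deriv (fun x => |φ x|) x| ≤ |deriv φ x| := by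
  rcases lt_trichotomy (φ x) 0 with h | h | h
  · have : (fun x => |φ x|) =ᶠ[𝓝 x] fun x => -φ x :=
      (hφ.continuousAt.eventually_lt_const h).mono fun y hy => abs_of_neg hy
    rw [this.deriv_eq, deriv.fun_neg, abs_neg]
  -- At a zero |φ| has a minimum. If it is not differentiable there, its `deriv` is 0 by convention.
  · have : IsLocalMin (fun x => |φ x|) x := .of_forall fun y => by
      simp only [h, abs_zero]
      exact abs_nonneg _
    rw [this.deriv_eq_zero, abs_zero]
    exact abs_nonneg _
  · have : (fun x => |φ x|) =ᶠ[𝓝 x] φ :=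
      (hφ.continuousAt.eventually_const_lt h).mono fun y hy => abs_of_pos hy
    rw [this.deriv_eq]

lemma well_abs (h p : ℝ) : well h |p| = well h p := by
  simp only [well, Real.cos_abs]

lemma FiniteEnergyPhase.abs {h : ℝ} {φ : ℝ → ℝ} {G : ℝ × ℝ → Plane}
    (hφ : FiniteEnergyPhase h φ G) : FiniteEnergyPhase h (fun x => |φ x|) G where
  ac := hφ.ac.lipschitz_comp (K := 1) (LipschitzWith.of_dist_le_mul fun x y => by
    simpa [Real.dist_eq] using abs_abs_sub_abs_le_abs_sub x y)
  memLp := hφ.memLp.mono (aestronglyMeasurable_deriv _ _)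
    (.of_forall fun x => abs_deriv_abs_le hφ.ac.continuous x)
  integrable_well := by simpa only [well_abs] using hφ.integrable_well
  strayField := by simpa only [Real.cos_abs] using hφ.strayField

lemma energy_ofPhase_abs_le {h : ℝ} (hh : 1 < h) {φ : ℝ → ℝ} {G : ℝ × ℝ → Plane}
    (hφ : FiniteEnergyPhase h φ G) :
    energy h (ofPhase fun x => |φ x|) ≤ energy h (ofPhase φ) := by
  rw [energy_ofPhase hh hφ.ac, energy_ofPhase hh hφ.abs.ac]
  simp only [Real.cos_abs, well_abs]
  gcongr 2⁻¹ * (∫⁻ x, ENNReal.ofReal (?_ + _)) + _ with x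
  exact sq_le_sq.2 (abs_deriv_abs_le hφ.ac.continuous x)

/-- As D ≤ 0, both limits of φ are nonnegative and unaffected by the absolute value, so a compact
perturbation of |φ| competes with φ itself in the same class. -/
lemma isLocalMinimiser_abs {h D : ℝ} (hh : 1 < h) {φ : ℝ → ℝ} {G : ℝ × ℝ → Plane}
    (hφ : FiniteEnergyPhase h φ G) (hD : D ≤ 0)
    (hmin : IsMinOn (energy h) (admissible h D) (ofPhase φ))
    (htop : Tendsto φ atTop (𝓝 0)) (hbot : Tendsto φ atBot (𝓝 (-(2 * π * D)))) :
    IsLocalMinimiser h fun x => |φ x| := by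
  intro χ U hχ hs
  have hz : Tendsto (fun x => χ x - |φ x|) (cocompact ℝ) (𝓝 0) :=
    hs.is_zero_at_infty
  rw [cocompact_eq_atBot_atTop, tendsto_sup] at hz
  have h1 := hz.2.add htop.abs
  have h2 := hz.1.add hbot.abs
  simp only [sub_add_cancel] at h1 h2
  refine (energy_ofPhase_abs_le hh hφ).trans (hmin (hχ.mem_admissible hh h1 h2 ?_))
  rw [abs_of_nonneg (a := -(2 * π * D)) (by nlinarith [Real.pi_pos]), abs_zero]
  field_simp
  ring

/-- The phase of a minimiser with negative degree is positive. -/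
lemma phase_pos {h D : ℝ} (hh : 1 < h) {φ : ℝ → ℝ} {G : ℝ × ℝ → Plane}
    (hφ : FiniteEnergyPhase h φ G) (hD : D < 0)
    (hmin : IsMinOn (energy h) (admissible h D) (ofPhase φ))
    (htop : Tendsto φ atTop (𝓝 0)) (hbot : Tendsto φ atBot (𝓝 (-(2 * π * D)))) (x : ℝ) :
    0 < φ x := by
  obtain ⟨hC, ⟨K, hK⟩, hE⟩ := euler_lagrange hh hφ.abs
    (isLocalMinimiser_abs hh hφ hD.le hmin htop hbot)
  have hlpos : 0 < -(2 * π * D) := by nlinarith [Real.pi_pos]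
  have hne : ∀ x, φ x ≠ 0 := by
    intro x₀ h0
    have hm : IsLocalMin (fun x => |φ x|) x₀ := .of_forall fun y => by
      simp only [h0, abs_zero]
      exact abs_nonneg _
    -- At x₀ the C² function |φ| and its derivative both vanish, and its equation has a bounded
    -- coefficient.
    have hzero := fun x (hx : x ≤ x₀) => eq_zero_of_le_of_pendulum
      (fun x => (hC.differentiable (by norm_num) x).hasDerivAt) hE
      (fun x => (abs_add_le _ _).trans (add_le_add ((abs_sub _ _).trans (add_le_add le_rfl
        (Real.abs_cos_le_one _))) (hK.abs_dirichletToNeumann_le x))) (by simp [h0])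
      hm.deriv_eq_zero hx
    have h1 : Tendsto (fun x => |φ x|) atBot (𝓝 0) :=
      tendsto_const_nhds.congr' ((eventually_le_atBot x₀).mono fun x hx => (hzero x hx).symm)
    have h2 := tendsto_nhds_unique h1 hbot.abs
    exact hlpos.ne (by simpa using h2)
  obtain ⟨y, hy⟩ := (hbot.eventually_const_lt hlpos).exists
  by_contra hx
  obtain ⟨z, hz⟩ := mem_range_of_exists_le_of_exists_ge hφ.ac.continuous ⟨x, not_lt.1 hx⟩ ⟨y, hy.le⟩
  exact hne z hz

lemma HolderDeriv.sub_const {f : ℝ → ℝ} {B K : ℝ} (hf : HolderDeriv f B K) (b : ℝ) :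
    HolderDeriv (fun x => f x - b) (B + |b|) K where
  hasDerivAt x := by simpa only [deriv_sub_const_fun] using (hf.hasDerivAt x).sub_const b
  memLp := by simpa only [deriv_sub_const_fun] using hf.memLp
  bound x := (abs_sub _ _).trans (add_le_add (hf.bound x) le_rfl)
  holder := by simpa only [deriv_sub_const_fun] using hf.holder

end NeelWall

end

/-! ### Proof of the theorem. -/

open NeelWall in
theorem theorem4p3 (h : ℝ) (hh : 1 < h) (d : ℕ) (hd : 1 ≤ d) (β : ℝ) (hβ₀ : 0 ≤ β) (hβ : β < 2)
    (φ : ℝ → ℝ) (hφ : Continuous φ)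
    (hmem : NeelWall.ofPhase φ ∈ NeelWall.admissible h (-(d : ℝ)))
    (hmin : IsMinOn (NeelWall.energy h) (NeelWall.admissible h (-(d : ℝ))) (NeelWall.ofPhase φ))
    (hlim : Tendsto φ atTop (𝓝 0)) :
    ContDiff ℝ 2 φ ∧
    ∃ a c C : ℝ, 0 < c ∧ 0 < C ∧
      (∀ x : ℝ, a ≤ x → deriv φ x ≤ 0 ∧
        max |φ x| (max |deriv φ x| |deriv (deriv φ) x|) ≤ exp (c * (a - x))) ∧
      (∀ x : ℝ, a < x → ∃ L : ℝ,
        NeelWall.HasDirichletToNeumann (fun t => NeelWall.comp (NeelWall.ofPhase φ) 0 t - 1) x L ∧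
        |L| ≤ C / (x - a) ^ β) := by
  obtain ⟨hm, he, hdeg⟩ := hmem
  obtain ⟨G, hG⟩ := exists_finiteEnergyPhase hh hφ hm he
  have hd0 : (-(d : ℝ)) < 0 := by
    have : (1 : ℝ) ≤ d := by exact_mod_cast hd
    linarith
  have hbot := hdeg.tendsto_atBot hφ hlim
  have hpos := phase_pos hh hG hd0 hmin hlim hbot
  have hlm := isLocalMinimiser_abs hh hG hd0.le hmin hlim hbot
  -- By positivity the statement about |φ| is one about φ.
  rw [show (fun x => |φ x|) = φ from funext fun x => abs_of_pos (hpos x)] at hlm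
  obtain ⟨hC, ⟨K, hK⟩, hE⟩ := euler_lagrange hh hG hlm
  refine ⟨hC, ?_⟩
  have hφd : ∀ x, HasDerivAt φ (deriv φ x) x := fun x =>
    (hC.differentiable (by norm_num) x).hasDerivAt
  have hcos : Tendsto (fun x => Real.cos (φ x)) atTop (𝓝 1) := by
    simpa [Function.comp_def] using (Real.continuous_cos.tendsto 0).comp hlim
  have hq : Tendsto (fun x => h - Real.cos (φ x) +
      dirichletToNeumann (fun x => Real.cos (φ x)) x) atTop (𝓝 (h - 1 + 0)) :=
    (hcos.const_sub h).add (hK.tendsto_dirichletToNeumann hcos)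
  -- With this κ one has 2κ = (h - 1)/2, strictly below the limit h - 1 of the coefficient.
  obtain ⟨a, c, hc, hdec⟩ := exists_exp_decay (κ := (h - 1) / 4) hφd hE
    (fun x => (abs_add_le _ _).trans (add_le_add ((abs_sub _ _).trans (add_le_add le_rfl
        (Real.abs_cos_le_one _))) (hK.abs_dirichletToNeumann_le x))) (by linarith)
    (hq.eventually_const_le (by linarith)) hpos hlim
  set φ'' : ℝ → ℝ := fun x => Real.sin (φ x) * (h - Real.cos (φ x) +
    dirichletToNeumann (fun x => Real.cos (φ x)) x) with hφ''
  have hf := hK.sub_const 1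
  have hfd : ∀ x, HasDerivAt (fun x => Real.cos (φ x) - 1) (-Real.sin (φ x) * deriv φ x) x :=
    fun x => (hφd x).cos.sub_const 1
  have hfdd : ∀ x, HasDerivAt (deriv fun x => Real.cos (φ x) - 1)
      (-(Real.cos (φ x) * deriv φ x) * deriv φ x + -Real.sin (φ x) * φ'' x) x := by
    intro x
    rw [show deriv (fun x => Real.cos (φ x) - 1) = fun x => -Real.sin (φ x) * deriv φ x from
      funext fun x => (hfd x).deriv]
    exact (hφd x).sin.neg.mul (hE x)
  have hb : ∀ x, a ≤ x → |φ x| ≤ exp (c * (a - x)) ∧ |deriv φ x| ≤ exp (c * (a - x)) ∧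
      |φ'' x| ≤ exp (c * (a - x)) ∧ exp (c * (a - x)) ≤ 1 := by
    intro x hx
    obtain ⟨h1, h2⟩ := max_le_iff.1 (hdec x hx).2
    obtain ⟨h2, h3⟩ := max_le_iff.1 h2
    exact ⟨h1, h2, h3, exp_le_one_iff.2 (by nlinarith)⟩
  have hi : Integrable fun x => Real.cos (φ x) - 1 := by
    simpa [Pi.neg_def] using (hG.integrable_one_sub_cos hh).neg
  obtain ⟨C, hC0, hCd⟩ := exists_dirichletToNeumann_decay (a := a) hc hf hi hfdd
    (fun x hx => by
      refine le_trans ?_ (hb x hx).1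
      simpa using Real.abs_cos_sub_cos_le (φ x) 0)
    fun x hx => by
      obtain ⟨-, h2, h3, h4⟩ := hb x hx
      refine (abs_add_le _ _).trans ?_
      rw [abs_mul, abs_mul, abs_neg, abs_neg, abs_mul, two_mul]
      refine add_le_add ?_ ?_
      · calc _ ≤ 1 * exp (c * (a - x)) * 1 := by
              gcongr
              · exact Real.abs_cos_le_one _
              · exact h2.trans h4
          _ = _ := by ring
      · calc _ ≤ 1 * exp (c * (a - x)) := by
              gcongr
              exact Real.abs_sin_le_one _
          _ = _ := one_mul _
  set M := ∫ s in Ioi (0 : ℝ), majorant (1 + |1|) K s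
  have hM : ∀ x, |dirichletToNeumann (fun x => Real.cos (φ x) - 1) x| ≤ M :=
    hf.abs_dirichletToNeumann_le
  have hM0 : 0 ≤ M := (abs_nonneg _).trans (hM 0)
  -- The global bound M serves for x - a ≤ 1, where (x - a)^β ≤ 1. Beyond that the quadratic decay
  -- with constant C is stronger than needed, as β < 2.
  refine ⟨a, c, M + C, hc, by positivity, fun x hx => ?_, fun x hx =>
    ⟨dirichletToNeumann (fun x => Real.cos (φ x) - 1) x, ?_, ?_⟩⟩
  · rw [(hE x).deriv]
    exact hdec x hx
  · simpa only [comp_ofPhase_zero] using hf.hasDirichletToNeumann x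
  · have hxa : 0 < x - a := sub_pos.2 hx
    rw [le_div_iff₀ (Real.rpow_pos_of_pos hxa _)]
    rcases le_total (x - a) 1 with h1 | h1
    · calc _ ≤ M * 1 := by
            gcongr
            · exact hM x
            · exact Real.rpow_le_one hxa.le h1 hβ₀
        _ ≤ _ := by linarith
    · calc _ ≤ C / (x - a) ^ 2 * (x - a) ^ 2 := by
            gcongr
            · exact hCd x hx
            · rw [← Real.rpow_two]
              exact Real.rpow_le_rpow_of_exponent_le h1 hβ.le
        _ = C := by field_simp
        _ ≤ _ := by linarith
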